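/- **Setting.** Let $H$ be a positive semidefinite Hermitian matrix on $n$ qubits with spectral norm $\|H\|>0$ and normalized ground-state eigenpair $(\lambda_0,|\psi_0\rangle)$. Let $\mu\in\mathbb R$ and $\Delta>0$ satisfy $\lambda_0\le\mu-\Delta/2<\mu+\Delta/2\le\lambda_1$, where $\lambda_1$ is the smallest eigenvalue of $H$ on $\psi_0^\perp$ (if $n\geq 1$). Let $E\in\mathbb R$ be a known reference energy with $0\le\lambda_0-E\le\Delta/2$ (so $E=0$ if $\lambda_0\le\Delta/2$ already). Let $O_I$ be a unitary with $|\langle\psi_0|O_I|0^n\rangle|=\gamma>0$. Let $0\le\alpha\le1$ and $0<\varepsilon<1$. *Gates.* Elementary gates are unitaries on at most two qubits. The gate complexity of a unitary is the least number of elementary gates in a circuit for it on the same register. *$\alpha$-soft fast-forwarding.* A family of unitaries $O_H(t)$ on the system is fast-forwarded with parameters $(\tau,\alpha)$ and precision $\delta$ if, for all $|t|\le\tau$, $\|O_H(t)-e^{-iHt}\|\le\delta$ and $O_H(t)$ has gate complexity at most $A\,(C+(|t|\,\|H\|)^\alpha)$, where $A,C\ge0$. *Multi-level QSP.* Put $\tilde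 L=\lceil\log_2(\pi\|H\|/(4\Delta))\rceil$ and $t_\ell=2^\ell/\|H\|$. We assume $t_{\tilde L}\le\tau$. The method uses one ancilla qubit, $d+1$ symmetric phase factors $\varphi_j=\varphi_{d-j}$ ($d$ even) and a real shift $s$. One run resets all qubits to $|0\rangle$ and queries $O_I$ on the system. Then, for $\ell=1,\dots,\tilde L$, it applies the QETU circuit in which the ancilla rotations $e^{i\varphi_0X},\dots,e^{i\varphi_dX}$ alternate with controlled $O_H(t_\ell)$ and controlled $O_H(-t_\ell)$, each followed by an ancilla $Z$-rotation that shifts $H$ to $H-s$, and measures the ancilla. Outcome $0$ leads to the next level. Outcome $1$ means failure, and a new run is started. Success is declared after level $\tilde L$ (there is no clean-up filter). At most $N$ runs are made. **Theorem.** There are an absolute constant $K_0$ and, for each $\alpha\in[0,1]$, constants $K>0$ and $k\in\mathbb N$ depending only on $\alpha$, with the following property. Whenever $$\varepsilon\le\gamma^{-1}\,\Bigl(\log_2\frac{\pi\|H\|}{4\Delta}\Bigr)^{-1}\ln(3/2)\qquad\text{with }\ \frac{\pi\|H\|}{4\Delta}>1,$$ there are $d$, symmetric phase factors, a shift $s$,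 a number $N$ and a precision $\delta>0$, depending only on $\alpha,\|H\|,\Delta,\mu,E,\gamma,\varepsilon$, such that: * With exact evolutions and outcome $0$, the QETU circuit with time $t$ applies $g(\cos((H-s)t/2))$ up to a global phase. Here $g$ is an even real polynomial of degree at most $d$ with $|g-1|\le\gamma\varepsilon$ on $(\cos\frac\pi8,1]$, $|g|\le\gamma\varepsilon$ on $(0,\cos\frac\pi4)$ and $|g|\le1$ on $[-1,1]$. * For every $n$, $H$, $O_I$, $\tau$, $A$, $C$ and $O_H$ as in the setting with precision $\delta$, the multi-level method succeeds with probability at least $2/3$. Conditioned on success, the system register has fidelity $\langle\psi_0|\rho|\psi_0\rangle\ge1-\varepsilon$ with the ground state. In the worst case over the measurement outcomes, the cost is 1. at most $K_0\gamma^{-2}$ queries to $O_I$; 2. at most $K\,(1+A(1+C))\,S\,(1+\log(1+S))^k$ elementary gates (not counting those inside $O_I$), where $$S=\begin{cases}\gamma^{-2}\,\log(\|H\|/\Delta)\,(1+\log\varepsilon^{-1}),&\alpha=0,\\ \gamma^{-2}\,(\|H\|/\Delta)^\alpha\,(1+\log\varepsilon^{-1}),&0<\alpha\le1,\end{cases}$$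 that is, $\tilde{\mathcal O}(\gamma^{-2}\log(\|H\|/\Delta)\log\varepsilon^{-1})$ gates for $\alpha=0$ and $\tilde{\mathcal O}(\gamma^{-2}(\|H\|/\Delta)^\alpha\log\varepsilon^{-1})$ gates for $0<\alpha\le1$ (for, say, $\varepsilon\le1/2$); 3. one ancilla qubit. -/

import Mathlib

open scoped Matrix Matrix.Norms.L2Operator Kronecker ComplexOrder

noncomputable section

namespace MultiLevelQSP

/-! ### Qubit registers, elementary gates and gate complexity -/

/-- Operators on a register whose qubits are labelled by `ι`; the computational basis is
`ι → Bool`. The norm `‖·‖` of such a matrix is its operator norm for the Euclidean norm. -/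
abbrev Op (ι : Type) : Type := Matrix (ι → Bool) (ι → Bool) ℂ

/-- (Possibly unnormalized) pure states of a register whose qubits are labelled by `ι`. -/
abbrev Ket (ι : Type) : Type := EuclideanSpace ℂ (ι → Bool)

/-- The action of an operator on a state. -/
def act {ι : Type} [Fintype ι] [DecidableEq ι] (U : Op ι) (v : Ket ι) : Ket ι :=
  Matrix.toEuclideanCLM (𝕜 := ℂ) U v

/-- The computational basis state `|0…0⟩`. -/
def ketZero (ι : Type) [Fintype ι] [DecidableEq ι] : Ket ι :=
  EuclideanSpace.single (fun _ => false) 1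

/-- The operator `u` on `k` qubits, acting on the qubits `e 0, …, e (k - 1)` of a register and
trivially on all others. -/
def embed {ι : Type} [Fintype ι] [DecidableEq ι] {k : ℕ} (e : Fin k ↪ ι) (u : Op (Fin k)) :
    Op ι :=
  Matrix.of fun x y =>
    if ∀ i, (∀ j, e j ≠ i) → x i = y i then u (fun j => x (e j)) (fun j => y (e j)) else 0

/-- An elementary gate: a unitary acting on at most two qubits. -/
structure Gate (ι : Type) where
  arity : ℕ
  arity_le : arity ≤ 2
  wires : Fin arity ↪ ι
  op : Op (Fin arity)
  unitary : op ∈ Matrix.unitaryGroup (Fin arity → Bool) ℂ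

/-- The unitary implemented by a circuit, i.e. by a list of gates in the order of time. -/
def circuitOp {ι : Type} [Fintype ι] [DecidableEq ι] : List (Gate ι) → Op ι
  | [] => 1
  | g :: c => circuitOp c * embed g.wires g.op

/-- The gate complexity of an operator: the least number of elementary gates in a circuit on the
same register (no further qubits) that implements it; `⊤` if there is none. -/
def gateComplexity {ι : Type} [Fintype ι] [DecidableEq ι] (U : Op ι) : ℕ∞ :=
  ⨅ c : {c : List (Gate ι) // circuitOp c = U}, (c.1.length : ℕ∞)

/-! ### The Hamiltonian, its ground state and fast-forwarded evolution -/

/-- The exact evolution `e^{-iHt}`. -/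
def evolution {n : ℕ} (H : Op (Fin n)) (t : ℝ) : Op (Fin n) :=
  NormedSpace.exp ((-(Complex.I * (t : ℂ))) • H)

/-- `(lam, psi)` is the normalized ground-state eigenpair of `H`, with `lam ≤ μ - Δ/2`, and all
other eigenvalues (those belonging to eigenvectors orthogonal to `psi`) are at least `μ + Δ/2`. -/
structure IsGappedGroundState {n : ℕ} (H : Op (Fin n)) (μ Δ lam : ℝ) (psi : Ket (Fin n)) :
    Prop where
  norm_eq : ‖psi‖ = 1
  eigen : act H psi = (lam : ℂ) • psi
  ground_le : lam ≤ μ - Δ / 2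
  excited_ge : ∀ (lam' : ℝ) (v : Ket (Fin n)), v ≠ 0 → act H v = (lam' : ℂ) • v →
    inner ℂ psi v = 0 → μ + Δ / 2 ≤ lam'

/-- `O` is a fast-forwarded evolution of `H` with parameters `(τ, α)` and precision `δ`: for
`|t| ≤ τ` the unitary `O t` is `δ`-close to `e^{-iHt}` and has gate complexity at most
`A (C + (|t| ‖H‖)^α)`, where `C` is the overhead that does not depend on `t` and `‖H‖`. -/
structure IsFastForwarding {n : ℕ} (H : Op (Fin n)) (O : ℝ → Op (Fin n)) (τ α δ A C : ℝ) :
    Prop where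
  unitary : ∀ t, O t ∈ Matrix.unitaryGroup (Fin n → Bool) ℂ
  accurate : ∀ t, |t| ≤ τ → ‖O t - evolution H t‖ ≤ δ
  efficient : ∀ t, |t| ≤ τ → ∃ c : ℕ, gateComplexity (O t) ≤ c ∧
    (c : ℝ) ≤ A * (C + (|t| * ‖H‖) ^ α)

/-! ### One ancilla qubit next to `n` system qubits

The qubits of the whole machine are labelled by `Option (Fin n)`: the label `none` is the only
ancilla qubit and `some i` are the system qubits. -/

/-- The operator `a ⊗ U` (ancilla ⊗ system). -/
def tensorOp {n : ℕ} (a : Matrix Bool Bool ℂ) (U : Op (Fin n)) : Op (Option (Fin n)) :=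
  (a ⊗ₖ U).submatrix (fun x => (x none, fun i => x (some i))) (fun x => (x none, fun i => x (some i)))

/-- The projection `|b⟩⟨b|` on one qubit. -/
def projBit (b : Bool) : Matrix Bool Bool ℂ := Matrix.single b b 1

/-- The rotation `e^{iθX}` of the ancilla. -/
def rotX (n : ℕ) (θ : ℝ) : Op (Option (Fin n)) :=
  tensorOp (Matrix.of fun a b => if a = b then (Real.cos θ : ℂ) else Complex.I * Real.sin θ) 1

/-- The rotation `e^{iθZ}` of the ancilla. -/
def rotZ (n : ℕ) (θ : ℝ) : Op (Option (Fin n)) :=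
  tensorOp (Matrix.diagonal fun b =>
    if b then Complex.exp (-(Complex.I * θ)) else Complex.exp (Complex.I * θ)) 1

/-- `U` on the system, controlled by the ancilla being `|1⟩`. -/
def controlled {n : ℕ} (U : Op (Fin n)) : Op (Option (Fin n)) :=
  tensorOp (projBit false) 1 + tensorOp (projBit true) U

/-- The state `|b⟩ ⊗ v` (ancilla ⊗ system). -/
def withAncilla {n : ℕ} (b : Bool) (v : Ket (Fin n)) : Ket (Option (Fin n)) :=
  WithLp.toLp 2 fun x => if x none = b then v (fun i => x (some i)) else 0

/-- The system part `v_b` of `v = |0⟩ ⊗ v_0 + |1⟩ ⊗ v_1`. -/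
def systemPart {n : ℕ} (b : Bool) (v : Ket (Option (Fin n))) : Ket (Fin n) :=
  WithLp.toLp 2 fun y => v (fun q => q.elim b y)

/-! ### Quantum programs with intermediate measurements -/

/-- Programs on `n` system qubits and one ancilla qubit, with classical control by the outcomes of
measurements of the ancilla. A branch ends by declaring success or by giving up. -/
inductive Program (n : ℕ) : Type
  | succeed : Program n
  | giveUp : Program n
  /-- Reset all qubits to `|0⟩`, then continue. -/
  | reset : Program n → Program n
  /-- Query the oracle `O_I` on the system qubits, then continue. -/
  | oracle : Program n → Program n
  /-- Apply an operator to all qubits, then continue. -/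
  | apply : Op (Option (Fin n)) → Program n → Program n
  /-- Measure the ancilla; continue with the first program on outcome `0`, with the second one on
  outcome `1`. -/
  | measure : Program n → Program n → Program n

/-- The final states of the branches that declare success, for the oracle `OI` and a given initial
state. The states are unnormalized: the probability of a branch is its squared norm. -/
def Program.outputs {n : ℕ} (OI : Op (Fin n)) :
    Program n → Ket (Option (Fin n)) → List (Ket (Option (Fin n)))
  | .succeed, v => [v]
  | .giveUp, _ => []
  | .reset P, v => P.outputs OI ((‖v‖ : ℂ) • ketZero (Option (Fin n)))
  | .oracle P, v => P.outputs OI (act (tensorOp 1 OI) v)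
  | .apply U P, v => P.outputs OI (act U v)
  | .measure P Q, v =>
      P.outputs OI (act (tensorOp (projBit false) 1) v) ++
        Q.outputs OI (act (tensorOp (projBit true) 1) v)

/-- The probability that the program, started in `|0…0⟩`, declares success. -/
def Program.successProb {n : ℕ} (OI : Op (Fin n)) (P : Program n) : ℝ :=
  ((P.outputs OI (ketZero _)).map fun v => ‖v‖ ^ 2).sum

/-- The fidelity `⟨psi| ρ |psi⟩` of the state `ρ` of the system register, conditioned on success,
with the pure state `psi`. -/
def Program.fidelity {n : ℕ} (OI : Op (Fin n)) (P : Program n) (psi : Ket (Fin n)) : ℝ :=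
  ((P.outputs OI (ketZero _)).map fun v =>
    ∑ b : Bool, ‖inner ℂ psi (systemPart b v)‖ ^ 2).sum / P.successProb OI

/-- The number of queries to `O_I`, in the worst case over the measurement outcomes. -/
def Program.queryCount {n : ℕ} : Program n → ℕ
  | .succeed => 0
  | .giveUp => 0
  | .reset P => P.queryCount
  | .oracle P => P.queryCount + 1
  | .apply _ P => P.queryCount
  | .measure P Q => max P.queryCount Q.queryCount

/-- The number of elementary gates, in the worst case over the measurement outcomes. -/
def Program.gateCount {n : ℕ} : Program n → ℕ∞
  | .succeed => 0
  | .giveUp => 0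
  | .reset P => P.gateCount
  | .oracle P => P.gateCount
  | .apply U P => gateComplexity U + P.gateCount
  | .measure P Q => max P.gateCount Q.gateCount

/-- Apply a list of operators, in the order of time, then continue. -/
def Program.applyAll {n : ℕ} (l : List (Op (Option (Fin n)))) (P : Program n) : Program n :=
  l.foldr Program.apply P

/-! ### The multi-level method -/

/-- The QETU circuit of degree `2 m` with phase factors `φ 0, …, φ (2 m)` and evolution time `t`,
in the order of time: the rotations `e^{iφ_j X}` alternate with the controlled evolutions to the
times `t` and `-t`, which are queries to `O`. The `Z`-rotations shift the spectrum of the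
Hamiltonian `H` behind `O` to that of `H - s`. -/
def qetu {n : ℕ} (O : ℝ → Op (Fin n)) (s t : ℝ) (m : ℕ) (φ : ℕ → ℝ) :
    List (Op (Option (Fin n))) :=
  (List.range m).flatMap (fun j =>
    [rotX n (φ (2 * j)), controlled (O t), rotZ n (-(s * t / 2)),
      rotX n (φ (2 * j + 1)), controlled (O (-t)), rotZ n (s * t / 2)]) ++ [rotX n (φ (2 * m))]

/-- The levels of one run: for each time in the list, a QETU circuit followed by a measurement of
the ancilla; outcome `0` leads to the next level, outcome `1` to `restart`. -/
def levels {n : ℕ} (O : ℝ → Op (Fin n)) (s : ℝ) (m : ℕ) (φ : ℕ → ℝ) (restart : Program n) :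
    List ℝ → Program n
  | [] => .succeed
  | t :: ts => Program.applyAll (qetu O s t m φ) (.measure (levels O s m φ restart ts) restart)

/-- The multi-level method with intermediate measurements: prepare the initial guess and run
through the levels; start again after a failure, with `N` runs at most. -/
def multiLevel {n : ℕ} (O : ℝ → Op (Fin n)) (s : ℝ) (m : ℕ) (φ : ℕ → ℝ) (times : List ℝ) :
    ℕ → Program n
  | 0 => .giveUp
  | N + 1 => .reset (.oracle (levels O s m φ (multiLevel O s m φ times N) times))

/-- The stopping level `⌈log₂ (π R / (4 Δ))⌉`, where `R = ‖H‖`. -/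
def stopLevel (R Δ : ℝ) : ℕ := ⌈Real.logb 2 (Real.pi * R / (4 * Δ))⌉₊

/-- The evolution time `2 ^ ℓ / R` of level `ℓ`, where `R = ‖H‖`. -/
def levelTime (R : ℝ) (l : ℕ) : ℝ := 2 ^ l / R

/-- The evolution times of the levels `1, …, stopLevel R Δ`. -/
def levelTimes (R Δ : ℝ) : List ℝ :=
  (List.range (stopLevel R Δ)).map fun l => levelTime R (l + 1)

/-- `g` is an even real polynomial which is `η`-close to `1` on `(cos (π/8), 1]`, `η`-close to `0`
on `(0, cos (π/4))` and bounded by `1` on `[-1, 1]`. -/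
structure IsFilter (g : Polynomial ℝ) (η : ℝ) : Prop where
  even : g.comp (-Polynomial.X) = g
  accept : ∀ x : ℝ, Real.cos (Real.pi / 8) < x → x ≤ 1 → |g.eval x - 1| ≤ η
  reject : ∀ x : ℝ, 0 < x → x < Real.cos (Real.pi / 4) → |g.eval x| ≤ η
  bounded : ∀ x : ℝ, -1 ≤ x → x ≤ 1 → |g.eval x| ≤ 1

/-- With exact evolutions and outcome `0`, the QETU circuit with phase factors `φ 0, …, φ (2 m)`
applies `g (cos ((H - s) t / 2))` to the system, up to a global phase. -/
def QETURealizes (m : ℕ) (φ : ℕ → ℝ) (g : Polynomial ℝ) : Prop :=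
  ∃ c : ℂ, ‖c‖ = 1 ∧ ∀ (n : ℕ) (H : Op (Fin n)), H.IsHermitian → ∀ (s t lam : ℝ) (v : Ket (Fin n)),
    act H v = (lam : ℂ) • v →
    systemPart false ((qetu (evolution H) s t m φ).foldl (fun w U => act U w) (withAncilla false v)) =
      (c * ((g.eval (Real.cos ((lam - s) * t / 2)) : ℝ) : ℂ)) • v

/-- The argument of the soft-O bound on the number of gates. -/
def gateScale (α R Δ γ ε : ℝ) : ℝ :=
  (γ ^ 2)⁻¹ * (if α = 0 then Real.log (R / Δ) else (R / Δ) ^ α) * (1 + Real.log ε⁻¹)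

end MultiLevelQSP

end

open MultiLevelQSP

/-!
With the shift `s = min (μ - Δ) E`, the ground energy lies in `[s, s + Δ/2]` and every excited
energy in `[s + 3Δ/2, s + ‖H‖ + Δ/2]`. The angle `(λ - s) t / 2` of an energy doubles from level
to level. At the stopping level `t ≤ π/(2Δ)`, so that the angle of the ground state stays below
`π/8` on all levels (`ground_angle_le`), while that of an excited energy reaches `3π/16` sooner or
later, and on the first level where it does, it is still at most `π/2` (`exists_excited_angle`).
So a filter that is close to `1` at angles up to `π/8` and close to `0` at angles in
`[3π/16, π/2]`, and whose values all lie in `[0, 1]`, accepts the ground state on every level and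
rejects each excited energy on some level. The errors of the filter add up over the `L` levels, so its
precision is chosen as `η = γε/(64 L)`.

The filter is `x ↦ P(x²)`, where `P(y)` is the probability that a binomial variable with `4q`
trials of success probability `y` is at least `3q`. By the Chernoff bound it has precision
`0.97 ^ q`, since `cos² (3π/16) < 3/4 < cos² (π/8)` (`binomialTail_eval_le`,
`one_sub_binomialTail_eval_le`); so a degree of order `log η⁻¹` suffices. As `1 - P²` is
nonnegative on `[0, 1]`, it has a Markov–Lukács form `a² + y (1 - y) b²` (`lukacs_even`), and this
completes `P` to an `SU(2)`-valued function without `Z`-component. Every such function is a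
symmetric quantum signal processing sequence: a rotation in the plane of `P` and `a` makes all
degrees drop when one layer is removed on both sides (`exists_peel_rotation`,
`exists_symmetric_phases`). On an eigenvector of `H`, the QETU circuit is this sequence, applied
to the ancilla (`foldl_qetu`).

With exact evolutions, a run without failures therefore ends `η`-close to a multiple of the ground
state of norm about `γ` (`norm_act_successOp_evolution_sub_le`), and errors `δ` of the evolutions
add up to at most `L (6m + 1) δ` (`norm_successOp_sub_le`). The runs form a geometric series in
which all successful branches carry multiples of the same state (`branchSum_multiLevel`); so
`N = ⌈3/γ²⌉` runs give success probability `2/3`, and the fidelity is that of one run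
(`successProb_fidelity_of_close`, `multiLevel_success`).

The gate complexity of a controlled evolution is at most seven times that of the evolution: each
gate is diagonalized, and the controlled phases are distributed over pairs of qubits
(`exists_circuit_controlled_gate`). The costs of the levels add up to a multiple of `(‖H‖/Δ) ^ α`,
as a geometric sum, or of `log (‖H‖/Δ)`, as the number of levels, if `α = 0`
(`exists_sum_le_gapScale`); the degree of the filter contributes `log ε⁻¹` and a logarithm of the
gate scale (`degree_bound`).
-/

noncomputable section

namespace MultiLevelQSP

/-! ### Nonnegative polynomials on the unit interval -/

open Polynomial in
/-- The Markov–Lukács form of a polynomial of degree at most `2 m` that is nonnegative on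
`[0, 1]`. -/
def LukacsEven (m : ℕ) (w : ℝ[X]) : Prop :=
  ∃ a b : ℝ[X], a.degree < (m + 1 : ℕ) ∧ b.degree < (m : ℕ) ∧ w = a ^ 2 + X * (1 - X) * b ^ 2

open Polynomial in
/-- The Markov–Lukács form of a polynomial of degree at most `2 m + 1` that is nonnegative on
`[0, 1]`. -/
def LukacsOdd (m : ℕ) (w : ℝ[X]) : Prop :=
  ∃ a b : ℝ[X], a.degree < (m + 1 : ℕ) ∧ b.degree < (m + 1 : ℕ) ∧ w = X * a ^ 2 + (1 - X) * b ^ 2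

section
open Polynomial

theorem degree_C_mul_lt {c : ℝ} {p : ℝ[X]} {m : ℕ} (hp : p.degree < (m : ℕ)) :
    (C c * p).degree < (m : ℕ) := by
  rw [C_mul']; exact (degree_smul_le c p).trans_lt hp

theorem degree_mul_lt_succ {f p : ℝ[X]} {m : ℕ} (hf : f.natDegree ≤ 1)
    (hp : p.degree < (m : ℕ)) : (f * p).degree < (m + 1 : ℕ) := by
  rw [degree_lt_iff_coeff_zero] at hp ⊢
  intro k hk
  rcases eq_or_ne p 0 with rfl | h0
  · simp
  have hpd : p.natDegree < m := by
    by_contra h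
    exact h0 (leadingCoeff_eq_zero.1 (hp _ (not_lt.1 h)))
  exact coeff_eq_zero_of_natDegree_lt (lt_of_le_of_lt natDegree_mul_le (by omega))

theorem natDegree_one_sub_X_le : (1 - X : ℝ[X]).natDegree ≤ 1 := by compute_degree

/-- Markov–Lukács forms are closed under multiplication by the two-squares identity
`(u² + w v²) (a² + w b²) = (u a + w v b)² + w (u b - v a)²`, here and in the next three lemmas with
the weights `X` and `1 - X` distributed over the squares. -/
theorem LukacsEven.linear_mul {m : ℕ} {w : ℝ[X]} (hw : LukacsEven m w) {c d : ℝ} (hc : 0 ≤ c)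
    (hd : 0 ≤ d) : LukacsOdd m ((C c * X + C d * (1 - X)) * w) := by
  obtain ⟨a, b, ha, hb, rfl⟩ := hw
  refine ⟨C √c * a + C √d * ((1 - X) * b), C √d * a - C √c * (X * b), ?_, ?_, ?_⟩
  · exact (degree_add_le _ _).trans_lt (max_lt (degree_C_mul_lt ha)
      (degree_C_mul_lt (degree_mul_lt_succ natDegree_one_sub_X_le hb)))
  · exact (degree_sub_le _ _).trans_lt (max_lt (degree_C_mul_lt ha)
      (degree_C_mul_lt (degree_mul_lt_succ natDegree_X_le hb)))
  · have h1 : (C c : ℝ[X]) = C √c ^ 2 := by rw [← C_pow, Real.sq_sqrt hc]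
    have h2 : (C d : ℝ[X]) = C √d ^ 2 := by rw [← C_pow, Real.sq_sqrt hd]
    rw [h1, h2]; ring

theorem LukacsOdd.linear_mul {m : ℕ} {w : ℝ[X]} (hw : LukacsOdd m w) {c d : ℝ} (hc : 0 ≤ c)
    (hd : 0 ≤ d) : LukacsEven (m + 1) ((C c * X + C d * (1 - X)) * w) := by
  obtain ⟨a, b, ha, hb, rfl⟩ := hw
  refine ⟨C √c * (X * a) + C √d * ((1 - X) * b), C √d * a - C √c * b, ?_, ?_, ?_⟩
  · exact (degree_add_le _ _).trans_lt (max_lt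
      (degree_C_mul_lt (degree_mul_lt_succ natDegree_X_le ha))
      (degree_C_mul_lt (degree_mul_lt_succ natDegree_one_sub_X_le hb)))
  · exact (degree_sub_le _ _).trans_lt (max_lt (degree_C_mul_lt ha) (degree_C_mul_lt hb))
  · have h1 : (C c : ℝ[X]) = C √c ^ 2 := by rw [← C_pow, Real.sq_sqrt hc]
    have h2 : (C d : ℝ[X]) = C √d ^ 2 := by rw [← C_pow, Real.sq_sqrt hd]
    rw [h1, h2]; ring

theorem LukacsEven.quadratic_mul {m : ℕ} {w f : ℝ[X]} (hw : LukacsEven m w) {e : ℝ}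
    (hf : f.natDegree ≤ 1) :
    LukacsEven (m + 1) ((f ^ 2 + X * (1 - X) * C e ^ 2) * w) := by
  obtain ⟨a, b, ha, hb, rfl⟩ := hw
  refine ⟨f * a - C e * (X * ((1 - X) * b)), f * b + C e * a, ?_, ?_, ?_⟩
  · exact (degree_sub_le _ _).trans_lt (max_lt (degree_mul_lt_succ hf ha) (degree_C_mul_lt
      (degree_mul_lt_succ natDegree_X_le (degree_mul_lt_succ natDegree_one_sub_X_le hb))))
  · exact (degree_add_le _ _).trans_lt (max_lt (degree_mul_lt_succ hf hb) (degree_C_mul_lt ha))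
  · ring

theorem LukacsOdd.quadratic_mul {m : ℕ} {w f : ℝ[X]} (hw : LukacsOdd m w) {e : ℝ}
    (hf : f.natDegree ≤ 1) :
    LukacsOdd (m + 1) ((f ^ 2 + X * (1 - X) * C e ^ 2) * w) := by
  obtain ⟨a, b, ha, hb, rfl⟩ := hw
  refine ⟨f * a + C e * ((1 - X) * b), f * b - C e * (X * a), ?_, ?_, ?_⟩
  · exact (degree_add_le _ _).trans_lt (max_lt (degree_mul_lt_succ hf ha) (degree_C_mul_lt
      (degree_mul_lt_succ natDegree_one_sub_X_le hb)))
  · exact (degree_sub_le _ _).trans_lt (max_lt (degree_mul_lt_succ hf hb) (degree_C_mul_lt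
      (degree_mul_lt_succ natDegree_X_le ha)))
  · ring

/-- A quadratic without real roots has itself a Markov–Lukács form: completing the square in its
homogenization `α x² + 2 β x (1 - x) + γ (1 - x)²` leaves a nonnegative multiple of `x (1 - x)`. -/
theorem exists_quadratic_lukacs (p t : ℝ) (hpt : p ^ 2 ≤ t) :
    ∃ (f : ℝ[X]) (e : ℝ), f.natDegree ≤ 1 ∧
      X ^ 2 - C (2 * p) * X + C t = f ^ 2 + X * (1 - X) * C e ^ 2 := by
  have h1 : 0 ≤ 1 - 2 * p + t := by nlinarith [sq_nonneg (1 - p)]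
  have h2 : 0 ≤ t := (sq_nonneg p).trans hpt
  have h3 : 0 ≤ 2 * (t - p) + 2 * (√(1 - 2 * p + t) * √t) := by
    have : p - t ≤ √(1 - 2 * p + t) * √t := by
      rw [← Real.sqrt_mul h1]
      apply Real.le_sqrt_of_sq_le
      nlinarith
    linarith
  refine ⟨C √(1 - 2 * p + t) * X - C √t * (1 - X), √(2 * (t - p) + 2 * (√(1 - 2 * p + t) * √t)),
    by compute_degree, ?_⟩
  have e1 : (C √(1 - 2 * p + t) : ℝ[X]) ^ 2 = 1 - 2 * C p + C t := by
    rw [← C_pow, Real.sq_sqrt h1]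
    simp only [C_add, C_mul, C_sub, map_ofNat C 2, C_1]
  have e2 : (C √t : ℝ[X]) ^ 2 = C t := by rw [← C_pow, Real.sq_sqrt h2]
  rw [← C_pow, Real.sq_sqrt h3]
  have e0 : (C (2 : ℝ) : ℝ[X]) = 2 := map_ofNat C 2
  simp only [C_add, C_mul, C_sub, e0]
  linear_combination (-X ^ 2) * e1 - (1 - X) ^ 2 * e2

/-- Nonnegativity on `[0, 1]` extends to an exceptional point by continuity. -/
theorem eval_nonneg_of_ne {w : ℝ[X]} (r : ℝ)
    (h : ∀ x, 0 ≤ x → x ≤ 1 → x ≠ r → 0 ≤ w.eval x) {x : ℝ} (h0 : 0 ≤ x) (h1 : x ≤ 1) :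
    0 ≤ w.eval x := by
  by_contra hneg
  push Not at hneg
  have hx : x = r := by
    by_contra hne
    exact absurd (h x h0 h1 hne) (not_le.2 hneg)
  have hev : ∀ᶠ y in nhds x, w.eval y < 0 :=
    w.continuous.continuousAt.eventually_lt continuousAt_const hneg
  obtain ⟨δ, hδ, hball⟩ := Metric.eventually_nhds_iff.1 hev
  obtain ⟨y, hy0, hy1, hyx, hyd⟩ : ∃ y : ℝ, 0 ≤ y ∧ y ≤ 1 ∧ y ≠ x ∧ |y - x| < δ := by
    rcases le_total x (1 / 2) with hx2 | hx2
    · refine ⟨x + min (δ / 2) (1 / 2), ?_, ?_, ?_, ?_⟩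
      · positivity
      · linarith [min_le_right (δ / 2) (1 / 2)]
      · have : 0 < min (δ / 2) (1 / 2) := by positivity
        linarith
      · rw [add_sub_cancel_left, abs_of_nonneg (by positivity)]
        linarith [min_le_left (δ / 2) (1 / 2)]
    · refine ⟨x - min (δ / 2) (1 / 2), ?_, ?_, ?_, ?_⟩
      · linarith [min_le_right (δ / 2) (1 / 2)]
      · have : 0 < min (δ / 2) (1 / 2) := by positivity
        linarith
      · have : 0 < min (δ / 2) (1 / 2) := by positivity
        linarith
      · rw [sub_sub_cancel_left, abs_neg, abs_of_nonneg (by positivity)]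
        linarith [min_le_left (δ / 2) (1 / 2)]
  exact absurd (h y hy0 hy1 (hx ▸ hyx)) (not_le.2 (hball (by simpa [Real.dist_eq] using hyd)))

/-- A simultaneous induction on the degree, splitting off the factor that belongs to a complex root:
a quadratic for a nonreal root or for a (double) root in `(0, 1)`, and a linear polynomial that is
nonnegative on `[0, 1]` for any other real root. -/
theorem lukacs_aux (n : ℕ) : ∀ w : ℝ[X], w.natDegree ≤ n →
    (∀ x, 0 ≤ x → x ≤ 1 → 0 ≤ w.eval x) →
    (∀ m, n = 2 * m → LukacsEven m w) ∧ (∀ m, n = 2 * m + 1 → LukacsOdd m w) := by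
  induction n using Nat.strong_induction_on with
  | _ n ih =>
  intro w hdeg hpos
  -- a factor of degree at most one, of the form `c x + d (1 - x)`
  have linear : ∀ (c d : ℝ) (w' : ℝ[X]), 0 ≤ c → 0 ≤ d → 0 < n → w'.natDegree ≤ n - 1 →
      w = (C c * X + C d * (1 - X)) * w' → (∀ x, 0 ≤ x → x ≤ 1 → 0 ≤ w'.eval x) →
      (∀ m, n = 2 * m → LukacsEven m w) ∧ (∀ m, n = 2 * m + 1 → LukacsOdd m w) := by
    intro c d w' hc hd hn hw' hfac hpos'
    obtain ⟨h1, h2⟩ := ih (n - 1) (by omega) w' hw' hpos'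
    constructor
    · intro m hm
      obtain ⟨k, rfl⟩ : ∃ k, m = k + 1 := ⟨m - 1, by omega⟩
      rw [hfac]
      exact (h2 k (by omega)).linear_mul hc hd
    · intro m hm
      rw [hfac]
      exact (h1 m (by omega)).linear_mul hc hd
  -- a positive quadratic factor, itself in Markov–Lukács form
  have quadratic : ∀ (f : ℝ[X]) (e : ℝ) (w' : ℝ[X]), f.natDegree ≤ 1 → 2 ≤ n →
      w'.natDegree ≤ n - 2 →
      w = (f ^ 2 + X * (1 - X) * C e ^ 2) * w' → (∀ x, 0 ≤ x → x ≤ 1 → 0 ≤ w'.eval x) →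
      (∀ m, n = 2 * m → LukacsEven m w) ∧ (∀ m, n = 2 * m + 1 → LukacsOdd m w) := by
    intro f e w' hf hn hw' hfac hpos'
    obtain ⟨h1, h2⟩ := ih (n - 2) (by omega) w' hw' hpos'
    constructor
    · intro m hm
      obtain ⟨k, rfl⟩ : ∃ k, m = k + 1 := ⟨m - 1, by omega⟩
      rw [hfac]
      exact (h1 k (by omega)).quadratic_mul hf
    · intro m hm
      obtain ⟨k, rfl⟩ : ∃ k, m = k + 1 := ⟨m - 1, by omega⟩
      rw [hfac]
      exact (h2 k (by omega)).quadratic_mul hf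
  rcases Nat.eq_zero_or_pos n with rfl | hn
  · have hw : w = C (w.coeff 0) := eq_C_of_natDegree_eq_zero (by omega)
    have h0 : 0 ≤ w.coeff 0 := by
      have := hpos 0 le_rfl zero_le_one
      rw [hw] at this
      simpa using this
    refine ⟨fun m hm => ?_, fun m hm => by omega⟩
    obtain rfl : m = 0 := by omega
    refine ⟨C √(w.coeff 0), 0, ?_, ?_, ?_⟩
    · exact degree_C_le.trans_lt (by norm_num)
    · simp
    · rw [← C_pow, Real.sq_sqrt h0]
      simpa using hw
  -- a polynomial of lower degree is raised to degree `n` by the trivial factor `x + (1 - x) = 1`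
  rcases lt_or_eq_of_le hdeg with hlt | heq
  · exact linear 1 1 w zero_le_one zero_le_one hn (by omega) (by simp) hpos
  have hw0 : w ≠ 0 := by rintro rfl; simp at heq; omega
  obtain ⟨z, hz⟩ := IsAlgClosed.exists_aeval_eq_zero ℂ w (by
    rw [degree_eq_natDegree hw0, heq]; exact_mod_cast hn.ne')
  by_cases him : z.im = 0
  · -- a real root
    have hroot : w.IsRoot z.re := by
      have hzr : z = ((z.re : ℝ) : ℂ) := Complex.ext (by simp) (by simpa using him)
      rw [hzr] at hz
      have := hz
      rw [← Complex.coe_algebraMap, aeval_algebraMap_apply] at this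
      simpa [IsRoot] using this
    set r := z.re
    obtain ⟨w', hw'⟩ := dvd_iff_isRoot.2 hroot
    have hw'0 : w' ≠ 0 := by rintro rfl; simp at hw'; exact hw0 hw'
    have hd' : w'.natDegree = n - 1 := by
      have := congrArg natDegree hw'
      rw [natDegree_mul (X_sub_C_ne_zero r) hw'0, natDegree_X_sub_C] at this
      omega
    have hev : ∀ x, w.eval x = (x - r) * w'.eval x := fun x => by rw [hw']; simp
    rcases le_or_gt r 0 with hr | hr
    · refine linear (1 - r) (-r) w' (by linarith) (by linarith) hn hd'.le ?_ ?_
      · rw [hw']; congr 1; simp only [C_sub, C_neg, C_1]; ring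
      · intro x h0 h1
        refine eval_nonneg_of_ne r (fun y hy0 hy1 hyr => ?_) h0 h1
        have h := hpos y hy0 hy1
        rw [hev] at h
        have : 0 < y - r := by
          rcases lt_or_eq_of_le (hr.trans hy0) with h | h
          · linarith
          · exact absurd h.symm hyr
        exact nonneg_of_mul_nonneg_right h this
    rcases le_or_gt 1 r with hr1 | hr1
    · refine linear (r - 1) r (-w') (by linarith) (by linarith) hn
        (by rw [natDegree_neg]; omega) ?_ ?_
      · rw [hw']; simp only [C_sub, C_1]; ring
      · intro x h0 h1
        refine eval_nonneg_of_ne r (fun y hy0 hy1 hyr => ?_) h0 h1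
        have h := hpos y hy0 hy1
        rw [hev] at h
        have : 0 < r - y := by
          rcases lt_or_eq_of_le (hy1.trans hr1) with h | h
          · linarith
          · exact absurd h hyr
        rw [eval_neg]
        exact nonneg_of_mul_nonneg_right (by linarith) this
    · -- the sign change of `x - r` has to be compensated by a root of the cofactor
      have hroot' : w'.IsRoot r := by
        have hge : 0 ≤ w'.eval r := by
          refine ge_of_tendsto (w'.continuous.continuousAt.continuousWithinAt (s := Set.Ioi r)) ?_
          filter_upwards [Ioo_mem_nhdsGT hr1] with y hy
          have h := hpos y (by linarith [hy.1]) hy.2.le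
          rw [hev] at h
          exact nonneg_of_mul_nonneg_right h (by linarith [hy.1])
        have hle : w'.eval r ≤ 0 := by
          refine le_of_tendsto (w'.continuous.continuousAt.continuousWithinAt (s := Set.Iio r)) ?_
          filter_upwards [Ioo_mem_nhdsLT hr] with y hy
          have h := hpos y hy.1.le (by linarith [hy.2])
          rw [hev] at h
          by_contra hc
          push Not at hc
          have := mul_neg_of_neg_of_pos (sub_neg.2 hy.2) hc
          linarith
        exact le_antisymm hle hge
      obtain ⟨w'', hw''⟩ := dvd_iff_isRoot.2 hroot'
      have hw''0 : w'' ≠ 0 := by rintro rfl; simp at hw''; exact hw'0 hw''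
      have hd'' : w''.natDegree + 1 = n - 1 := by
        have := congrArg natDegree hw''
        rw [natDegree_mul (X_sub_C_ne_zero r) hw''0, natDegree_X_sub_C] at this
        omega
      refine quadratic (X - C r) 0 w'' (natDegree_X_sub_C_le r) (by omega) (by omega) ?_ ?_
      · rw [hw', hw'']; simp; ring
      · intro x h0 h1
        refine eval_nonneg_of_ne r (fun y hy0 hy1 hyr => ?_) h0 h1
        have h := hpos y hy0 hy1
        rw [hev, hw'', eval_mul, ← mul_assoc] at h
        have : 0 < (y - r) * (y - r) := mul_self_pos.2 (sub_ne_zero.2 hyr)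
        simp only [eval_sub, eval_X, eval_C] at h
        exact nonneg_of_mul_nonneg_right h this
  · -- a nonreal root
    obtain ⟨w', hw'⟩ := quadratic_dvd_of_aeval_eq_zero_im_ne_zero w hz him
    have hw'0 : w' ≠ 0 := by rintro rfl; simp at hw'; exact hw0 hw'
    have hqd : (X ^ 2 - C (2 * z.re) * X + C (‖z‖ ^ 2) : ℝ[X]).natDegree = 2 := by compute_degree!
    have hd' : 2 + w'.natDegree = n := by
      have := congrArg natDegree hw'
      rw [natDegree_mul (by rintro h; rw [h] at hqd; simp at hqd) hw'0, hqd] at this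
      omega
    have hnorm : ‖z‖ ^ 2 = z.re ^ 2 + z.im ^ 2 := by
      rw [← Complex.normSq_eq_norm_sq, Complex.normSq_apply]; ring
    obtain ⟨f, e, hf, hfe⟩ := exists_quadratic_lukacs z.re (‖z‖ ^ 2)
      (by rw [hnorm]; nlinarith [sq_nonneg z.im])
    refine quadratic f e w' hf (by omega) (by omega) (by rw [← hfe]; exact hw') ?_
    intro x h0 h1
    have h := hpos x h0 h1
    rw [hw', eval_mul] at h
    refine nonneg_of_mul_nonneg_right h ?_
    have : 0 < z.im ^ 2 := sq_pos_iff.2 him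
    simp only [eval_add, eval_sub, eval_mul, eval_pow, eval_X, eval_C]
    nlinarith [sq_nonneg (x - z.re)]

/-- The Markov–Lukács theorem for an even degree bound. -/
theorem lukacs_even {m : ℕ} {w : ℝ[X]} (hdeg : w.natDegree ≤ 2 * m)
    (hpos : ∀ x, 0 ≤ x → x ≤ 1 → 0 ≤ w.eval x) : LukacsEven m w :=
  (lukacs_aux (2 * m) w hdeg hpos).1 m rfl

end

/-! ### Symmetric quantum signal processing -/

/-- The one-qubit rotation `e^{iθX}`. -/
def expX (θ : ℝ) : Matrix Bool Bool ℂ :=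
  Matrix.of fun a b => if a = b then (Real.cos θ : ℂ) else Complex.I * Real.sin θ

/-- The one-qubit rotation `e^{iθZ}`. -/
def expZ (θ : ℝ) : Matrix Bool Bool ℂ :=
  Matrix.diagonal fun b =>
    if b then Complex.exp (-(Complex.I * θ)) else Complex.exp (Complex.I * θ)

/-- The matrix `p + i q X + i r Y`, which for `p² + q² + r² = 1` is a general element of `SU(2)`
without `Z`-component. -/
def spin (p q r : ℝ) : Matrix Bool Bool ℂ :=
  Matrix.of fun a b => if a = b then (p : ℂ) else Complex.I * q + (if a then -(r : ℂ) else r)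

/-- The signal processing sequence with `d` signal rotations `e^{± iωZ}` of alternating sign, the
first one in the order of time being `e^{iωZ}`. -/
def qspMat (φ : ℕ → ℝ) (ω : ℝ) : ℕ → Matrix Bool Bool ℂ
  | 0 => expX (φ 0)
  | d + 1 => expX (φ (d + 1)) * expZ ((-1) ^ d * ω) * qspMat φ ω d

theorem qspMat_succ_front (φ : ℕ → ℝ) (ω : ℝ) (d : ℕ) :
    qspMat φ ω (d + 1) = qspMat (fun j => φ (j + 1)) (-ω) d * expZ ω * expX (φ 0) := by
  induction d with
  | zero => simp [qspMat]
  | succ d ih =>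
    rw [qspMat, ih]
    conv_rhs => rw [qspMat]
    rw [show (-1 : ℝ) ^ (d + 1) * ω = (-1) ^ d * -ω by ring]
    simp only [Matrix.mul_assoc]

theorem qspMat_congr {φ ψ : ℕ → ℝ} {ω : ℝ} {d : ℕ} (h : ∀ j, j ≤ d → φ j = ψ j) :
    qspMat φ ω d = qspMat ψ ω d := by
  induction d with
  | zero => rw [qspMat, qspMat, h 0 le_rfl]
  | succ d ih => rw [qspMat, qspMat, h _ le_rfl, ih fun j hj => h j (hj.trans d.le_succ)]

theorem expX_eq_spin (θ : ℝ) : expX θ = spin (Real.cos θ) (Real.sin θ) 0 := by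
  ext a b; simp [expX, spin]

theorem expX_conj_spin (θ p q r : ℝ) :
    expX θ * spin p q r * expX θ =
      spin (p * Real.cos (2 * θ) - q * Real.sin (2 * θ))
        (q * Real.cos (2 * θ) + p * Real.sin (2 * θ)) r := by
  have h := Complex.sin_sq_add_cos_sq (θ : ℂ)
  have hI := Complex.I_sq
  ext a b
  cases a <;> cases b <;>
  simp [expX, spin, Matrix.mul_apply, Complex.sin_two_mul, Complex.cos_two_mul'] <;>
  first
  | linear_combination (2 * Complex.sin θ * Complex.cos θ * q + Complex.sin θ ^ 2 * p) * hI
  | linear_combination Complex.sin θ ^ 2 * (Complex.I * q - r) * hI + r * h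
  | linear_combination Complex.sin θ ^ 2 * (Complex.I * q + r) * hI - r * h

theorem expZ_conj_spin (ω p q r : ℝ) :
    expZ (-ω) * spin p q r * expZ ω =
      spin p (q * Real.cos (2 * ω) - r * Real.sin (2 * ω))
        (r * Real.cos (2 * ω) + q * Real.sin (2 * ω)) := by
  have h := Complex.sin_sq_add_cos_sq (ω : ℂ)
  have hI := Complex.I_sq
  have e1 : Complex.exp (Complex.I * ω) = Complex.cos ω + Complex.sin ω * Complex.I := by
    rw [mul_comm, Complex.exp_mul_I]
  have e2 : Complex.exp (-(Complex.I * ω)) = Complex.cos ω - Complex.sin ω * Complex.I := by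
    rw [mul_comm, ← neg_mul, Complex.exp_mul_I]; simp [sub_eq_add_neg]
  ext a b
  cases a <;> cases b <;>
  simp [expZ, spin, Matrix.mul_apply, Matrix.diagonal, Complex.sin_two_mul,
    Complex.cos_two_mul', e1, e2] <;>
  first
  | linear_combination p * h - p * Complex.sin ω ^ 2 * hI
  | linear_combination (Complex.sin ω ^ 2 * (Complex.I * q + r) -
      2 * Complex.sin ω * Complex.cos ω * q) * hI
  | linear_combination (Complex.sin ω ^ 2 * (Complex.I * q - r) +
      2 * Complex.sin ω * Complex.cos ω * q) * hI

/-- A plane vector of squared length `r²` can be rotated to the position `(0, r)`. -/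
theorem exists_rotation {p q r : ℝ} (h : p ^ 2 + q ^ 2 = r ^ 2) :
    ∃ θ : ℝ, p * Real.cos θ + q * Real.sin θ = 0 ∧ q * Real.cos θ - p * Real.sin θ = r := by
  rcases eq_or_ne r 0 with rfl | hr
  · have hp : p = 0 := by nlinarith [sq_nonneg p, sq_nonneg q]
    have hq : q = 0 := by nlinarith [sq_nonneg p, sq_nonneg q]
    exact ⟨0, by simp [hp, hq], by simp [hp, hq]⟩
  · have hz : ‖(⟨q / r, -(p / r)⟩ : ℂ)‖ = 1 := by
      rw [← sq_eq_sq₀ (norm_nonneg _) zero_le_one, ← Complex.normSq_eq_norm_sq, Complex.normSq_mk]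
      field_simp
      linarith
    have hz0 : (⟨q / r, -(p / r)⟩ : ℂ) ≠ 0 := by
      intro h0; rw [h0] at hz; simp at hz
    refine ⟨Complex.arg ⟨q / r, -(p / r)⟩, ?_, ?_⟩
    · rw [Complex.cos_arg hz0, Complex.sin_arg, hz]; field_simp; ring
    · rw [Complex.cos_arg hz0, Complex.sin_arg, hz]; field_simp; linarith

section
open Polynomial

theorem natDegree_le_of_degree_lt_succ {p : ℝ[X]} {m : ℕ}
    (h : p.degree < ((m + 1 : ℕ) : WithBot ℕ)) :
    p.natDegree ≤ m := by
  rw [degree_lt_iff_coeff_zero] at h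
  exact natDegree_le_iff_coeff_eq_zero.2 fun k hk => h k hk

theorem degree_lt_of_coeff_eq_zero {p : ℝ[X]} {m : ℕ} (h : p.degree < ((m + 1 : ℕ) : WithBot ℕ))
    (h0 : p.coeff m = 0) : p.degree < ((m : ℕ) : WithBot ℕ) := by
  rw [degree_lt_iff_coeff_zero] at h ⊢
  intro k hk
  rcases hk.eq_or_lt with rfl | hk
  · exact h0
  · exact h k hk

theorem degree_X_mul_lt {p : ℝ[X]} {m : ℕ} (h : p.degree < ((m : ℕ) : WithBot ℕ)) :
    (X * p).degree < ((m + 1 : ℕ) : WithBot ℕ) := degree_mul_lt_succ natDegree_X_le h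

/-- The degree reduction behind the layer-by-layer construction of the phases: after a suitable
rotation of the pair `(g, a)`, undoing one signal rotation on both sides lowers all degrees. -/
theorem exists_peel_rotation {m : ℕ} {g a b : ℝ[X]} (hg : g.degree < ((m + 2 : ℕ) : WithBot ℕ))
    (ha : a.degree < ((m + 2 : ℕ) : WithBot ℕ)) (hb : b.degree < ((m + 1 : ℕ) : WithBot ℕ))
    (h : g ^ 2 + a ^ 2 + X * (1 - X) * b ^ 2 = 1) :
    ∃ θ : ℝ, (C (Real.cos θ) * g + C (Real.sin θ) * a).degree < ((m + 1 : ℕ) : WithBot ℕ) ∧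
      (C (Real.cos θ) * a - C (Real.sin θ) * g - X * b).degree < ((m + 1 : ℕ) : WithBot ℕ) ∧
      (2 * (C (Real.cos θ) * a - C (Real.sin θ) * g - X * b) + b).degree <
        ((m : ℕ) : WithBot ℕ) := by
  have hXb : (X * b).degree < ((m + 2 : ℕ) : WithBot ℕ) := degree_X_mul_lt hb
  have hXbb : ∀ {k : ℕ}, b.degree < ((k + 1 : ℕ) : WithBot ℕ) →
      (X * b ^ 2).natDegree ≤ 2 * k + 1 := by
    intro k hbk
    refine natDegree_mul_le.trans ?_
    have := natDegree_pow_le_of_le 2 (natDegree_le_of_degree_lt_succ hbk)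
    have := natDegree_X_le (R := ℝ)
    omega
  have hrot : ∀ (θ : ℝ) {k : ℕ}, g.degree < ((k : ℕ) : WithBot ℕ) →
      a.degree < ((k : ℕ) : WithBot ℕ) →
      (C (Real.cos θ) * g + C (Real.sin θ) * a).degree < ((k : ℕ) : WithBot ℕ) ∧
      (C (Real.cos θ) * a - C (Real.sin θ) * g).degree < ((k : ℕ) : WithBot ℕ) := fun θ k h1 h2 =>
    ⟨(degree_add_le _ _).trans_lt (max_lt (degree_C_mul_lt h1) (degree_C_mul_lt h2)),
      (degree_sub_le _ _).trans_lt (max_lt (degree_C_mul_lt h2) (degree_C_mul_lt h1))⟩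
  have hid : ∀ θ : ℝ, (C (Real.cos θ) * g + C (Real.sin θ) * a) ^ 2 +
      (C (Real.cos θ) * a - C (Real.sin θ) * g - X * b) *
        (C (Real.cos θ) * a - C (Real.sin θ) * g + X * b) + X * b ^ 2 = 1 := by
    intro θ
    have hcs : (C (Real.cos θ) : ℝ[X]) ^ 2 + C (Real.sin θ) ^ 2 = 1 := by
      rw [← C_pow, ← C_pow, ← C_add, Real.cos_sq_add_sin_sq, C_1]
    linear_combination h + (g ^ 2 + a ^ 2) * hcs
  have two_mul_lt : ∀ {p q : ℝ[X]} {k : ℕ}, p.degree < ((k : ℕ) : WithBot ℕ) →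
      q.degree < ((k : ℕ) : WithBot ℕ) →
      (2 * p + q).degree < ((k : ℕ) : WithBot ℕ) := by
    intro p q k h1 h2
    rw [show (2 : ℝ[X]) = C 2 from (map_ofNat C 2).symm]
    exact (degree_add_le _ _).trans_lt (max_lt (degree_C_mul_lt h1) h2)
  have hbc : (X * b).coeff (m + 1) = b.coeff m := coeff_X_mul _ _
  -- the leading coefficient of the normalization condition
  have hlead : ∀ {k : ℕ}, g.degree < ((k + 2 : ℕ) : WithBot ℕ) →
      a.degree < ((k + 2 : ℕ) : WithBot ℕ) → b.degree < ((k + 1 : ℕ) : WithBot ℕ) →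
      g.coeff (k + 1) ^ 2 + a.coeff (k + 1) ^ 2 = b.coeff k ^ 2 := by
    intro k hgk hak hbk
    have htop := hid 0
    simp only [Real.cos_zero, Real.sin_zero, C_1, C_0, one_mul, zero_mul, add_zero,
      sub_zero] at htop
    have hc := congrArg (fun p => coeff p ((k + 1) + (k + 1))) htop
    have hXbk : (X * b).degree < ((k + 2 : ℕ) : WithBot ℕ) := degree_X_mul_lt hbk
    have hm := natDegree_le_of_degree_lt_succ ((degree_sub_le a (X * b)).trans_lt (max_lt hak hXbk))
    have hp := natDegree_le_of_degree_lt_succ ((degree_add_le a (X * b)).trans_lt (max_lt hak hXbk))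
    have hgn := natDegree_le_of_degree_lt_succ hgk
    simp only [coeff_add, sq g] at hc
    rw [coeff_mul_add_eq_of_natDegree_le hgn hgn, coeff_mul_add_eq_of_natDegree_le hm hp,
      coeff_eq_zero_of_natDegree_lt ((hXbb hbk).trans_lt (by omega : _ < k + 1 + (k + 1))),
      coeff_sub, coeff_add, coeff_X_mul, coeff_one, if_neg (by omega)] at hc
    linarith
  by_cases hβ : b.coeff m = 0
  · -- all leading coefficients vanish, and those of the next lower degree are cancelled instead
    have hb' := degree_lt_of_coeff_eq_zero hb hβ
    have h0 := hlead hg ha hb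
    have hg' := degree_lt_of_coeff_eq_zero hg
      (by nlinarith [sq_nonneg (g.coeff (m + 1)), sq_nonneg (a.coeff (m + 1))])
    have ha' := degree_lt_of_coeff_eq_zero ha
      (by nlinarith [sq_nonneg (g.coeff (m + 1)), sq_nonneg (a.coeff (m + 1))])
    obtain ⟨θ, h1⟩ : ∃ θ : ℝ, a.coeff m * Real.cos θ - g.coeff m * Real.sin θ -
        (X * b).coeff m = 0 := by
      rcases m with _ | k
      · obtain ⟨θ, h1, -⟩ := exists_rotation (p := -a.coeff 0) (q := g.coeff 0)
          (r := √((-a.coeff 0) ^ 2 + g.coeff 0 ^ 2)) (Real.sq_sqrt (by positivity)).symm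
        exact ⟨θ, by rw [coeff_X_mul_zero]; linarith⟩
      · obtain ⟨θ, -, h2⟩ := exists_rotation (hlead hg' ha' hb')
        exact ⟨θ, by rw [coeff_X_mul, h2, sub_self]⟩
    obtain ⟨hg1, ha1⟩ := hrot θ hg' ha'
    have hD := degree_lt_of_coeff_eq_zero
      ((degree_sub_le _ _).trans_lt (max_lt ha1 (degree_X_mul_lt hb'))) (by
        rw [coeff_sub, coeff_sub, coeff_C_mul, coeff_C_mul, ← h1]; ring)
    refine ⟨θ, hg1, hD.trans_le (by exact_mod_cast Nat.le_succ m), two_mul_lt hD hb'⟩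
  · obtain ⟨θ, h1, h2⟩ := exists_rotation (hlead hg ha hb)
    obtain ⟨hg1, ha1⟩ := hrot θ hg ha
    have hD : (C (Real.cos θ) * a - C (Real.sin θ) * g - X * b).degree <
        ((m + 1 : ℕ) : WithBot ℕ) := by
      apply degree_lt_of_coeff_eq_zero
      · exact (degree_sub_le _ _).trans_lt (max_lt ha1 hXb)
      · rw [coeff_sub, coeff_sub, coeff_C_mul, coeff_C_mul, hbc, ← h2]; ring
    have hG : (C (Real.cos θ) * g + C (Real.sin θ) * a).degree < ((m + 1 : ℕ) : WithBot ℕ) := by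
      apply degree_lt_of_coeff_eq_zero hg1
      rw [coeff_add, coeff_C_mul, coeff_C_mul, ← h1]; ring
    refine ⟨θ, hG, hD, degree_lt_of_coeff_eq_zero (two_mul_lt hD hb) ?_⟩
    -- the next coefficient of the normalization condition
    have hc := congrArg (fun p => coeff p (m + (m + 1))) (hid θ)
    have hGn := natDegree_pow_le_of_le 2 (natDegree_le_of_degree_lt_succ hG)
    have hS := natDegree_le_of_degree_lt_succ ((degree_add_le _ (X * b)).trans_lt (max_lt ha1 hXb))
    have hbn := natDegree_le_of_degree_lt_succ hb
    simp only [coeff_add] at hc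
    rw [coeff_eq_zero_of_natDegree_lt (hGn.trans_lt (by omega : _ < m + (m + 1))),
      coeff_mul_add_eq_of_natDegree_le (natDegree_le_of_degree_lt_succ hD) hS, ← add_assoc m m 1,
      coeff_X_mul, sq b, coeff_mul_add_eq_of_natDegree_le hbn hbn, coeff_one, if_neg (by omega),
      coeff_add, hbc] at hc
    have hat : (C (Real.cos θ) * a - C (Real.sin θ) * g).coeff (m + 1) = b.coeff m := by
      rw [coeff_sub, coeff_C_mul, coeff_C_mul, ← h2]; ring
    rw [hat] at hc
    rw [coeff_add, show (2 : ℝ[X]) = C 2 from (map_ofNat C 2).symm, coeff_C_mul]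
    apply mul_left_cancel₀ hβ
    linarith

/-- Completeness of symmetric quantum signal processing in the variable `x = cos² ω`: every
normalized triple of polynomials arises from a symmetric sequence of phases. -/
theorem exists_symmetric_phases (m : ℕ) : ∀ g a b : ℝ[X],
    g.degree < ((m + 1 : ℕ) : WithBot ℕ) → a.degree < ((m + 1 : ℕ) : WithBot ℕ) →
    b.degree < (m : WithBot ℕ) → g ^ 2 + a ^ 2 + X * (1 - X) * b ^ 2 = 1 →
    ∃ φ : ℕ → ℝ, (∀ j, j ≤ 2 * m → φ (2 * m - j) = φ j) ∧ ∀ ω : ℝ,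
      qspMat φ ω (2 * m) = spin (g.eval (Real.cos ω ^ 2)) (a.eval (Real.cos ω ^ 2))
        (Real.sin ω * Real.cos ω * b.eval (Real.cos ω ^ 2)) := by
  induction m with
  | zero =>
    intro g a b hg ha hb h
    obtain rfl : b = 0 := by
      rw [← degree_eq_bot]
      exact Nat.WithBot.lt_zero_iff.1 hb
    have hg0 := eq_C_of_natDegree_eq_zero (Nat.le_zero.1 (natDegree_le_of_degree_lt_succ hg))
    have ha0 := eq_C_of_natDegree_eq_zero (Nat.le_zero.1 (natDegree_le_of_degree_lt_succ ha))
    generalize g.coeff 0 = p at hg0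
    generalize a.coeff 0 = q at ha0
    subst hg0 ha0
    have hpq : (-q) ^ 2 + p ^ 2 = 1 ^ 2 := by
      have := congrArg (eval 0) h
      simp at this
      linarith
    obtain ⟨θ, h1, h2⟩ := exists_rotation hpq
    have hcs := Real.sin_sq_add_cos_sq θ
    refine ⟨fun _ => θ, fun _ _ => rfl, fun ω => ?_⟩
    simp only [mul_zero, qspMat, eval_C, eval_zero, expX_eq_spin]
    congr 1
    · linear_combination p * hcs - Real.sin θ * h1 - Real.cos θ * h2
    · linear_combination q * hcs + Real.cos θ * h1 - Real.sin θ * h2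
  | succ m ih =>
    intro g a b hg ha hb h
    obtain ⟨θ, h1, h2, h3⟩ := exists_peel_rotation hg ha hb h
    set g' := C (Real.cos θ) * g + C (Real.sin θ) * a with hg'
    set a' := C (Real.cos θ) * a - C (Real.sin θ) * g with ha'
    set b'' := 2 * (a' - X * b) + b with hb''
    have hcs : (C (Real.cos θ) : ℝ[X]) ^ 2 + C (Real.sin θ) ^ 2 = 1 := by
      rw [← C_pow, ← C_pow, ← C_add, Real.cos_sq_add_sin_sq, C_1]
    -- the triple left after removing one signal rotation on both sides is normalized again
    obtain ⟨φ, hsym, hφ⟩ := ih g' (X * b'' - (a' - X * b)) b'' h1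
      ((degree_sub_le _ _).trans_lt (max_lt (degree_X_mul_lt h3) h2)) h3 (by
        rw [hb'', ha', hg']
        linear_combination h + (g ^ 2 + a ^ 2) * hcs)
    -- `θ / 2` at both ends, because multiplication by `e^{iθX/2}` on both sides rotates by `θ`
    refine ⟨fun j => if j = 0 ∨ j = 2 * m + 2 then θ / 2 else φ (j - 1), ?_, fun ω => ?_⟩
    · intro j hj
      beta_reduce
      by_cases hj' : j = 0 ∨ j = 2 * m + 2
      · rw [if_pos (by omega), if_pos hj']
      · rw [if_neg (by omega), if_neg hj', ← hsym (j - 1) (by omega)]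
        congr 1
        omega
    · rw [show 2 * (m + 1) = 2 * m + 1 + 1 by ring, qspMat, qspMat_succ_front,
        qspMat_congr (ψ := φ) (fun j hj => by
          rw [if_neg (by omega), Nat.add_sub_cancel]), hφ, if_pos (by omega), if_pos (by simp)]
      have hodd : (-1 : ℝ) ^ (2 * m + 1) * ω = -ω := by
        rw [Odd.neg_one_pow ⟨m, rfl⟩, neg_one_mul]
      rw [hodd]
      have assoc : ∀ P Q S : Matrix Bool Bool ℂ,
          P * Q * (S * expZ ω * P) = P * (Q * S * expZ ω) * P :=
        fun P Q S => by simp only [Matrix.mul_assoc]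
      rw [assoc, expZ_conj_spin, expX_conj_spin, mul_div_cancel₀ θ (two_ne_zero)]
      have hs := Real.sin_sq ω
      have ht := Real.sin_sq_add_cos_sq θ
      simp only [Real.cos_neg, Real.sin_neg, hb'', ha', hg', eval_add, eval_sub, eval_mul, eval_C,
        eval_X, eval_ofNat, Real.sin_two_mul, Real.cos_two_mul]
      generalize eval (Real.cos ω ^ 2) g = p
      generalize eval (Real.cos ω ^ 2) a = q
      generalize eval (Real.cos ω ^ 2) b = r
      congr 1
      · linear_combination p * ht - 2 * Real.sin θ * Real.cos ω ^ 2 *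
          (2 * (Real.cos θ * q - Real.sin θ * p - Real.cos ω ^ 2 * r) + r) * hs
      · linear_combination q * ht + 2 * Real.cos θ * Real.cos ω ^ 2 *
          (2 * (Real.cos θ * q - Real.sin θ * p - Real.cos ω ^ 2 * r) + r) * hs
      · ring

end

/-! ### The filter polynomial -/

section
open Polynomial

/-- The probability that a binomial variable with `4 q` trials of success probability `x` is at
least `3 q`, as a polynomial in `x`. -/
def binomialTail (q : ℕ) : ℝ[X] :=
  ∑ j ∈ (Finset.range (4 * q + 1)).filter (3 * q ≤ ·), bernsteinPolynomial ℝ (4 * q) j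

theorem bernsteinPolynomial_eval (k j : ℕ) (x : ℝ) :
    (bernsteinPolynomial ℝ k j).eval x = k.choose j * x ^ j * (1 - x) ^ (k - j) := by
  simp [bernsteinPolynomial]

theorem bernsteinPolynomial_eval_nonneg (k j : ℕ) {x : ℝ} (h0 : 0 ≤ x) (h1 : x ≤ 1) :
    0 ≤ (bernsteinPolynomial ℝ k j).eval x := by
  rw [bernsteinPolynomial_eval]
  have := sub_nonneg.2 h1
  positivity

theorem natDegree_binomialTail_le (q : ℕ) : (binomialTail q).natDegree ≤ 4 * q := by
  refine natDegree_sum_le_of_forall_le _ _ fun j hj => ?_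
  have hj' : j ≤ 4 * q := by
    have := (Finset.mem_filter.1 hj).1
    rw [Finset.mem_range] at this
    omega
  rw [bernsteinPolynomial]
  refine natDegree_mul_le.trans ?_
  have h1 : (((4 * q).choose j : ℝ[X]) * X ^ j).natDegree ≤ j := by
    refine natDegree_mul_le.trans ?_
    rw [natDegree_natCast, zero_add, natDegree_X_pow]
  have h2 : ((1 - X : ℝ[X]) ^ (4 * q - j)).natDegree ≤ 4 * q - j := by
    have := natDegree_pow_le_of_le (4 * q - j) natDegree_one_sub_X_le
    omega
  omega

theorem binomialTail_eval (q : ℕ) (x : ℝ) : (binomialTail q).eval x =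
    ∑ j ∈ (Finset.range (4 * q + 1)).filter (3 * q ≤ ·),
      (bernsteinPolynomial ℝ (4 * q) j).eval x := by
  rw [binomialTail, eval_finsetSum]

theorem one_sub_binomialTail_eval (q : ℕ) (x : ℝ) : 1 - (binomialTail q).eval x =
    ∑ j ∈ (Finset.range (4 * q + 1)).filter (¬ 3 * q ≤ ·),
      (bernsteinPolynomial ℝ (4 * q) j).eval x := by
  rw [binomialTail_eval, sub_eq_iff_eq_add, add_comm, Finset.sum_filter_add_sum_filter_not,
    ← eval_finsetSum, bernsteinPolynomial.sum, eval_one]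

theorem binomialTail_eval_nonneg (q : ℕ) {x : ℝ} (h0 : 0 ≤ x) (h1 : x ≤ 1) :
    0 ≤ (binomialTail q).eval x := by
  rw [binomialTail_eval]
  exact Finset.sum_nonneg fun j _ => bernsteinPolynomial_eval_nonneg _ _ h0 h1

theorem binomialTail_eval_le_one (q : ℕ) {x : ℝ} (h0 : 0 ≤ x) (h1 : x ≤ 1) :
    (binomialTail q).eval x ≤ 1 := by
  rw [← sub_nonneg, one_sub_binomialTail_eval]
  exact Finset.sum_nonneg fun j _ => bernsteinPolynomial_eval_nonneg _ _ h0 h1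

/-- The Chernoff bound: the exponential moment with weight `y` dominates every part `s` of the
binomial distribution on which `y ^ (3 q) ≤ y ^ j`. -/
theorem sum_bernsteinPolynomial_le (q : ℕ) (s : Finset ℕ) (hs : s ⊆ Finset.range (4 * q + 1))
    {x y : ℝ} (h0 : 0 ≤ x) (h1 : x ≤ 1) (hy : 0 < y) (hsy : ∀ j ∈ s, y ^ (3 * q) ≤ y ^ j) :
    ∑ j ∈ s, (bernsteinPolynomial ℝ (4 * q) j).eval x ≤ ((x * y + (1 - x)) ^ 4 / y ^ 3) ^ q := by
  have hnn : ∀ j, 0 ≤ (bernsteinPolynomial ℝ (4 * q) j).eval x :=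
    fun j => bernsteinPolynomial_eval_nonneg _ _ h0 h1
  rw [div_pow, ← pow_mul, ← pow_mul, le_div_iff₀ (by positivity), add_pow, Finset.sum_mul]
  calc ∑ j ∈ s, (bernsteinPolynomial ℝ (4 * q) j).eval x * y ^ (3 * q)
      ≤ ∑ j ∈ s, (bernsteinPolynomial ℝ (4 * q) j).eval x * y ^ j :=
        Finset.sum_le_sum fun j hj => mul_le_mul_of_nonneg_left (hsy j hj) (hnn j)
    _ ≤ ∑ j ∈ Finset.range (4 * q + 1), (bernsteinPolynomial ℝ (4 * q) j).eval x * y ^ j :=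
        Finset.sum_le_sum_of_subset_of_nonneg hs fun j _ _ => mul_nonneg (hnn j) (by positivity)
    _ = _ := Finset.sum_congr rfl fun j _ => by rw [bernsteinPolynomial_eval, mul_pow]; ring

/-- The bound `0.692` is just above `cos² (3π/16)`; the weight `4/3` of the Chernoff bound is close
to the optimal one there. -/
theorem binomialTail_eval_le (q : ℕ) {x : ℝ} (h0 : 0 ≤ x) (h1 : x ≤ 0.692) :
    (binomialTail q).eval x ≤ 0.97 ^ q := by
  rw [binomialTail_eval]
  refine (sum_bernsteinPolynomial_le q _ (Finset.filter_subset _ _) h0 (by linarith)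
    (y := 4 / 3) (by norm_num) fun j hj => ?_).trans ?_
  · exact pow_le_pow_right₀ (by norm_num) (Finset.mem_filter.1 hj).2
  · have hm : x * (4 / 3) + (1 - x) ≤ 1.231 := by linarith
    have hn : 0 ≤ x * (4 / 3) + (1 - x) := by linarith
    refine pow_le_pow_left₀ (by positivity) ?_ q
    rw [div_le_iff₀ (by norm_num)]
    exact (pow_le_pow_left₀ hn hm 4).trans (by norm_num)

/-- The bound `0.853` is just below `cos² (π/8)`. -/
theorem one_sub_binomialTail_eval_le (q : ℕ) {x : ℝ} (h0 : 0.853 ≤ x) (h1 : x ≤ 1) :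
    1 - (binomialTail q).eval x ≤ 0.97 ^ q := by
  rw [one_sub_binomialTail_eval]
  refine (sum_bernsteinPolynomial_le q _ (Finset.filter_subset _ _) (by linarith) h1
    (y := 1 / 2) (by norm_num) fun j hj => ?_).trans ?_
  · exact pow_le_pow_of_le_one (by norm_num) (by norm_num) (not_le.1 (Finset.mem_filter.1 hj).2).le
  · have hm : x * (1 / 2) + (1 - x) ≤ 0.574 := by linarith
    have hn : 0 ≤ x * (1 / 2) + (1 - x) := by linarith
    refine pow_le_pow_left₀ (by positivity) ?_ q
    rw [div_le_iff₀ (by norm_num)]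
    exact (pow_le_pow_left₀ hn hm 4).trans (by norm_num)

/-- The filter polynomial `x ↦ binomialTail q (x²)` in the variable `x = cos θ`. -/
def filterPoly (q : ℕ) : ℝ[X] := (binomialTail q).comp (X ^ 2)

theorem filterPoly_eval (q : ℕ) (x : ℝ) :
    (filterPoly q).eval x = (binomialTail q).eval (x ^ 2) := by
  simp [filterPoly]

theorem natDegree_filterPoly_le (q : ℕ) : (filterPoly q).natDegree ≤ 2 * (4 * q) := by
  rw [filterPoly, natDegree_comp, natDegree_X_pow, mul_comm]
  exact Nat.mul_le_mul_left 2 (natDegree_binomialTail_le q)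

/-- The Markov–Lukács form of `1 - binomialTail²` supplies the other two components of the signal
processing sequence. -/
theorem exists_phases_filterPoly (q : ℕ) : ∃ φ : ℕ → ℝ,
    (∀ j, j ≤ 2 * (4 * q) → φ (2 * (4 * q) - j) = φ j) ∧
    ∀ ω : ℝ, qspMat φ ω (2 * (4 * q)) false false = ((filterPoly q).eval (Real.cos ω) : ℝ) := by
  obtain ⟨a, b, ha, hb, h⟩ := lukacs_even (m := 4 * q) (w := 1 - binomialTail q ^ 2) (by
      refine (natDegree_sub_le _ _).trans (max_le (by simp) ?_)
      exact natDegree_pow_le_of_le 2 (natDegree_binomialTail_le q))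
    (fun x h0 h1 => by
      have h2 := binomialTail_eval_nonneg q h0 h1
      have h3 := binomialTail_eval_le_one q h0 h1
      simp only [eval_sub, eval_one, eval_pow]
      nlinarith)
  obtain ⟨φ, hsym, hφ⟩ := exists_symmetric_phases (4 * q) (binomialTail q) a b
    ((degree_le_of_natDegree_le (natDegree_binomialTail_le q)).trans_lt
      (by exact_mod_cast Nat.lt_succ_self _)) ha hb (by linear_combination -h)
  exact ⟨φ, hsym, fun ω => by rw [hφ, filterPoly_eval]; simp [spin]⟩

theorem cos_pi_div_eight_sq_ge : (0.853 : ℝ) ≤ Real.cos (Real.pi / 8) ^ 2 := by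
  rw [Real.cos_sq, show 2 * (Real.pi / 8) = Real.pi / 4 by ring, Real.cos_pi_div_four]
  have : (1.414 : ℝ) ≤ √2 := Real.le_sqrt_of_sq_le (by norm_num)
  linarith

theorem cos_three_pi_div_sixteen_sq_le : Real.cos (3 * Real.pi / 16) ^ 2 ≤ (0.692 : ℝ) := by
  rw [Real.cos_sq, show 2 * (3 * Real.pi / 16) = Real.pi / 2 - Real.pi / 8 by ring,
    Real.cos_pi_div_two_sub, Real.sin_pi_div_eight]
  have h1 : (1.414 : ℝ) ≤ √2 := Real.le_sqrt_of_sq_le (by norm_num)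
  have h2 : √(2 - √2) ≤ 0.767 := by
    rw [Real.sqrt_le_left (by norm_num)]
    norm_num at h1 ⊢
    linarith
  linarith

theorem filterPoly_eval_nonneg (q : ℕ) {x : ℝ} (h : x ^ 2 ≤ 1) : 0 ≤ (filterPoly q).eval x := by
  rw [filterPoly_eval]; exact binomialTail_eval_nonneg q (sq_nonneg x) h

theorem filterPoly_eval_le_one (q : ℕ) {x : ℝ} (h : x ^ 2 ≤ 1) : (filterPoly q).eval x ≤ 1 := by
  rw [filterPoly_eval]; exact binomialTail_eval_le_one q (sq_nonneg x) h

theorem isFilter_filterPoly (q : ℕ) {η : ℝ} (hη : 0.97 ^ q ≤ η) : IsFilter (filterPoly q) η where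
  even := by simp [filterPoly, comp_assoc]
  accept x hx hx1 := by
    have hc : 0 ≤ Real.cos (Real.pi / 8) :=
      Real.cos_nonneg_of_mem_Icc ⟨by linarith [Real.pi_pos], by linarith [Real.pi_pos]⟩
    have h1 : x ^ 2 ≤ 1 := by nlinarith
    have h2 : 0.853 ≤ x ^ 2 := cos_pi_div_eight_sq_ge.trans (by gcongr)
    rw [abs_sub_comm, abs_of_nonneg (sub_nonneg.2 (filterPoly_eval_le_one q h1)), filterPoly_eval]
    exact (one_sub_binomialTail_eval_le q h2 h1).trans hη
  reject x hx hx1 := by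
    have h2 : x ^ 2 ≤ 0.692 := by
      have h3 : x ^ 2 ≤ Real.cos (Real.pi / 4) ^ 2 := by gcongr
      rw [Real.cos_pi_div_four, div_pow, Real.sq_sqrt zero_le_two] at h3
      exact h3.trans (by norm_num)
    rw [abs_of_nonneg (filterPoly_eval_nonneg q (h2.trans (by norm_num))), filterPoly_eval]
    exact (binomialTail_eval_le q (sq_nonneg x) h2).trans hη
  bounded x h0 h1 := by
    have h : x ^ 2 ≤ 1 := by nlinarith
    rw [abs_of_nonneg (filterPoly_eval_nonneg q h)]
    exact filterPoly_eval_le_one q h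

theorem filterPoly_eval_cos_mem (q : ℕ) (θ : ℝ) :
    0 ≤ (filterPoly q).eval (Real.cos θ) ∧ (filterPoly q).eval (Real.cos θ) ≤ 1 :=
  ⟨filterPoly_eval_nonneg q (Real.cos_sq_le_one θ), filterPoly_eval_le_one q (Real.cos_sq_le_one θ)⟩

theorem one_sub_filterPoly_eval_cos_le (q : ℕ) {θ : ℝ} (h0 : 0 ≤ θ) (h1 : θ ≤ Real.pi / 8) :
    1 - 0.97 ^ q ≤ (filterPoly q).eval (Real.cos θ) := by
  have hc : 0 ≤ Real.cos (Real.pi / 8) :=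
    Real.cos_nonneg_of_mem_Icc ⟨by linarith [Real.pi_pos], by linarith [Real.pi_pos]⟩
  have h2 : Real.cos (Real.pi / 8) ≤ Real.cos θ :=
    Real.cos_le_cos_of_nonneg_of_le_pi h0 (by linarith [Real.pi_pos]) h1
  rw [filterPoly_eval]
  linarith [one_sub_binomialTail_eval_le q (cos_pi_div_eight_sq_ge.trans
    (pow_le_pow_left₀ hc h2 2)) (Real.cos_sq_le_one θ)]

/-- The reject region of the filter is larger than required: it starts at the angle `3π/16`. -/
theorem filterPoly_eval_cos_le (q : ℕ) {θ : ℝ} (h0 : 3 * Real.pi / 16 ≤ θ) (h1 : θ ≤ Real.pi / 2) :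
    (filterPoly q).eval (Real.cos θ) ≤ 0.97 ^ q := by
  have hc : 0 ≤ Real.cos θ :=
    Real.cos_nonneg_of_mem_Icc ⟨by linarith [Real.pi_pos], h1⟩
  have h2 : Real.cos θ ≤ Real.cos (3 * Real.pi / 16) :=
    Real.cos_le_cos_of_nonneg_of_le_pi (by linarith [Real.pi_pos]) (by linarith [Real.pi_pos]) h0
  rw [filterPoly_eval]
  exact binomialTail_eval_le q (sq_nonneg _) ((pow_le_pow_left₀ hc h2 2).trans
    cos_three_pi_div_sixteen_sq_le)

end

/-! ### Operators acting on states -/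

section
variable {ι : Type} [Fintype ι] [DecidableEq ι]

theorem act_apply (U : Op ι) (v : Ket ι) (x : ι → Bool) : act U v x = ∑ y, U x y * v y := by
  rw [act, Matrix.ofLp_toEuclideanCLM]
  rfl

theorem act_mul (U V : Op ι) (v : Ket ι) : act (U * V) v = act U (act V v) := by
  simp [act]

theorem act_one (v : Ket ι) : act (1 : Op ι) v = v := by
  simp [act]

theorem act_add (U V : Op ι) (v : Ket ι) : act (U + V) v = act U v + act V v := by
  simp [act]

theorem act_sub (U V : Op ι) (v : Ket ι) : act (U - V) v = act U v - act V v := by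
  simp [act]

theorem act_smul (U : Op ι) (c : ℂ) (v : Ket ι) : act U (c • v) = c • act U v := by
  simp [act]

theorem act_add_right (U : Op ι) (v w : Ket ι) : act U (v + w) = act U v + act U w := by
  simp [act]

theorem act_sub_right (U : Op ι) (v w : Ket ι) : act U (v - w) = act U v - act U w := by
  simp [act]

theorem norm_act_le (U : Op ι) (v : Ket ι) : ‖act U v‖ ≤ ‖U‖ * ‖v‖ := by
  rw [act, Matrix.l2_opNorm_def]
  exact ContinuousLinearMap.le_opNorm _ v

theorem opNorm_le_of_forall_norm_act_le {U : Op ι} {C : ℝ} (hC : 0 ≤ C)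
    (h : ∀ v, ‖act U v‖ ≤ C * ‖v‖) : ‖U‖ ≤ C := by
  rw [Matrix.l2_opNorm_def]
  exact ContinuousLinearMap.opNorm_le_bound _ hC h

theorem norm_act_of_unitary {U : Op ι} (hU : U ∈ Matrix.unitaryGroup (ι → Bool) ℂ) (v : Ket ι) :
    ‖act U v‖ = ‖v‖ := by
  have h : act (star U) (act U v) = v := by
    rw [← act_mul, Matrix.mem_unitaryGroup_iff'.1 hU, act_one]
  have h1 : ‖star U‖ = ‖U‖ := norm_star U
  have h2 : ‖U‖ ≤ 1 := by
    rcases subsingleton_or_nontrivial (Op ι) with hs | hs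
    · rw [Subsingleton.elim U 0, norm_zero]; exact zero_le_one
    · exact (CStarRing.norm_of_mem_unitary hU).le
  refine le_antisymm ((norm_act_le U v).trans (mul_le_of_le_one_left (norm_nonneg v) h2)) ?_
  conv_lhs => rw [← h]
  exact (norm_act_le _ _).trans (mul_le_of_le_one_left (norm_nonneg _) (h1 ▸ h2))

theorem norm_ketZero : ‖ketZero ι‖ = 1 := by simp [ketZero]

end

section
variable {n : ℕ}

theorem evolution_mem_unitaryGroup (H : Op (Fin n)) (hH : H.IsHermitian) (t : ℝ) :
    evolution H t ∈ Matrix.unitaryGroup (Fin n → Bool) ℂ := by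
  let _ : NormedAlgebra ℚ (Op (Fin n)) := NormedAlgebra.restrictScalars ℚ ℂ _
  apply NormedSpace.exp_mem_unitary_of_mem_skewAdjoint
  rw [skewAdjoint.mem_iff, star_smul, show star H = H from hH]
  simp

theorem act_evolution {H : Op (Fin n)} {lam : ℝ} {v : Ket (Fin n)} (h : act H v = (lam : ℂ) • v)
    (t : ℝ) : act (evolution H t) v = Complex.exp (-(Complex.I * (lam * t))) • v := by
  have hpow : ∀ k : ℕ, act (H ^ k) v = (lam : ℂ) ^ k • v := by
    intro k
    induction k with
    | zero => simp [act_one]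
    | succ k ih => rw [pow_succ, act_mul, h, act_smul, ih, smul_smul, pow_succ, mul_comm]
  let _ : NormedAlgebra ℚ (Op (Fin n)) := NormedAlgebra.restrictScalars ℚ ℂ _
  have hs := NormedSpace.exp_series_hasSum_exp' (𝕂 := ℂ) ((-(Complex.I * (t : ℂ))) • H)
  have hs' := NormedSpace.exp_series_hasSum_exp' (𝕂 := ℂ) (-(Complex.I * (lam * t)))
  rw [← Complex.exp_eq_exp_ℂ] at hs'
  let L : Op (Fin n) →ₗ[ℂ] Ket (Fin n) :=
    { toFun := fun A => act A v, map_add' := fun A B => act_add A B v,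
      map_smul' := fun c A => by simp [act] }
  have hL : Continuous L := L.continuous_of_finiteDimensional
  refine (hs.map L hL).unique ?_
  convert hs'.smul_const v using 1
  ext k : 1
  simp only [Function.comp_apply, map_smul, smul_pow]
  change _ • _ • act (H ^ k) v = _
  rw [hpow, smul_smul, smul_smul]
  congr 1
  simp only [smul_eq_mul]
  ring

/-- The product state of the ancilla state `q` and the system state `v`. -/
def ketTensor (q : Bool → ℂ) (v : Ket (Fin n)) : Ket (Option (Fin n)) :=
  WithLp.toLp 2 fun x => q (x none) * v (fun i => x (some i))

/-- Basis states of the machine as pairs of an ancilla bit and a basis state of the system. -/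
def splitEquiv (n : ℕ) : (Option (Fin n) → Bool) ≃ Bool × (Fin n → Bool) where
  toFun x := (x none, fun i => x (some i))
  invFun p q := q.elim p.1 p.2
  left_inv x := by ext q; cases q <;> rfl
  right_inv p := rfl

theorem tensorOp_apply (a : Matrix Bool Bool ℂ) (U : Op (Fin n)) (x y : Option (Fin n) → Bool) :
    tensorOp a U x y = a (x none) (y none) * U (fun i => x (some i)) (fun i => y (some i)) := rfl

theorem sum_split {M : Type*} [AddCommMonoid M] (f : (Option (Fin n) → Bool) → M) :
    ∑ x, f x = ∑ b : Bool, ∑ y : Fin n → Bool, f (fun q => q.elim b y) := by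
  rw [← Fintype.sum_prod_type', ← (splitEquiv n).symm.sum_comp]
  rfl

theorem act_tensorOp_apply (a : Matrix Bool Bool ℂ) (U : Op (Fin n)) (w : Ket (Option (Fin n)))
    (b : Bool) : systemPart b (act (tensorOp a U) w) = ∑ c, a b c • act U (systemPart c w) := by
  ext y
  simp only [systemPart, act_apply, sum_split, tensorOp_apply]
  simp [act_apply, Finset.mul_sum, mul_assoc]

theorem act_tensorOp_ketTensor (a : Matrix Bool Bool ℂ) (U : Op (Fin n)) (q : Bool → ℂ)
    (v : Ket (Fin n)) : act (tensorOp a U) (ketTensor q v) = ketTensor (a *ᵥ q) (act U v) := by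
  ext x
  simp only [ketTensor, act_apply, sum_split, tensorOp_apply, Matrix.mulVec, dotProduct]
  rw [Finset.sum_mul]
  refine Finset.sum_congr rfl fun b _ => ?_
  rw [Finset.mul_sum]
  refine Finset.sum_congr rfl fun y _ => ?_
  simp only [Option.elim]
  ring

theorem norm_sq_eq_sum_systemPart (w : Ket (Option (Fin n))) :
    ‖w‖ ^ 2 = ∑ b, ‖systemPart b w‖ ^ 2 := by
  simp only [EuclideanSpace.norm_sq_eq, sum_split]
  rfl

end

/-! ### The action of the QETU circuit -/

section
variable {n : ℕ}

theorem ketTensor_smul (q : Bool → ℂ) (c : ℂ) (v : Ket (Fin n)) :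
    ketTensor q (c • v) = ketTensor (c • q) v := by
  ext x; simp [ketTensor]; ring

theorem ketTensor_add (q r : Bool → ℂ) (v : Ket (Fin n)) :
    ketTensor q v + ketTensor r v = ketTensor (q + r) v := by
  ext x; simp [ketTensor]; ring

theorem withAncilla_eq_ketTensor (b : Bool) (v : Ket (Fin n)) :
    withAncilla b v = ketTensor (Pi.single b 1) v := by
  ext x; simp [withAncilla, ketTensor, Pi.single_apply]

theorem systemPart_ketTensor (b : Bool) (q : Bool → ℂ) (v : Ket (Fin n)) :
    systemPart b (ketTensor q v) = q b • v := by
  ext y; simp [systemPart, ketTensor]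

theorem rotX_eq (θ : ℝ) : rotX n θ = tensorOp (expX θ) 1 := rfl

theorem rotZ_eq (θ : ℝ) : rotZ n θ = tensorOp (expZ θ) 1 := rfl

theorem act_rotX_ketTensor (θ : ℝ) (q : Bool → ℂ) (v : Ket (Fin n)) :
    act (rotX n θ) (ketTensor q v) = ketTensor (expX θ *ᵥ q) v := by
  rw [rotX_eq, act_tensorOp_ketTensor, act_one]

theorem act_rotZ_ketTensor (θ : ℝ) (q : Bool → ℂ) (v : Ket (Fin n)) :
    act (rotZ n θ) (ketTensor q v) = ketTensor (expZ θ *ᵥ q) v := by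
  rw [rotZ_eq, act_tensorOp_ketTensor, act_one]

theorem act_controlled_ketTensor {U : Op (Fin n)} {z : ℂ} {v : Ket (Fin n)} (h : act U v = z • v)
    (q : Bool → ℂ) : act (controlled U) (ketTensor q v) =
      ketTensor (Matrix.diagonal (fun b => if b then z else 1) *ᵥ q) v := by
  rw [controlled, act_add, act_tensorOp_ketTensor, act_tensorOp_ketTensor, act_one, h,
    ketTensor_smul, ketTensor_add]
  congr 1
  ext b
  cases b <;> simp [projBit, Matrix.mulVec, dotProduct, Matrix.single_apply, Matrix.diagonal]

/-- The controlled evolution followed by the shift acts like a signal rotation, up to a phase. -/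
theorem expZ_mul_diagonal (s t lam : ℝ) :
    expZ (-(s * t / 2)) *
        Matrix.diagonal (fun b : Bool => if b then Complex.exp (-(Complex.I * (lam * t))) else 1) =
      Complex.exp (-(Complex.I * (lam * t / 2))) • expZ ((lam - s) * t / 2) := by
  rw [expZ, expZ, Matrix.diagonal_mul_diagonal, ← Matrix.diagonal_smul]
  congr 1
  ext b
  cases b <;> simp only [Bool.false_eq_true, if_true, if_false, Pi.smul_apply, smul_eq_mul, mul_one,
    ← Complex.exp_add] <;> congr 1 <;> push_cast <;> ring

/-- The operators of `qetu` before the last rotation. -/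
def qetuBlocks (O : ℝ → Op (Fin n)) (s t : ℝ) (m : ℕ) (φ : ℕ → ℝ) : List (Op (Option (Fin n))) :=
  (List.range m).flatMap (fun j =>
    [rotX n (φ (2 * j)), controlled (O t), rotZ n (-(s * t / 2)),
      rotX n (φ (2 * j + 1)), controlled (O (-t)), rotZ n (s * t / 2)])

theorem qetuBlocks_succ (O : ℝ → Op (Fin n)) (s t : ℝ) (m : ℕ) (φ : ℕ → ℝ) :
    qetuBlocks O s t (m + 1) φ = qetuBlocks O s t m φ ++
      [rotX n (φ (2 * m)), controlled (O t), rotZ n (-(s * t / 2)),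
      rotX n (φ (2 * m + 1)), controlled (O (-t)), rotZ n (s * t / 2)] := by
  simp [qetuBlocks, List.range_succ]

theorem foldl_qetuBlocks {H : Op (Fin n)} {lam : ℝ} {v : Ket (Fin n)} (h : act H v = (lam : ℂ) • v)
    (s t : ℝ) (φ : ℕ → ℝ) (q : Bool → ℂ) (m : ℕ) : ∃ q' : Bool → ℂ,
    (qetuBlocks (evolution H) s t m φ).foldl (fun w U => act U w) (ketTensor q v) = ketTensor q' v ∧
    expX (φ (2 * m)) *ᵥ q' = qspMat φ ((lam - s) * t / 2) (2 * m) *ᵥ q := by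
  induction m with
  | zero => exact ⟨q, by simp [qetuBlocks], by simp [qspMat]⟩
  | succ m ih =>
    obtain ⟨q', h1, h2⟩ := ih
    refine ⟨expZ (-((lam - s) * t / 2)) *ᵥ expX (φ (2 * m + 1)) *ᵥ expZ ((lam - s) * t / 2) *ᵥ
        expX (φ (2 * m)) *ᵥ q', ?_, ?_⟩
    · have hp := expZ_mul_diagonal s t lam
      have hm := expZ_mul_diagonal s (-t) lam
      rw [show -(s * -t / 2) = s * t / 2 by ring,
        show (lam - s) * -t / 2 = -((lam - s) * t / 2) by ring] at hm
      rw [qetuBlocks_succ, List.foldl_append, h1]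
      simp only [List.foldl_cons, List.foldl_nil, act_rotX_ketTensor, act_rotZ_ketTensor,
        act_controlled_ketTensor (act_evolution h _)]
      congr 1
      simp only [Matrix.mulVec_mulVec, ← Matrix.mul_assoc]
      rw [hm]
      simp only [Matrix.mul_assoc]
      rw [← Matrix.mul_assoc (expZ (-(s * t / 2))), hp]
      simp only [Matrix.smul_mul, Matrix.mul_smul, smul_smul, ← Complex.exp_add]
      rw [show -(Complex.I * (lam * t / 2)) + -(Complex.I * (lam * ((-t : ℝ) : ℂ) / 2)) = 0 by
        push_cast; ring, Complex.exp_zero, one_smul]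
    · rw [h2, show 2 * (m + 1) = 2 * m + 1 + 1 by ring, qspMat, qspMat]
      simp only [Matrix.mulVec_mulVec, Matrix.mul_assoc]
      congr 4
      · rw [Odd.neg_one_pow ⟨m, rfl⟩, neg_one_mul]
      · rw [Even.neg_one_pow ⟨m, by ring⟩, one_mul]

/-- On an eigenvector of `H`, the QETU circuit is a signal processing sequence of the ancilla. -/
theorem foldl_qetu {H : Op (Fin n)} {lam : ℝ} {v : Ket (Fin n)} (h : act H v = (lam : ℂ) • v)
    (s t : ℝ) (φ : ℕ → ℝ) (q : Bool → ℂ) (m : ℕ) :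
    (qetu (evolution H) s t m φ).foldl (fun w U => act U w) (ketTensor q v) =
      ketTensor (qspMat φ ((lam - s) * t / 2) (2 * m) *ᵥ q) v := by
  obtain ⟨q', h1, h2⟩ := foldl_qetuBlocks h s t φ q m
  rw [← h2, ← act_rotX_ketTensor, ← h1, qetu, List.foldl_append]
  rfl

end

theorem qetuRealizes_of_qspMat {m : ℕ} {φ : ℕ → ℝ} {g : Polynomial ℝ}
    (h : ∀ ω : ℝ, qspMat φ ω (2 * m) false false = (g.eval (Real.cos ω) : ℝ)) :
    QETURealizes m φ g := by
  refine ⟨1, norm_one, fun n H _ s t lam v hv => ?_⟩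
  rw [withAncilla_eq_ketTensor, foldl_qetu hv, systemPart_ketTensor, Matrix.mulVec_single_one,
    one_mul, Matrix.col_apply, h]

/-! ### Unitarity of the circuit -/

section
variable {n : ℕ}

theorem tensorOp_mul (a b : Matrix Bool Bool ℂ) (U V : Op (Fin n)) :
    tensorOp a U * tensorOp b V = tensorOp (a * b) (U * V) := by
  ext x y
  simp only [Matrix.mul_apply, tensorOp_apply, sum_split, Option.elim, Finset.sum_mul_sum]
  exact Finset.sum_congr rfl fun _ _ => Finset.sum_congr rfl fun _ _ => by ring

theorem tensorOp_one : tensorOp (1 : Matrix Bool Bool ℂ) (1 : Op (Fin n)) = 1 := by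
  ext x y
  rw [tensorOp_apply, Matrix.one_apply, Matrix.one_apply, Matrix.one_apply]
  by_cases h : x = y
  · simp [h]
  · rw [if_neg h]
    by_contra hne
    apply h
    ext q
    cases q <;> simp_all [funext_iff]

theorem star_tensorOp (a : Matrix Bool Bool ℂ) (U : Op (Fin n)) :
    star (tensorOp a U) = tensorOp (star a) (star U) := by
  ext x y
  simp [tensorOp_apply, Matrix.star_apply]

theorem tensorOp_mem_unitaryGroup {a : Matrix Bool Bool ℂ} {U : Op (Fin n)}
    (ha : a ∈ Matrix.unitaryGroup Bool ℂ) (hU : U ∈ Matrix.unitaryGroup (Fin n → Bool) ℂ) :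
    tensorOp a U ∈ Matrix.unitaryGroup (Option (Fin n) → Bool) ℂ := by
  rw [Matrix.mem_unitaryGroup_iff, star_tensorOp, tensorOp_mul, Matrix.mem_unitaryGroup_iff.1 ha,
    Matrix.mem_unitaryGroup_iff.1 hU, tensorOp_one]

theorem expX_mem_unitaryGroup (θ : ℝ) : expX θ ∈ Matrix.unitaryGroup Bool ℂ := by
  rw [Matrix.mem_unitaryGroup_iff]
  have h := Complex.sin_sq_add_cos_sq (θ : ℂ)
  have hI := Complex.I_sq
  ext a b
  cases a <;> cases b <;>
  simp [expX, Matrix.mul_apply, ← Complex.cos_conj, ← Complex.sin_conj] <;>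
  first
  | linear_combination h - Complex.sin θ ^ 2 * hI
  | ring

theorem expZ_mem_unitaryGroup (θ : ℝ) : expZ θ ∈ Matrix.unitaryGroup Bool ℂ := by
  rw [Matrix.mem_unitaryGroup_iff]
  ext a b
  cases a <;> cases b <;>
  simp [expZ, Matrix.mul_apply, Matrix.diagonal, ← Complex.exp_conj, ← Complex.exp_add]

theorem controlled_mul (U V : Op (Fin n)) : controlled U * controlled V = controlled (U * V) := by
  simp only [controlled, mul_add, add_mul, tensorOp_mul]
  have h : ∀ b c, projBit b * projBit c = if b = c then projBit b else 0 := by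
    intro b c
    ext i j
    cases b <;> cases c <;> simp [projBit]
  have h0 : ∀ W : Op (Fin n), tensorOp 0 W = 0 := fun W => by ext x y; simp [tensorOp_apply]
  simp [h, h0]

theorem controlled_one : controlled (1 : Op (Fin n)) = 1 := by
  rw [← tensorOp_one]
  ext x y
  rw [controlled, Matrix.add_apply, tensorOp_apply, tensorOp_apply, tensorOp_apply, ← add_mul]
  congr 1
  cases x none <;> cases y none <;> simp [projBit]

theorem star_controlled (U : Op (Fin n)) : star (controlled U) = controlled (star U) := by
  have h : ∀ b, star (projBit b) = projBit b := fun b => by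
    ext i j
    cases b <;> cases i <;> cases j <;> simp [projBit, Matrix.star_apply]
  rw [controlled, star_add, star_tensorOp, star_tensorOp, h, h, star_one, controlled]

theorem controlled_mem_unitaryGroup {U : Op (Fin n)}
    (hU : U ∈ Matrix.unitaryGroup (Fin n → Bool) ℂ) :
    controlled U ∈ Matrix.unitaryGroup (Option (Fin n) → Bool) ℂ := by
  rw [Matrix.mem_unitaryGroup_iff, star_controlled, controlled_mul,
    Matrix.mem_unitaryGroup_iff.1 hU, controlled_one]

theorem mem_qetu_cases {O : ℝ → Op (Fin n)} {s t : ℝ} {m : ℕ} {φ : ℕ → ℝ}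
    {p : Op (Option (Fin n)) → Prop} (hX : ∀ θ, p (rotX n θ)) (hZ : ∀ θ, p (rotZ n θ))
    (h1 : p (controlled (O t))) (h2 : p (controlled (O (-t)))) :
    ∀ U ∈ qetu O s t m φ, p U := by
  intro U hU
  simp only [qetu, List.mem_append, List.mem_flatMap, List.mem_cons, List.not_mem_nil,
    or_false] at hU
  rcases hU with ⟨j, -, h | h | h | h | h | h⟩ | h <;> rw [h]
  · exact hX _
  · exact h1
  · exact hZ _
  · exact hX _
  · exact h2
  · exact hZ _
  · exact hX _

theorem qetu_mem_unitaryGroup {O : ℝ → Op (Fin n)}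
    (hO : ∀ t, O t ∈ Matrix.unitaryGroup (Fin n → Bool) ℂ) (s t : ℝ) (m : ℕ) (φ : ℕ → ℝ) :
    ∀ U ∈ qetu O s t m φ, U ∈ Matrix.unitaryGroup (Option (Fin n) → Bool) ℂ :=
  mem_qetu_cases (fun θ => tensorOp_mem_unitaryGroup (expX_mem_unitaryGroup θ) (one_mem _))
    (fun θ => tensorOp_mem_unitaryGroup (expZ_mem_unitaryGroup θ) (one_mem _))
    (controlled_mem_unitaryGroup (hO t)) (controlled_mem_unitaryGroup (hO (-t)))

theorem norm_foldl_act_of_unitary (l : List (Op (Option (Fin n))))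
    (hl : ∀ U ∈ l, U ∈ Matrix.unitaryGroup (Option (Fin n) → Bool) ℂ) (w : Ket (Option (Fin n))) :
    ‖l.foldl (fun w U => act U w) w‖ = ‖w‖ := by
  induction l generalizing w with
  | nil => rfl
  | cons U l ih =>
    rw [List.foldl_cons, ih (fun V hV => hl V (List.mem_cons_of_mem _ hV)),
      norm_act_of_unitary (hl U List.mem_cons_self)]

end

/-! ### Branches of the multi-level program -/

section
variable {n : ℕ}

/-- The operator that a list of operators, in the order of time, implements. -/
def listOp (l : List (Op (Option (Fin n)))) : Op (Option (Fin n)) :=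
  l.foldl (fun A U => U * A) 1

theorem foldl_mul_left (l : List (Op (Option (Fin n)))) (A : Op (Option (Fin n))) :
    l.foldl (fun A U => U * A) A = listOp l * A := by
  induction l generalizing A with
  | nil => simp [listOp]
  | cons U l ih => rw [listOp, List.foldl_cons, List.foldl_cons, ih, ih (U * 1), mul_one, mul_assoc]

theorem listOp_cons (U : Op (Option (Fin n))) (l : List (Op (Option (Fin n)))) :
    listOp (U :: l) = listOp l * U := by
  rw [listOp, List.foldl_cons, foldl_mul_left, mul_one]

theorem act_listOp (l : List (Op (Option (Fin n)))) (w : Ket (Option (Fin n))) :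
    act (listOp l) w = l.foldl (fun w U => act U w) w := by
  induction l generalizing w with
  | nil => simp [listOp, act_one]
  | cons U l ih => rw [listOp_cons, act_mul, ih, List.foldl_cons]

/-- The (contractive) operator of the branch of a run in which no level fails. -/
def successOp (O : ℝ → Op (Fin n)) (s : ℝ) (m : ℕ) (φ : ℕ → ℝ) : List ℝ → Op (Option (Fin n))
  | [] => 1
  | t :: ts => successOp O s m φ ts * (tensorOp (projBit false) 1 * listOp (qetu O s t m φ))

theorem norm_sq_act_projBit (b : Bool) (w : Ket (Option (Fin n))) :
    ‖act (tensorOp (projBit b) 1) w‖ ^ 2 = ‖systemPart b w‖ ^ 2 := by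
  rw [norm_sq_eq_sum_systemPart]
  simp only [act_tensorOp_apply, act_one]
  cases b <;> simp [projBit]

theorem norm_sq_eq_add_projBit (w : Ket (Option (Fin n))) :
    ‖w‖ ^ 2 =
      ‖act (tensorOp (projBit false) 1) w‖ ^ 2 + ‖act (tensorOp (projBit true) 1) w‖ ^ 2 := by
  rw [norm_sq_act_projBit, norm_sq_act_projBit, norm_sq_eq_sum_systemPart]
  simp [add_comm]

theorem norm_act_projBit_le (b : Bool) (w : Ket (Option (Fin n))) :
    ‖act (tensorOp (projBit b) 1) w‖ ≤ ‖w‖ := by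
  apply le_of_sq_le_sq _ (norm_nonneg _)
  rw [norm_sq_eq_add_projBit w]
  cases b
  · exact le_add_of_nonneg_right (sq_nonneg _)
  · exact le_add_of_nonneg_left (sq_nonneg _)

/-- The sum of `Φ` over the final states of the successful branches. -/
def branchSum (OI : Op (Fin n)) (Φ : Ket (Option (Fin n)) → ℝ) (P : Program n)
    (v : Ket (Option (Fin n))) : ℝ :=
  ((P.outputs OI v).map Φ).sum

theorem branchSum_applyAll (OI : Op (Fin n)) (Φ : Ket (Option (Fin n)) → ℝ) (P : Program n)
    (l : List (Op (Option (Fin n)))) (v : Ket (Option (Fin n))) :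
    branchSum OI Φ (Program.applyAll l P) v = branchSum OI Φ P (act (listOp l) v) := by
  induction l generalizing v with
  | nil => simp [Program.applyAll, listOp, act_one]
  | cons U l ih => rw [listOp_cons, act_mul, ← ih]; rfl

theorem branchSum_measure (OI : Op (Fin n)) (Φ : Ket (Option (Fin n)) → ℝ) (P Q : Program n)
    (v : Ket (Option (Fin n))) : branchSum OI Φ (.measure P Q) v =
      branchSum OI Φ P (act (tensorOp (projBit false) 1) v) +
        branchSum OI Φ Q (act (tensorOp (projBit true) 1) v) := by
  simp [branchSum, Program.outputs]

theorem outputs_smul (OI : Op (Fin n)) (P : Program n) {r : ℝ} (hr : 0 ≤ r)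
    (v : Ket (Option (Fin n))) :
    P.outputs OI ((r : ℂ) • v) = (P.outputs OI v).map fun w => (r : ℂ) • w := by
  induction P generalizing v with
  | succeed => simp [Program.outputs]
  | giveUp => simp [Program.outputs]
  | reset P ih =>
    rw [Program.outputs, Program.outputs, ← ih, smul_smul, norm_smul]
    simp [abs_of_nonneg hr]
  | oracle P ih => rw [Program.outputs, Program.outputs, act_smul, ih]
  | apply U P ih => rw [Program.outputs, Program.outputs, act_smul, ih]
  | measure P Q ihP ihQ =>
    rw [Program.outputs, Program.outputs, act_smul, act_smul, ihP, ihQ, List.map_append]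

theorem branchSum_smul (OI : Op (Fin n)) {Φ : Ket (Option (Fin n)) → ℝ}
    (hΦ : ∀ (r : ℝ) w, Φ ((r : ℂ) • w) = r ^ 2 * Φ w) (P : Program n) {r : ℝ} (hr : 0 ≤ r)
    (v : Ket (Option (Fin n))) : branchSum OI Φ P ((r : ℂ) • v) = r ^ 2 * branchSum OI Φ P v := by
  rw [branchSum, outputs_smul OI P hr, branchSum, ← List.sum_map_mul_left, List.map_map]
  congr 2
  ext w
  exact hΦ r w

variable {O : ℝ → Op (Fin n)} {s : ℝ} {m : ℕ} {φ : ℕ → ℝ}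

theorem branchSum_multiLevel_reset (OI : Op (Fin n)) {Φ : Ket (Option (Fin n)) → ℝ}
    (hΦ : ∀ (r : ℝ) w, Φ ((r : ℂ) • w) = r ^ 2 * Φ w) (ts : List ℝ) (N : ℕ)
    (v : Ket (Option (Fin n))) : branchSum OI Φ (multiLevel O s m φ ts N) v =
      ‖v‖ ^ 2 * branchSum OI Φ (multiLevel O s m φ ts N) (ketZero _) := by
  cases N with
  | zero => simp [multiLevel, branchSum, Program.outputs]
  | succ N =>
    -- the reset replaces `v` by the multiple `‖v‖` of the initial state
    have h : ∀ v, branchSum OI Φ (multiLevel O s m φ ts (N + 1)) v = ‖v‖ ^ 2 *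
        branchSum OI Φ (.oracle (levels O s m φ (multiLevel O s m φ ts N) ts)) (ketZero _) :=
      fun v => branchSum_smul OI hΦ _ (norm_nonneg v) _
    rw [h v, h (ketZero _), norm_ketZero, one_pow, one_mul]

/-- A run either succeeds or, with the complementary probability, is followed by the program
`restart`, which begins with a reset. -/
theorem branchSum_levels (hO : ∀ t, O t ∈ Matrix.unitaryGroup (Fin n → Bool) ℂ) (OI : Op (Fin n))
    {Φ : Ket (Option (Fin n)) → ℝ} {restart : Program n} {T : ℝ}
    (hT : ∀ v, branchSum OI Φ restart v = ‖v‖ ^ 2 * T) (ts : List ℝ) (v : Ket (Option (Fin n))) :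
    branchSum OI Φ (levels O s m φ restart ts) v = Φ (act (successOp O s m φ ts) v) +
      (‖v‖ ^ 2 - ‖act (successOp O s m φ ts) v‖ ^ 2) * T := by
  induction ts generalizing v with
  | nil => simp [levels, successOp, act_one, branchSum, Program.outputs]
  | cons t ts ih =>
    have hn : ‖v‖ = ‖act (listOp (qetu O s t m φ)) v‖ := by
      rw [act_listOp, norm_foldl_act_of_unitary _ (qetu_mem_unitaryGroup hO s t m φ)]
    rw [levels, branchSum_applyAll, branchSum_measure, ih, hT, successOp, act_mul, act_mul, hn,
      norm_sq_eq_add_projBit (act (listOp (qetu O s t m φ)) v)]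
    ring

theorem norm_act_tensorOp_one {OI : Op (Fin n)} (hOI : OI ∈ Matrix.unitaryGroup (Fin n → Bool) ℂ)
    (v : Ket (Option (Fin n))) : ‖act (tensorOp 1 OI) v‖ = ‖v‖ :=
  norm_act_of_unitary (tensorOp_mem_unitaryGroup (one_mem _) hOI) v

/-- Summing the geometric series over the runs: a quantity `Φ` that is quadratic in the final state
is, over all runs, `Φ w` times `∑ k < N, (1 - ‖w‖²) ^ k`, where `w` is the final state of a single
successful run. The division by `‖w‖²` is avoided. -/
theorem branchSum_multiLevel (hO : ∀ t, O t ∈ Matrix.unitaryGroup (Fin n → Bool) ℂ)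
    {OI : Op (Fin n)} (hOI : OI ∈ Matrix.unitaryGroup (Fin n → Bool) ℂ)
    {Φ : Ket (Option (Fin n)) → ℝ} (hΦ : ∀ (r : ℝ) w, Φ ((r : ℂ) • w) = r ^ 2 * Φ w)
    (ts : List ℝ) (N : ℕ) {w : Ket (Option (Fin n))}
    (hw : w = act (successOp O s m φ ts) (act (tensorOp 1 OI) (ketZero _))) :
    branchSum OI Φ (multiLevel O s m φ ts N) (ketZero _) * ‖w‖ ^ 2 =
      Φ w * (1 - (1 - ‖w‖ ^ 2) ^ N) := by
  induction N with
  | zero => simp [multiLevel, branchSum, Program.outputs]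
  | succ N ih =>
    have h : branchSum OI Φ (multiLevel O s m φ ts (N + 1)) (ketZero _) =
        branchSum OI Φ (levels O s m φ (multiLevel O s m φ ts N) ts)
          (act (tensorOp 1 OI) (ketZero _)) := by
      rw [multiLevel, branchSum, Program.outputs, Program.outputs, norm_ketZero, Complex.ofReal_one,
        one_smul]
      rfl
    rw [h, branchSum_levels hO OI (branchSum_multiLevel_reset OI hΦ ts N), ← hw,
      norm_act_tensorOp_one hOI, norm_ketZero]
    linear_combination (1 - ‖w‖ ^ 2) * ih

/-! ### Perturbation of the evolution -/

theorem norm_controlled_sub_le (U V : Op (Fin n)) : ‖controlled U - controlled V‖ ≤ ‖U - V‖ := by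
  apply opNorm_le_of_forall_norm_act_le (norm_nonneg _)
  intro w
  have h : controlled U - controlled V = tensorOp (projBit true) (U - V) := by
    ext x y; simp [controlled, tensorOp_apply]; ring
  apply le_of_sq_le_sq _ (by positivity)
  rw [h, norm_sq_eq_sum_systemPart]
  simp only [act_tensorOp_apply]
  have h1 : ‖act (U - V) (systemPart true w)‖ ^ 2 ≤ (‖U - V‖ * ‖w‖) ^ 2 := by
    have h2 : ‖systemPart true w‖ ≤ ‖w‖ := by
      apply le_of_sq_le_sq _ (norm_nonneg _)
      rw [← norm_sq_act_projBit]
      exact pow_le_pow_left₀ (norm_nonneg _) (norm_act_projBit_le _ _) 2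
    exact pow_le_pow_left₀ (norm_nonneg _) ((norm_act_le _ _).trans (by gcongr)) 2
  simpa [projBit] using h1

/-- Errors of unitary steps accumulate additively. -/
theorem norm_foldl_act_sub_le {δ : ℝ} {l l' : List (Op (Option (Fin n)))}
    (h : List.Forall₂ (fun U V => U ∈ Matrix.unitaryGroup (Option (Fin n) → Bool) ℂ ∧
      V ∈ Matrix.unitaryGroup (Option (Fin n) → Bool) ℂ ∧ ‖U - V‖ ≤ δ) l l')
    (w w' : Ket (Option (Fin n))) :
    ‖l.foldl (fun w U => act U w) w - l'.foldl (fun w U => act U w) w'‖ ≤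
      l.length * δ * ‖w'‖ + ‖w - w'‖ := by
  induction h generalizing w w' with
  | nil => simp
  | @cons U V l l' hUV _ ih =>
    obtain ⟨hU, hV, hd⟩ := hUV
    rw [List.foldl_cons, List.foldl_cons, List.length_cons]
    refine (ih _ _).trans ?_
    have h1 : ‖act U w - act V w'‖ ≤ ‖w - w'‖ + δ * ‖w'‖ := by
      rw [show act U w - act V w' = act U (w - w') + act (U - V) w' by
        rw [act_sub_right, act_sub]; abel]
      refine (norm_add_le _ _).trans (add_le_add (norm_act_of_unitary hU _).le ?_)
      exact (norm_act_le _ _).trans (by gcongr)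
    rw [norm_act_of_unitary hV]
    push_cast
    linarith

theorem length_qetu (O : ℝ → Op (Fin n)) (s t : ℝ) (m : ℕ) (φ : ℕ → ℝ) :
    (qetu O s t m φ).length = 6 * m + 1 := by
  simp [qetu, mul_comm]

theorem norm_listOp_qetu_sub_le {O O' : ℝ → Op (Fin n)}
    (hO : ∀ t, O t ∈ Matrix.unitaryGroup (Fin n → Bool) ℂ)
    (hO' : ∀ t, O' t ∈ Matrix.unitaryGroup (Fin n → Bool) ℂ) (s : ℝ) (m : ℕ) (φ : ℕ → ℝ) {δ t : ℝ}
    (hδ : 0 ≤ δ) (h1 : ‖O t - O' t‖ ≤ δ) (h2 : ‖O (-t) - O' (-t)‖ ≤ δ)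
    (w w' : Ket (Option (Fin n))) :
    ‖act (listOp (qetu O s t m φ)) w - act (listOp (qetu O' s t m φ)) w'‖ ≤
      (6 * m + 1) * δ * ‖w'‖ + ‖w - w'‖ := by
  rw [act_listOp, act_listOp]
  have hX : ∀ θ, rotX n θ ∈ Matrix.unitaryGroup (Option (Fin n) → Bool) ℂ :=
    fun θ => tensorOp_mem_unitaryGroup (expX_mem_unitaryGroup θ) (one_mem _)
  have hZ : ∀ θ, rotZ n θ ∈ Matrix.unitaryGroup (Option (Fin n) → Bool) ℂ :=
    fun θ => tensorOp_mem_unitaryGroup (expZ_mem_unitaryGroup θ) (one_mem _)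
  have hC : ∀ u, ‖O u - O' u‖ ≤ δ →
      controlled (O u) ∈ Matrix.unitaryGroup (Option (Fin n) → Bool) ℂ ∧
      controlled (O' u) ∈ Matrix.unitaryGroup (Option (Fin n) → Bool) ℂ ∧
      ‖controlled (O u) - controlled (O' u)‖ ≤ δ := fun u hu =>
    ⟨controlled_mem_unitaryGroup (hO u), controlled_mem_unitaryGroup (hO' u),
      (norm_controlled_sub_le _ _).trans hu⟩
  have hrefl : ∀ U : Op (Option (Fin n)), ‖U - U‖ ≤ δ := fun U => by rwa [sub_self, norm_zero]
  have := norm_foldl_act_sub_le (δ := δ) (l := qetu O s t m φ) (l' := qetu O' s t m φ) ?_ w w'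
  · rw [length_qetu] at this
    push_cast at this
    exact this
  · rw [qetu, qetu]
    refine List.rel_append ?_ (.cons ⟨hX _, hX _, hrefl _⟩ .nil)
    refine List.rel_flatMap (R := Eq) (List.forall₂_eq_eq_eq ▸ rfl) ?_
    rintro j _ rfl
    exact .cons ⟨hX _, hX _, hrefl _⟩ (.cons (hC t h1) (.cons ⟨hZ _, hZ _, hrefl _⟩
      (.cons ⟨hX _, hX _, hrefl _⟩ (.cons (hC (-t) h2) (.cons ⟨hZ _, hZ _, hrefl _⟩ .nil)))))

theorem norm_successOp_sub_le {O O' : ℝ → Op (Fin n)}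
    (hO : ∀ t, O t ∈ Matrix.unitaryGroup (Fin n → Bool) ℂ)
    (hO' : ∀ t, O' t ∈ Matrix.unitaryGroup (Fin n → Bool) ℂ) (s : ℝ) (m : ℕ) (φ : ℕ → ℝ) {δ : ℝ}
    (hδ : 0 ≤ δ) (ts : List ℝ) (h : ∀ t ∈ ts, ‖O t - O' t‖ ≤ δ ∧ ‖O (-t) - O' (-t)‖ ≤ δ)
    (w w' : Ket (Option (Fin n))) :
    ‖act (successOp O s m φ ts) w - act (successOp O' s m φ ts) w'‖ ≤
      ts.length * (6 * m + 1) * δ * ‖w'‖ + ‖w - w'‖ := by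
  induction ts generalizing w w' with
  | nil => simp [successOp, act_one]
  | cons t ts ih =>
    rw [successOp, successOp, act_mul, act_mul, act_mul, act_mul, List.length_cons]
    refine (ih (fun u hu => h u (List.mem_cons_of_mem _ hu)) _ _).trans ?_
    rw [← act_sub_right]
    have h1 := norm_listOp_qetu_sub_le hO hO' s m φ hδ (h t List.mem_cons_self).1
      (h t List.mem_cons_self).2 w w'
    have h2 : ‖act (tensorOp (projBit false) 1) (act (listOp (qetu O' s t m φ)) w')‖ ≤ ‖w'‖ := by
      refine (norm_act_projBit_le _ _).trans_eq ?_
      rw [act_listOp, norm_foldl_act_of_unitary _ (qetu_mem_unitaryGroup hO' s t m φ)]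
    have h3 := norm_act_projBit_le false
      (act (listOp (qetu O s t m φ)) w - act (listOp (qetu O' s t m φ)) w')
    have h4 := mul_le_mul_of_nonneg_left h2 (by positivity : 0 ≤ (ts.length : ℝ) * (6 * m + 1) * δ)
    push_cast
    linarith

end

/-! ### Ground-state filtering -/

section
variable {n : ℕ}

theorem act_eigenvectorBasis {H : Op (Fin n)} (hH : H.IsHermitian) (i : Fin n → Bool) :
    act H (hH.eigenvectorBasis i) = (hH.eigenvalues i : ℂ) • hH.eigenvectorBasis i := by
  ext x
  rw [act, Matrix.ofLp_toEuclideanCLM, hH.mulVec_eigenvectorBasis]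
  simp

/-- An eigenvector of a gapped Hamiltonian is either an excited one, orthogonal to the ground state,
or a multiple of the ground state. -/
theorem IsGappedGroundState.cases {H : Op (Fin n)} (hH : H.IsHermitian) {μ Δ lam : ℝ}
    {psi : Ket (Fin n)} (h : IsGappedGroundState H μ Δ lam psi) (hΔ : 0 < Δ) {lam' : ℝ}
    {v : Ket (Fin n)} (hv0 : v ≠ 0) (hv : act H v = (lam' : ℂ) • v) :
    (μ + Δ / 2 ≤ lam' ∧ inner ℂ psi v = 0) ∨ (lam' = lam ∧ v = inner ℂ psi v • psi) := by
  have hsym : inner ℂ (act H psi) v = inner ℂ psi (act H v) := by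
    have := (Matrix.isSymmetric_toEuclideanLin_iff.2 hH) psi v
    exact this
  rw [h.eigen, hv, inner_smul_left, inner_smul_right, Complex.conj_ofReal] at hsym
  by_cases hl : lam' = lam
  · right
    refine ⟨hl, ?_⟩
    by_contra hne
    have h1 := h.excited_ge lam' (v - (inner ℂ psi v : ℂ) • psi) (sub_ne_zero.2 hne) (by
      rw [act_sub_right, act_smul, hv, h.eigen, hl, smul_sub, smul_comm]) (by
      rw [inner_sub_right, inner_smul_right, inner_self_eq_norm_sq_to_K, h.norm_eq]; simp)
    linarith [h.ground_le]
  · left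
    have h0 : inner ℂ psi v = 0 := by
      by_contra hne
      exact hl (by exact_mod_cast (mul_right_cancel₀ hne hsym).symm)
    exact ⟨h.excited_ge lam' v hv0 hv h0, h0⟩

/-- A function of `H` that is at most `η` on the excited energies is `η`-close to a multiple of the
projection onto the ground state. -/
theorem norm_sub_ground_le {H : Op (Fin n)} (hH : H.IsHermitian) {μ Δ lam : ℝ}
    {psi : Ket (Fin n)} (h : IsGappedGroundState H μ Δ lam psi) (hΔ : 0 < Δ)
    (L : Ket (Fin n) →ₗ[ℂ] Ket (Fin n)) (d : ℝ → ℝ)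
    (hL : ∀ (lam' : ℝ) v, act H v = (lam' : ℂ) • v → L v = (d lam' : ℂ) • v) {η : ℝ} (hη : 0 ≤ η)
    (hd : ∀ (lam' : ℝ) v, v ≠ 0 → act H v = (lam' : ℂ) • v → μ + Δ / 2 ≤ lam' → |d lam'| ≤ η)
    (v : Ket (Fin n)) : ‖L v - ((d lam : ℂ) * inner ℂ psi v) • psi‖ ≤ η * ‖v‖ := by
  set e := hH.eigenvectorBasis with he
  -- `L` minus the ground-state part is diagonal in the eigenbasis, with entries `c`
  have hc : ∀ i, ∃ c : ℂ, ‖c‖ ≤ η ∧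
      L (e i) - ((d lam : ℂ) * inner ℂ psi (e i)) • psi = c • e i := by
    intro i
    have hei := act_eigenvectorBasis hH i
    have hne : e i ≠ 0 := e.orthonormal.ne_zero i
    rcases h.cases hH hΔ hne hei with ⟨hge, h0⟩ | ⟨heq, hpsi⟩
    · refine ⟨d (hH.eigenvalues i), ?_, ?_⟩
      · rw [Complex.norm_real]
        exact hd _ _ hne hei hge
      · rw [h0, hL _ _ hei, mul_zero, zero_smul, sub_zero]
    · refine ⟨0, by simpa using hη, ?_⟩
      rw [hL _ _ hei, heq, mul_smul, ← hpsi, sub_self, zero_smul]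
  choose c hcn hce using hc
  have hsum : L v - ((d lam : ℂ) * inner ℂ psi v) • psi = ∑ i, (inner ℂ (e i) v * c i) • e i := by
    conv_lhs => rw [← e.sum_repr' v]
    rw [map_sum, inner_sum, Finset.mul_sum, Finset.sum_smul, ← Finset.sum_sub_distrib]
    refine Finset.sum_congr rfl fun i _ => ?_
    rw [map_smul, inner_smul_right, mul_smul _ (c i), ← hce, smul_sub, smul_smul (inner ℂ (e i) v)]
    congr 2
    ring
  apply le_of_sq_le_sq _ (by positivity)
  rw [hsum, mul_pow, ← e.sum_sq_norm_inner_right v, ← e.sum_sq_norm_inner_right, Finset.mul_sum]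
  refine Finset.sum_le_sum fun i _ => ?_
  rw [e.orthonormal.inner_right_fintype, norm_mul, mul_pow, mul_comm]
  have := pow_le_pow_left₀ (norm_nonneg _) (hcn i) 2
  gcongr

/-- Among the multiples of `psi`, the projection of `y` is the one closest to `y`. -/
theorem norm_sq_le_inner_sq_add {psi : Ket (Fin n)} (h : ‖psi‖ = 1) (a : ℂ) (y : Ket (Fin n)) :
    ‖y‖ ^ 2 ≤ ‖inner ℂ psi y‖ ^ 2 + ‖y - a • psi‖ ^ 2 := by
  set c : ℂ := inner ℂ psi y
  have horth : inner ℂ psi (y - c • psi) = 0 := by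
    rw [inner_sub_right, inner_smul_right, inner_self_eq_norm_sq_to_K, h]; simp [c]
  have key : ∀ b : ℂ, ‖(y - c • psi) + b • psi‖ ^ 2 = ‖y - c • psi‖ ^ 2 + ‖b‖ ^ 2 := by
    intro b
    rw [sq, norm_add_sq_eq_norm_sq_add_norm_sq_of_inner_eq_zero (𝕜 := ℂ), norm_smul, h,
      mul_one, sq, sq]
    rw [inner_smul_right, ← inner_conj_symm, horth, map_zero, mul_zero]
  have h1 := key c
  have h2 := key (c - a)
  rw [sub_add_cancel] at h1
  rw [show y - c • psi + (c - a) • psi = y - a • psi by rw [sub_smul]; abel] at h2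
  rw [h1, h2]
  nlinarith [sq_nonneg ‖c - a‖]

/-- The filter function of all levels together. -/
def levelFilter (g : Polynomial ℝ) (s : ℝ) (ts : List ℝ) (lam : ℝ) : ℝ :=
  (ts.map fun t => g.eval (Real.cos ((lam - s) * t / 2))).prod

theorem act_successOp_evolution {m : ℕ} {φ : ℕ → ℝ} {g : Polynomial ℝ}
    (hφ : ∀ ω : ℝ, qspMat φ ω (2 * m) false false = (g.eval (Real.cos ω) : ℝ))
    {H : Op (Fin n)} {lam : ℝ} {v : Ket (Fin n)} (h : act H v = (lam : ℂ) • v) (s : ℝ)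
    (ts : List ℝ) : act (successOp (evolution H) s m φ ts) (ketTensor (Pi.single false 1) v) =
      ketTensor (Pi.single false 1) ((levelFilter g s ts lam : ℂ) • v) := by
  induction ts with
  | nil => simp [successOp, act_one, levelFilter]
  | cons t ts ih =>
    rw [successOp, act_mul, act_mul, act_listOp, foldl_qetu h, act_tensorOp_ketTensor, act_one]
    have hq : projBit false *ᵥ qspMat φ ((lam - s) * t / 2) (2 * m) *ᵥ Pi.single false 1 =
        ((g.eval (Real.cos ((lam - s) * t / 2)) : ℝ) : ℂ) • Pi.single false 1 := by
      rw [Matrix.mulVec_single_one]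
      ext b
      cases b <;> simp [projBit, Matrix.mulVec, dotProduct, hφ]
    have hs : ∀ (c : ℂ) (q : Bool → ℂ) (w : Ket (Fin n)),
        ketTensor q (c • w) = c • ketTensor q w := by
      intro c q w
      ext x
      simp [ketTensor]
      ring
    rw [hq, ← ketTensor_smul, hs, act_smul, ih, ← hs, smul_smul]
    simp [levelFilter]

theorem systemPart_add (b : Bool) (v w : Ket (Option (Fin n))) :
    systemPart b (v + w) = systemPart b v + systemPart b w := rfl

theorem systemPart_smul (b : Bool) (c : ℂ) (v : Ket (Option (Fin n))) :
    systemPart b (c • v) = c • systemPart b v := rfl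

theorem systemPart_sub (b : Bool) (v w : Ket (Option (Fin n))) :
    systemPart b (v - w) = systemPart b v - systemPart b w := rfl

theorem norm_ketTensor_false (v : Ket (Fin n)) : ‖ketTensor (Pi.single false 1) v‖ = ‖v‖ := by
  rw [← sq_eq_sq₀ (norm_nonneg _) (norm_nonneg _), norm_sq_eq_sum_systemPart]
  simp [systemPart_ketTensor]

theorem ketZero_eq_ketTensor :
    ketZero (Option (Fin n)) = ketTensor (Pi.single false 1) (ketZero (Fin n)) := by
  ext x
  by_cases h : x = fun _ => false
  · simp [ketZero, ketTensor, h]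
  · have h2 : x none = true ∨ (fun i => x (some i)) ≠ fun _ => false := by
      by_contra hc
      push Not at hc
      apply h
      ext q
      cases q
      · simpa using hc.1
      · exact congrFun hc.2 _
    rcases h2 with h2 | h2 <;> simp [ketZero, ketTensor, h, h2]

/-- With exact evolutions, the branch without failures is close to a multiple of the ground state.
-/
theorem norm_act_successOp_evolution_sub_le {m : ℕ} {φ : ℕ → ℝ} {g : Polynomial ℝ}
    (hφ : ∀ ω : ℝ, qspMat φ ω (2 * m) false false = (g.eval (Real.cos ω) : ℝ))
    {H : Op (Fin n)} (hH : H.IsHermitian) {μ Δ lam : ℝ} {psi : Ket (Fin n)}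
    (h : IsGappedGroundState H μ Δ lam psi) (hΔ : 0 < Δ) (s : ℝ) (ts : List ℝ) {η : ℝ} (hη : 0 ≤ η)
    (hd : ∀ (lam' : ℝ) v, v ≠ 0 → act H v = (lam' : ℂ) • v → μ + Δ / 2 ≤ lam' →
      |levelFilter g s ts lam'| ≤ η) (v : Ket (Fin n)) :
    ‖act (successOp (evolution H) s m φ ts) (ketTensor (Pi.single false 1) v) -
      ketTensor (Pi.single false 1) (((levelFilter g s ts lam : ℂ) * inner ℂ psi v) • psi)‖ ≤
        η * ‖v‖ := by
  set A := successOp (evolution H) s m φ ts with hA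
  have hadd : ∀ v w : Ket (Fin n), ketTensor (Pi.single false 1) (v + w) =
      ketTensor (Pi.single false 1) v + ketTensor (Pi.single false 1) w := by
    intro v w; ext x; simp [ketTensor]; ring
  have hsmul : ∀ (c : ℂ) (v : Ket (Fin n)), ketTensor (Pi.single false 1) (c • v) =
      c • ketTensor (Pi.single false 1) v := by
    intro c v; ext x; simp [ketTensor]; ring
  let L : Ket (Fin n) →ₗ[ℂ] Ket (Fin n) :=
    { toFun := fun v => systemPart false (act A (ketTensor (Pi.single false 1) v))
      map_add' := fun v w => by rw [hadd, act_add_right, systemPart_add]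
      map_smul' := fun c v => by rw [hsmul, act_smul, systemPart_smul]; rfl }
  have hL := norm_sub_ground_le hH h hΔ L (levelFilter g s ts) (fun lam' v hv => by
    change systemPart false (act A (ketTensor (Pi.single false 1) v)) = _
    rw [hA, act_successOp_evolution hφ hv, systemPart_ketTensor, Pi.single_eq_same,
      one_smul]) hη hd v
  -- the branch leaves the ancilla in the state `|0⟩`
  have hfalse : act A (ketTensor (Pi.single false 1) v) = ketTensor (Pi.single false 1) (L v) := by
    let F : Ket (Fin n) →ₗ[ℂ] Ket (Option (Fin n)) :=
      { toFun := fun v => act A (ketTensor (Pi.single false 1) v) -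
          ketTensor (Pi.single false 1) (L v)
        map_add' := fun v w => by rw [hadd, act_add_right, map_add, hadd]; abel
        map_smul' := fun c v => by rw [hsmul, act_smul, map_smul, hsmul, ← smul_sub]; rfl }
    have hF : F = 0 := hH.eigenvectorBasis.toBasis.ext fun i => by
      rw [OrthonormalBasis.coe_toBasis]
      change act A _ - ketTensor _ (systemPart false (act A _)) = 0
      rw [hA, act_successOp_evolution hφ (act_eigenvectorBasis hH i) s ts, systemPart_ketTensor,
        Pi.single_eq_same, one_smul, sub_self]
    exact sub_eq_zero.1 (LinearMap.congr_fun hF v)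
  have hsub : ∀ v w : Ket (Fin n), ketTensor (Pi.single false 1) v -
      ketTensor (Pi.single false 1) w = ketTensor (Pi.single false 1) (v - w) := by
    intro v w; ext x; simp [ketTensor]; ring
  rw [hfalse, hsub, norm_ketTensor_false]
  exact hL

theorem norm_act_successOp_le {O : ℝ → Op (Fin n)}
    (hO : ∀ t, O t ∈ Matrix.unitaryGroup (Fin n → Bool) ℂ) (s : ℝ) (m : ℕ) (φ : ℕ → ℝ)
    (ts : List ℝ) (w : Ket (Option (Fin n))) : ‖act (successOp O s m φ ts) w‖ ≤ ‖w‖ := by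
  induction ts generalizing w with
  | nil => rw [successOp, act_one]
  | cons t ts ih =>
    rw [successOp, act_mul, act_mul]
    refine (ih _).trans ((norm_act_projBit_le _ _).trans_eq ?_)
    rw [act_listOp, norm_foldl_act_of_unitary _ (qetu_mem_unitaryGroup hO s t m φ)]

/-- Success probability and fidelity of the multi-level method in terms of the distance `ξ` between
the final state of a successful run and a multiple `a` of the ground state. -/
theorem successProb_fidelity_of_close {O : ℝ → Op (Fin n)} {s : ℝ} {m : ℕ} {φ : ℕ → ℝ}
    (hO : ∀ t, O t ∈ Matrix.unitaryGroup (Fin n → Bool) ℂ)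
    {OI : Op (Fin n)} (hOI : OI ∈ Matrix.unitaryGroup (Fin n → Bool) ℂ) {psi : Ket (Fin n)}
    (hpsi : ‖psi‖ = 1) (ts : List ℝ) {N : ℕ} (hN : N ≠ 0) {a : ℂ} {ξ r : ℝ}
    (hr : 0 < r) (hra : r + ξ ≤ ‖a‖)
    (hclose : ‖act (successOp O s m φ ts) (act (tensorOp 1 OI) (ketZero _)) -
      ketTensor (Pi.single false 1) (a • psi)‖ ≤ ξ) :
    1 - (1 - r ^ 2) ^ N ≤ (multiLevel O s m φ ts N).successProb OI ∧
    1 - ξ ^ 2 / r ^ 2 ≤ (multiLevel O s m φ ts N).fidelity OI psi := by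
  set w := act (successOp O s m φ ts) (act (tensorOp 1 OI) (ketZero _)) with hw
  have hrw : r ≤ ‖w‖ := by
    have h1 := norm_sub_norm_le (ketTensor (Pi.single false 1) (a • psi)) w
    rw [norm_sub_rev, norm_ketTensor_false, norm_smul, hpsi, mul_one] at h1
    linarith
  have hw1 : ‖w‖ ^ 2 ≤ 1 := by
    refine pow_le_one₀ (norm_nonneg _) ((norm_act_successOp_le hO s m φ ts _).trans_eq ?_)
    rw [norm_act_tensorOp_one hOI, norm_ketZero]
  have hrw2 : r ^ 2 ≤ ‖w‖ ^ 2 := pow_le_pow_left₀ hr.le hrw 2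
  have hwpos : 0 < ‖w‖ ^ 2 := by have := hr.trans_le hrw; positivity
  have hP := branchSum_multiLevel (s := s) (m := m) (φ := φ) hO hOI (Φ := fun v => ‖v‖ ^ 2)
    (fun r w => by rw [norm_smul, mul_pow, Complex.norm_real, Real.norm_eq_abs, sq_abs]) ts N hw
  have hF := branchSum_multiLevel (s := s) (m := m) (φ := φ) hO hOI
    (Φ := fun v => ∑ b : Bool, ‖inner ℂ psi (systemPart b v)‖ ^ 2)
    (fun r w => by
      rw [Finset.mul_sum]
      refine Finset.sum_congr rfl fun b _ => ?_
      rw [systemPart_smul, inner_smul_right, norm_mul, mul_pow, Complex.norm_real,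
        Real.norm_eq_abs, sq_abs]) ts N hw
  beta_reduce at hP hF
  rw [mul_comm] at hP
  replace hP := mul_left_cancel₀ hwpos.ne' hP
  have hq : 1 - (1 - r ^ 2) ^ N ≤ 1 - (1 - ‖w‖ ^ 2) ^ N :=
    sub_le_sub_left (pow_le_pow_left₀ (by linarith) (by linarith) N) 1
  have hqpos : 0 < 1 - (1 - ‖w‖ ^ 2) ^ N := by
    have : (1 - ‖w‖ ^ 2) ^ N < 1 := pow_lt_one₀ (by linarith) (by linarith) hN
    linarith
  refine ⟨by rw [Program.successProb]; exact hq.trans_eq hP.symm, ?_⟩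
  have hfid : (multiLevel O s m φ ts N).fidelity OI psi =
      (∑ b : Bool, ‖inner ℂ psi (systemPart b w)‖ ^ 2) / ‖w‖ ^ 2 := by
    rw [Program.fidelity, Program.successProb]
    change branchSum OI _ _ _ / branchSum OI _ _ _ = _
    rw [hP, div_eq_div_iff hqpos.ne' hwpos.ne', hF]
  have hbound : ‖w‖ ^ 2 - ξ ^ 2 ≤ ∑ b : Bool, ‖inner ℂ psi (systemPart b w)‖ ^ 2 := by
    have h1 := norm_sq_le_inner_sq_add hpsi a (systemPart false w)
    have h2 := pow_le_pow_left₀ (norm_nonneg _) hclose 2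
    rw [norm_sq_eq_sum_systemPart] at h2
    rw [norm_sq_eq_sum_systemPart w]
    simp only [Fintype.sum_bool, systemPart_sub, systemPart_ketTensor] at h2 ⊢
    simp only [Pi.single_eq_same, one_smul, ne_eq, Bool.true_eq_false, not_false_eq_true,
      Pi.single_eq_of_ne, zero_smul, sub_zero] at h2
    have := sq_nonneg ‖inner ℂ psi (systemPart true w)‖
    linarith
  rw [hfid]
  calc 1 - ξ ^ 2 / r ^ 2 ≤ 1 - ξ ^ 2 / ‖w‖ ^ 2 := by gcongr
    _ = (‖w‖ ^ 2 - ξ ^ 2) / ‖w‖ ^ 2 := by rw [sub_div, div_self hwpos.ne']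
    _ ≤ _ := by gcongr

end

/-! ### The levels and the spectrum -/

section
variable {R Δ : ℝ}

theorem pi_mul_div_le_two_pow_stopLevel (hR : 0 < R) (hΔ : 0 < Δ) :
    Real.pi * R / (4 * Δ) ≤ 2 ^ stopLevel R Δ := by
  have hpos : 0 < Real.pi * R / (4 * Δ) := by positivity
  have h := Nat.le_ceil (Real.logb 2 (Real.pi * R / (4 * Δ)))
  rw [Real.logb_le_iff_le_rpow one_lt_two hpos, Real.rpow_natCast] at h
  exact h

theorem two_pow_stopLevel_lt (hR : 0 < R) (hΔ : 0 < Δ)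
    (hL : 0 < Real.logb 2 (Real.pi * R / (4 * Δ))) :
    (2 : ℝ) ^ stopLevel R Δ < 2 * (Real.pi * R / (4 * Δ)) := by
  have hpos : 0 < Real.pi * R / (4 * Δ) := by positivity
  have h := Nat.ceil_lt_add_one hL.le
  have h2 := Real.rpow_lt_rpow_of_exponent_lt one_lt_two h
  rw [Real.rpow_natCast, Real.rpow_add two_pos, Real.rpow_logb two_pos (by norm_num) hpos,
    Real.rpow_one] at h2
  exact h2.trans_eq (mul_comm _ _)

theorem stopLevel_pos (hL : 0 < Real.logb 2 (Real.pi * R / (4 * Δ))) : 0 < stopLevel R Δ :=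
  Nat.ceil_pos.2 hL

theorem four_mul_lt_pi_mul (hR : 0 < R) (hΔ : 0 < Δ)
    (hL : 0 < Real.logb 2 (Real.pi * R / (4 * Δ))) : 4 * Δ < Real.pi * R := by
  have hpos : 0 < Real.pi * R / (4 * Δ) := by positivity
  rw [Real.logb_pos_iff one_lt_two hpos, one_lt_div (by positivity)] at hL
  exact hL

theorem levelTime_le_last (hR : 0 < R) {l : ℕ} (hl : l < stopLevel R Δ) :
    levelTime R (l + 1) ≤ levelTime R (stopLevel R Δ) := by
  rw [levelTime, levelTime]
  gcongr
  · norm_num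
  · exact hl

theorem length_levelTimes : (levelTimes R Δ).length = stopLevel R Δ := by simp [levelTimes]

/-- The ground state, at distance `x` from the shift, is accepted on all levels. -/
theorem ground_angle_le (hR : 0 < R) (hΔ : 0 < Δ)
    (hL : 0 < Real.logb 2 (Real.pi * R / (4 * Δ))) {x : ℝ} (hx0 : 0 ≤ x) (hx : x ≤ Δ / 2) :
    ∀ t ∈ levelTimes R Δ, 0 ≤ x * t / 2 ∧ x * t / 2 ≤ Real.pi / 8 := by
  intro t ht
  obtain ⟨l, hl, rfl⟩ := List.mem_map.1 ht
  rw [List.mem_range] at hl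
  have h0 : 0 ≤ levelTime R (l + 1) := by rw [levelTime]; positivity
  refine ⟨by positivity, ?_⟩
  have h1 : levelTime R (l + 1) ≤ Real.pi / (2 * Δ) := by
    refine (levelTime_le_last hR hl).trans ?_
    rw [levelTime, div_le_iff₀ hR]
    refine (two_pow_stopLevel_lt hR hΔ hL).le.trans_eq ?_
    field_simp
    ring
  calc x * levelTime R (l + 1) / 2 ≤ (Δ / 2) * (Real.pi / (2 * Δ)) / 2 := by gcongr
    _ = Real.pi / 8 := by field_simp; ring

/-- Every excited energy (here `x` is its distance from the shift) is rejected on some level,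
namely on the first one on which its angle reaches `3π/16`; the angle has at most doubled there.
-/
theorem exists_excited_angle (hR : 0 < R) (hΔ : 0 < Δ)
    (hL : 0 < Real.logb 2 (Real.pi * R / (4 * Δ))) {x : ℝ} (hx0 : 3 * Δ / 2 ≤ x)
    (hx : x ≤ R + Δ / 2) :
    ∃ t ∈ levelTimes R Δ, 3 * Real.pi / 16 ≤ x * t / 2 ∧ x * t / 2 ≤ Real.pi / 2 := by
  have hangle : ∀ l, x * levelTime R (l + 1) / 2 = x * 2 ^ l / R := by
    intro l; rw [levelTime, pow_succ]; field_simp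
  obtain ⟨k, hk⟩ : ∃ k, stopLevel R Δ = k + 1 :=
    Nat.exists_eq_succ_of_ne_zero (stopLevel_pos hL).ne'
  have hpi := Real.pi_gt_three
  have hlast : 3 * Real.pi / 16 ≤ x * 2 ^ k / R := by
    have h1 := pi_mul_div_le_two_pow_stopLevel hR hΔ
    rw [hk, pow_succ, div_le_iff₀ (by positivity)] at h1
    rw [le_div_iff₀ hR]
    have h2 : (3 * Δ / 2) * 2 ^ k ≤ x * 2 ^ k := by gcongr
    linarith
  classical
  have hex : ∃ l, 3 * Real.pi / 16 ≤ x * 2 ^ l / R := ⟨k, hlast⟩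
  have hfind := Nat.find_spec hex
  have hle : Nat.find hex ≤ k := Nat.find_min' hex hlast
  refine ⟨levelTime R (Nat.find hex + 1), List.mem_map.2 ⟨_, List.mem_range.2 (by omega), rfl⟩, ?_⟩
  rw [hangle]
  refine ⟨hfind, ?_⟩
  rcases h0 : Nat.find hex with _ | l
  · -- on the first level the angle is `x / R ≤ 1 + Δ / (2 R) < π / 2`
    have h4 := four_mul_lt_pi_mul hR hΔ hL
    rw [pow_zero, mul_one, div_le_iff₀ hR]
    nlinarith
  · have hmin := Nat.find_min hex (m := l) (by omega)
    push Not at hmin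
    rw [pow_succ, ← mul_assoc, mul_div_right_comm]
    linarith

theorem levelFilter_ge (q : ℕ) {s lam η : ℝ} (hη : 0.97 ^ q ≤ η) (hη1 : η ≤ 1) {ts : List ℝ}
    (h : ∀ t ∈ ts, 0 ≤ (lam - s) * t / 2 ∧ (lam - s) * t / 2 ≤ Real.pi / 8) :
    1 - ts.length * η ≤ levelFilter (filterPoly q) s ts lam := by
  have hη0 : 0 ≤ η := le_trans (by positivity) hη
  induction ts with
  | nil => simp [levelFilter]
  | cons t ts ih =>
    have h1 := h t List.mem_cons_self
    have h2 := one_sub_filterPoly_eval_cos_le q h1.1 h1.2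
    have h3 := ih fun u hu => h u (List.mem_cons_of_mem _ hu)
    have h4 := (filterPoly_eval_cos_mem q ((lam - s) * t / 2)).2
    have h5 : levelFilter (filterPoly q) s (t :: ts) lam =
        (filterPoly q).eval (Real.cos ((lam - s) * t / 2)) *
          levelFilter (filterPoly q) s ts lam := by
      simp [levelFilter]
    rw [h5, List.length_cons]
    push_cast
    generalize (filterPoly q).eval (Real.cos ((lam - s) * t / 2)) = y at h2 h4
    have hy : 1 - η ≤ y := by linarith
    have h6 : 0 ≤ (ts.length : ℝ) * η := by positivity
    calc 1 - ((ts.length : ℝ) + 1) * η ≤ y * (1 - ts.length * η) := by nlinarith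
      _ ≤ _ := mul_le_mul_of_nonneg_left h3 (by linarith)

theorem levelFilter_mem (q : ℕ) (s lam : ℝ) (ts : List ℝ) :
    0 ≤ levelFilter (filterPoly q) s ts lam ∧ levelFilter (filterPoly q) s ts lam ≤ 1 := by
  induction ts with
  | nil => simp [levelFilter]
  | cons t ts ih =>
    have h5 : levelFilter (filterPoly q) s (t :: ts) lam =
        (filterPoly q).eval (Real.cos ((lam - s) * t / 2)) *
          levelFilter (filterPoly q) s ts lam := by
      simp [levelFilter]
    have h4 := filterPoly_eval_cos_mem q ((lam - s) * t / 2)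
    rw [h5]
    exact ⟨mul_nonneg h4.1 ih.1, mul_le_one₀ h4.2 ih.1 ih.2⟩

theorem levelFilter_le (q : ℕ) {s lam η : ℝ} (hη : 0.97 ^ q ≤ η) {ts : List ℝ}
    (h : ∃ t ∈ ts, 3 * Real.pi / 16 ≤ (lam - s) * t / 2 ∧ (lam - s) * t / 2 ≤ Real.pi / 2) :
    |levelFilter (filterPoly q) s ts lam| ≤ η := by
  rw [abs_of_nonneg (levelFilter_mem q s lam ts).1]
  induction ts with
  | nil => simp at h
  | cons t ts ih =>
    have h5 : levelFilter (filterPoly q) s (t :: ts) lam =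
        (filterPoly q).eval (Real.cos ((lam - s) * t / 2)) *
          levelFilter (filterPoly q) s ts lam := by
      simp [levelFilter]
    have h4 := filterPoly_eval_cos_mem q ((lam - s) * t / 2)
    have h3 := levelFilter_mem q s lam ts
    rw [h5]
    obtain ⟨u, hu, hu1, hu2⟩ := h
    rcases List.mem_cons.1 hu with rfl | hu
    · exact (mul_le_of_le_one_right h4.1 h3.2).trans ((filterPoly_eval_cos_le q hu1 hu2).trans hη)
    · exact (mul_le_of_le_one_left h3.1 h4.2).trans (ih ⟨u, hu, hu1, hu2⟩)

end

section
variable {n : ℕ}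

theorem eigenvalue_le_norm {H : Op (Fin n)} {lam : ℝ} {v : Ket (Fin n)} (hv0 : v ≠ 0)
    (hv : act H v = (lam : ℂ) • v) : lam ≤ ‖H‖ := by
  have h := norm_act_le H v
  rw [hv, norm_smul, Complex.norm_real] at h
  exact (le_abs_self lam).trans (le_of_mul_le_mul_right h (norm_pos_iff.2 hv0))

theorem eigenvalue_nonneg {H : Op (Fin n)} (hH : H.PosSemidef) {lam : ℝ} {v : Ket (Fin n)}
    (hv0 : v ≠ 0) (hv : act H v = (lam : ℂ) • v) : 0 ≤ lam := by
  have h := hH.re_dotProduct_nonneg v.ofLp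
  rw [← Matrix.ofLp_toEuclideanCLM (𝕜 := ℂ) H v, dotProduct_comm,
    ← EuclideanSpace.inner_eq_star_dotProduct, show Matrix.toEuclideanCLM (𝕜 := ℂ) H v = _ from hv,
    inner_smul_right, inner_self_eq_norm_sq_to_K] at h
  have h2 : 0 ≤ lam * ‖v‖ ^ 2 := by
    norm_cast at h
    rw [RCLike.re_eq_complex_re, Complex.re_ofReal_mul] at h
    exact h
  exact nonneg_of_mul_nonneg_left h2 (by have := norm_pos_iff.2 hv0; positivity)

/-- The failure probability after all runs: `(1 - p) ^ N ≤ e^{-p N} ≤ e^{-2}` for the success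
probability `p = (15γ/16)²` of one run. -/
theorem failure_pow_le {γ : ℝ} (hγ : 0 < γ) (hγ1 : γ ≤ 1) {N : ℕ} (hN : 3 / γ ^ 2 ≤ N) :
    (1 - (15 / 16 * γ) ^ 2) ^ N ≤ 1 / 3 := by
  have hγ2 : γ ^ 2 ≤ 1 := pow_le_one₀ hγ.le hγ1
  rw [div_le_iff₀ (by positivity)] at hN
  have h1 : (1 - (15 / 16 * γ) ^ 2) ^ N ≤ Real.exp (-(15 / 16 * γ) ^ 2) ^ N := by
    refine pow_le_pow_left₀ (by linarith) ?_ N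
    have := Real.add_one_le_exp (-(15 / 16 * γ) ^ 2)
    linarith
  have h2 : Real.exp (-(15 / 16 * γ) ^ 2) ^ N ≤ Real.exp (-(2 : ℝ)) := by
    rw [← Real.exp_nat_mul, Real.exp_le_exp]
    linarith
  have h3 : Real.exp (-(2 : ℝ)) ≤ 1 / 3 := by
    rw [Real.exp_neg, one_div]
    apply inv_anti₀ (by norm_num)
    have := Real.add_one_le_exp (2 : ℝ)
    linarith
  exact (h1.trans h2).trans h3

/-- Success probability and fidelity for suitable phases, with the shift `s` chosen such that the
ground-state energy lies in `[s, s + Δ/2]` and all excited energies are at least `s + 3Δ/2`. -/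
theorem multiLevel_success {R Δ μ E γ ε : ℝ} (hR : 0 < R) (hΔ : 0 < Δ) (hγ : 0 < γ) (hγ1 : γ ≤ 1)
    (hε : 0 < ε) (hε1 : ε < 1) (hL : 0 < Real.logb 2 (Real.pi * R / (4 * Δ))) {q : ℕ}
    (hq : 0.97 ^ q ≤ γ * ε / (64 * stopLevel R Δ)) {φ : ℕ → ℝ}
    (hφ : ∀ ω : ℝ, qspMat φ ω (2 * (4 * q)) false false = ((filterPoly q).eval (Real.cos ω) : ℝ))
    {N : ℕ} (hN : 3 / γ ^ 2 ≤ N) {δ : ℝ} (hδ : 0 < δ)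
    (hδ' : stopLevel R Δ * (6 * (4 * q : ℕ) + 1) * δ ≤ γ * ε / 64)
    {H : Op (Fin n)} {lam : ℝ} {psi : Ket (Fin n)} {OI : Op (Fin n)} {O : ℝ → Op (Fin n)}
    (hH : H.PosSemidef) (hHR : ‖H‖ = R) (hg : IsGappedGroundState H μ Δ lam psi)
    (hE : E ≤ lam) (hE' : lam ≤ E + Δ / 2) (hOI : OI ∈ Matrix.unitaryGroup (Fin n → Bool) ℂ)
    (hγ' : ‖inner ℂ (act OI (ketZero (Fin n))) psi‖ = γ)
    (hO : ∀ t, O t ∈ Matrix.unitaryGroup (Fin n → Bool) ℂ)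
    (hOacc : ∀ t, |t| ≤ levelTime R (stopLevel R Δ) → ‖O t - evolution H t‖ ≤ δ) :
    2 / 3 ≤ (multiLevel O (min (μ - Δ) E) (4 * q) φ (levelTimes R Δ) N).successProb OI ∧
    1 - ε ≤ (multiLevel O (min (μ - Δ) E) (4 * q) φ (levelTimes R Δ) N).fidelity OI psi := by
  set s := min (μ - Δ) E with hs
  set η := γ * ε / (64 * stopLevel R Δ) with hη
  have hLpos : (0 : ℝ) < stopLevel R Δ := by exact_mod_cast stopLevel_pos hL
  have hL1 : (1 : ℝ) ≤ stopLevel R Δ := by exact_mod_cast stopLevel_pos hL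
  have hη0 : 0 ≤ η := by positivity
  have hLη : stopLevel R Δ * η = γ * ε / 64 := by rw [hη]; field_simp
  have hηle : η ≤ γ * ε / 64 := by rw [← hLη]; nlinarith
  have hγε : γ * ε ≤ 1 := mul_le_one₀ hγ1 hε.le hε1.le
  have hpsi0 : psi ≠ 0 := by
    intro h; have := hg.norm_eq; rw [h, norm_zero] at this; exact zero_ne_one this
  have hlam0 := eigenvalue_nonneg hH hpsi0 hg.eigen
  have hgl := hg.ground_le
  -- the ground energy lies in `[s, s + Δ/2]`, the excited ones in `[s + 3Δ/2, s + R + Δ/2]`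
  have hs1 : 0 ≤ lam - s := sub_nonneg.2 ((min_le_right _ _).trans hE)
  have hs2 : lam - s ≤ Δ / 2 := by
    rcases min_cases (μ - Δ) E with h | h <;> rw [hs, h.1] <;> linarith
  have hs3 : -(Δ / 2) ≤ s := le_min (by linarith) (by linarith)
  have hs4 : s ≤ μ - Δ := min_le_left _ _
  have hd : ∀ (lam' : ℝ) (v : Ket (Fin n)), v ≠ 0 → act H v = (lam' : ℂ) • v → μ + Δ / 2 ≤ lam' →
      |levelFilter (filterPoly q) s (levelTimes R Δ) lam'| ≤ η := by
    intro lam' v hv0 hv hge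
    apply levelFilter_le q hq
    have hle := eigenvalue_le_norm hv0 hv
    exact exists_excited_angle hR hΔ hL (by linarith) (by linarith)
  have hground := levelFilter_ge q hq (by linarith) (ground_angle_le hR hΔ hL hs1 hs2)
  rw [length_levelTimes, hLη] at hground
  set v := act OI (ketZero (Fin n)) with hv
  have hv1 : ‖v‖ = 1 := by rw [hv, norm_act_of_unitary hOI, norm_ketZero]
  have hstart : act (tensorOp 1 OI) (ketZero (Option (Fin n))) =
      ketTensor (Pi.single false 1) v := by
    rw [ketZero_eq_ketTensor, act_tensorOp_ketTensor, Matrix.one_mulVec]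
  have hideal := norm_act_successOp_evolution_sub_le hφ hH.1 hg hΔ s (levelTimes R Δ) hη0 hd v
  have hpert := norm_successOp_sub_le hO (fun t => evolution_mem_unitaryGroup H hH.1 t) s (4 * q) φ
    hδ.le (levelTimes R Δ) (fun t ht => by
      obtain ⟨l, hl, rfl⟩ := List.mem_map.1 ht
      have h1 := levelTime_le_last hR (List.mem_range.1 hl)
      have h0 : 0 ≤ levelTime R (l + 1) := by rw [levelTime]; positivity
      exact ⟨hOacc _ (by rwa [abs_of_nonneg h0]), hOacc _ (by rwa [abs_neg, abs_of_nonneg h0])⟩)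
    (ketTensor (Pi.single false 1) v) (ketTensor (Pi.single false 1) v)
  rw [norm_ketTensor_false, hv1, sub_self, norm_zero, add_zero, mul_one, length_levelTimes] at hpert
  rw [hv1, mul_one] at hideal
  have hclose := norm_sub_le_norm_sub_add_norm_sub
    (act (successOp O s (4 * q) φ (levelTimes R Δ)) (ketTensor (Pi.single false 1) v))
    (act (successOp (evolution H) s (4 * q) φ (levelTimes R Δ)) (ketTensor (Pi.single false 1) v))
    (ketTensor (Pi.single false 1)
      (((levelFilter (filterPoly q) s (levelTimes R Δ) lam : ℂ) * inner ℂ psi v) • psi))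
  have hN0 : N ≠ 0 := by
    rintro rfl
    rw [Nat.cast_zero] at hN
    have : 0 < 3 / γ ^ 2 := by positivity
    linarith
  set a : ℂ := (levelFilter (filterPoly q) s (levelTimes R Δ) lam : ℂ) * inner ℂ psi v with ha
  -- the accepted amplitude is at least `63γ/64`, which leaves room for the error `γε/32`
  have hnorm : 15 / 16 * γ + γ * ε / 32 ≤ ‖a‖ := by
    have h1 : (63 / 64 : ℝ) * γ ≤ ‖a‖ := by
      rw [ha, norm_mul, norm_inner_symm, hγ', Complex.norm_real, Real.norm_eq_abs,
        abs_of_nonneg (levelFilter_mem q s lam _).1]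
      gcongr
      linarith
    have h2 : γ * ε ≤ γ := mul_le_of_le_one_right hγ.le hε1.le
    linarith
  -- filter error and evolution error contribute `γε/64` each
  have hclose' : ‖act (successOp O s (4 * q) φ (levelTimes R Δ)) (act (tensorOp 1 OI) (ketZero _)) -
      ketTensor (Pi.single false 1) (a • psi)‖ ≤ γ * ε / 32 := by
    rw [hstart]
    linarith
  have hmain := successProb_fidelity_of_close hO hOI hg.norm_eq (levelTimes R Δ) hN0
    (by positivity) hnorm hclose'
  refine ⟨le_trans ?_ hmain.1, le_trans ?_ hmain.2⟩
  · linarith [failure_pow_le hγ hγ1 hN]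
  · have h1 : (γ * ε / 32) ^ 2 / (15 / 16 * γ) ^ 2 = ε * (ε / 900) := by field_simp; norm_num
    have h2 : ε * (ε / 900) ≤ ε := mul_le_of_le_one_right hε.le (by linarith)
    linarith

end

/-! ### Circuits for controlled operators -/

/-- Unitary diagonalization of a unitary matrix, reduced to the spectral theorem for Hermitian
matrices by taking a logarithm. -/
theorem exists_diagonalization {κ : Type} [Fintype κ] [DecidableEq κ] (u : Matrix κ κ ℂ)
    (hu : u ∈ Matrix.unitaryGroup κ ℂ) :
    ∃ (V : Matrix κ κ ℂ) (d : κ → ℂ), V ∈ Matrix.unitaryGroup κ ℂ ∧ (∀ i, ‖d i‖ = 1) ∧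
      u = V * Matrix.diagonal d * star V := by
  have hn : IsStarNormal u := ⟨by
    rw [Commute, SemiconjBy, Matrix.mem_unitaryGroup_iff'.1 hu,
      Matrix.mem_unitaryGroup_iff.1 hu]⟩
  have hfin : (spectrum ℂ u).Finite := Matrix.finite_spectrum u
  have hc : ∀ f : ℂ → ℂ, ContinuousOn f (spectrum ℂ u) := fun f => hfin.continuousOn f
  -- `u = exp (i A)` for the Hermitian matrix `A = arg u`
  set A : Matrix κ κ ℂ := cfc (fun z : ℂ => (Complex.arg z : ℂ)) u with hA
  have hAH : A.IsHermitian := by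
    change star A = A
    rw [hA, ← cfc_star]
    simp
  have huA : u = NormedSpace.exp (Complex.I • A) := by
    rw [hA, ← cfc_smul _ _ u (hc _), ← CFC.complex_exp_eq_normedSpace_exp,
      ← cfc_comp' _ _ u Complex.continuous_exp.continuousOn (hc _)]
    conv_lhs => rw [← cfc_id ℂ u]
    apply cfc_congr
    intro z hz
    have hz1 : ‖z‖ = 1 := by simpa using spectrum.subset_circle_of_unitary hu hz
    have h := Complex.norm_mul_exp_arg_mul_I z
    simp only [hz1, Complex.ofReal_one, one_mul] at h
    simpa [mul_comm] using h.symm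
  have hs := hAH.spectral_theorem
  rw [Unitary.conjStarAlgAut_apply] at hs
  set V := hAH.eigenvectorUnitary
  have hVinv : (V : Matrix κ κ ℂ)⁻¹ = star (V : Matrix κ κ ℂ) :=
    Matrix.inv_eq_right_inv (Matrix.mem_unitaryGroup_iff.1 V.2)
  have hVunit : IsUnit (V : Matrix κ κ ℂ) :=
    ⟨⟨V, star V, Matrix.mem_unitaryGroup_iff.1 V.2, Matrix.mem_unitaryGroup_iff'.1 V.2⟩, rfl⟩
  refine ⟨V, fun i => Complex.exp (hAH.eigenvalues i * Complex.I), V.2, fun i => ?_, ?_⟩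
  · exact Complex.norm_exp_ofReal_mul_I _
  · have h1 : Complex.I • A =
        V * Matrix.diagonal (fun i => (hAH.eigenvalues i : ℂ) * Complex.I) *
          (V : Matrix κ κ ℂ)⁻¹ := by
      conv_lhs => rw [hs]
      rw [hVinv, ← smul_mul_assoc, ← mul_smul_comm, ← Matrix.diagonal_smul]
      congr 3
      ext i
      simp [mul_comm]
    rw [huA, h1, Matrix.exp_conj _ _ hVunit, Matrix.exp_diagonal, hVinv]
    congr 3
    ext i
    rw [Pi.coe_exp, ← Complex.exp_eq_exp_ℂ]

section
variable {ι : Type} [Fintype ι] [DecidableEq ι]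

theorem embed_apply {k : ℕ} (e : Fin k ↪ ι) (u : Op (Fin k)) (x y : ι → Bool) :
    embed e u x y =
      if ∀ i, (∀ j, e j ≠ i) → x i = y i then u (fun j => x (e j)) (fun j => y (e j)) else 0 := rfl

theorem embed_mul {k : ℕ} (e : Fin k ↪ ι) (u v : Op (Fin k)) :
    embed e (u * v) = embed e u * embed e v := by
  ext x y
  -- the basis state that agrees with `z` on the wires and with `x` elsewhere
  let glue : (Fin k → Bool) → ι → Bool := fun z i =>
    if h : ∃ j, e j = i then z h.choose else x i
  have hglue : ∀ z j, glue z (e j) = z j := by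
    intro z j
    have h : ∃ j', e j' = e j := ⟨j, rfl⟩
    simp only [glue, dif_pos h]
    rw [e.injective h.choose_spec]
  have hoff : ∀ z i, (∀ j, e j ≠ i) → glue z i = x i := by
    intro z i hi
    have h : ¬ ∃ j, e j = i := by rintro ⟨j, hj⟩; exact hi j hj
    simp only [glue, dif_neg h]
  rw [Matrix.mul_apply]
  have hinj : Function.Injective glue := by
    intro z z' h
    ext j
    rw [← hglue z j, h, hglue]
  rw [← Finset.sum_subset (Finset.subset_univ (Finset.univ.image glue)),
    Finset.sum_image hinj.injOn]
  · rw [embed_apply, Matrix.mul_apply]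
    split_ifs with h
    · refine Finset.sum_congr rfl fun z _ => ?_
      rw [embed_apply, embed_apply, if_pos fun i hi => (hoff z i hi).symm,
        if_pos fun i hi => (hoff z i hi).trans (h i hi)]
      simp only [hglue]
    · symm
      refine Finset.sum_eq_zero fun z _ => ?_
      rw [embed_apply e v, if_neg, mul_zero]
      exact fun h' => h fun i hi => (hoff z i hi).symm.trans (h' i hi)
  · intro w _ hw
    rw [embed_apply, if_neg, zero_mul]
    intro h
    apply hw
    rw [Finset.mem_image]
    refine ⟨fun j => w (e j), Finset.mem_univ _, ?_⟩
    ext i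
    by_cases hi : ∃ j, e j = i
    · obtain ⟨j, rfl⟩ := hi
      exact hglue (fun j => w (e j)) j
    · push Not at hi
      exact (hoff (fun j => w (e j)) i hi).trans (h i hi)

theorem embed_diagonal {k : ℕ} (e : Fin k ↪ ι) (d : (Fin k → Bool) → ℂ) :
    embed e (Matrix.diagonal d) = Matrix.diagonal fun x => d fun j => x (e j) := by
  ext x y
  rw [embed_apply, Matrix.diagonal_apply, Matrix.diagonal_apply]
  by_cases h : x = y
  · simp [h]
  · rw [if_neg h]
    split_ifs with h1 h2
    · exact absurd (funext fun i => by
        by_cases hi : ∃ j, e j = i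
        · obtain ⟨j, rfl⟩ := hi
          exact congrFun h2 j
        · push Not at hi
          exact h1 i hi) h
    · rfl
    · rfl

theorem circuitOp_append (c c' : List (Gate ι)) :
    circuitOp (c ++ c') = circuitOp c' * circuitOp c := by
  induction c with
  | nil => simp [circuitOp]
  | cons g c ih => rw [List.cons_append, circuitOp, circuitOp, ih, mul_assoc]

theorem gateComplexity_le_length (c : List (Gate ι)) {U : Op ι} (h : circuitOp c = U) :
    gateComplexity U ≤ c.length :=
  iInf_le (fun c : {c : List (Gate ι) // circuitOp c = U} => (c.1.length : ℕ∞)) ⟨c, h⟩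

theorem exists_circuit_of_gateComplexity_le {U : Op ι} {c : ℕ} (h : gateComplexity U ≤ c) :
    ∃ l : List (Gate ι), circuitOp l = U ∧ l.length ≤ c := by
  by_contra hne
  push Not at hne
  have h1 : ((c + 1 : ℕ) : ℕ∞) ≤ gateComplexity U :=
    le_iInf fun l => by exact_mod_cast hne l.1 l.2
  have := h1.trans h
  norm_cast at this
  omega

/-- A diagonal operator that depends on two qubits is an elementary gate. -/
theorem exists_diagonal_gate₂ {a b : ι} (hab : a ≠ b) (d : Bool → Bool → ℂ)
    (hd : ∀ x y, ‖d x y‖ = 1) :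
    ∃ g : Gate ι, embed g.wires g.op = Matrix.diagonal fun x => d (x a) (x b) := by
  refine ⟨⟨2, le_rfl, ⟨![a, b], ?_⟩, Matrix.diagonal fun z => d (z 0) (z 1), ?_⟩, ?_⟩
  · intro i j h
    fin_cases i <;> fin_cases j <;> simp_all [eq_comm]
  · rw [Matrix.mem_unitaryGroup_iff, Matrix.star_eq_conjTranspose, Matrix.diagonal_conjTranspose,
      Matrix.diagonal_mul_diagonal, ← Matrix.diagonal_one]
    congr 1
    ext z
    simp [Complex.mul_conj, Complex.normSq_eq_norm_sq, hd]
  · rw [embed_diagonal]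
    rfl

theorem exists_diagonal_gate₁ (a : ι) (d : Bool → ℂ) (hd : ∀ x, ‖d x‖ = 1) :
    ∃ g : Gate ι, embed g.wires g.op = Matrix.diagonal fun x => d (x a) := by
  refine ⟨⟨1, one_le_two, ⟨fun _ => a, fun i j _ => Subsingleton.elim i j⟩,
    Matrix.diagonal fun z => d (z 0), ?_⟩, ?_⟩
  · rw [Matrix.mem_unitaryGroup_iff, Matrix.star_eq_conjTranspose, Matrix.diagonal_conjTranspose,
      Matrix.diagonal_mul_diagonal, ← Matrix.diagonal_one]
    congr 1
    ext z
    simp [Complex.mul_conj, Complex.normSq_eq_norm_sq, hd]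
  · rw [embed_diagonal]
    rfl

/-- The permutation of basis states that the CNOT gate with control `a` and target `b` applies. -/
def cnotFun {ι : Type} [DecidableEq ι] (a b : ι) (x : ι → Bool) : ι → Bool :=
  Function.update x b (xor (x a) (x b))

theorem cnotFun_involutive {ι : Type} [DecidableEq ι] {a b : ι} (hab : a ≠ b) :
    Function.Involutive (cnotFun a b) := by
  intro x
  ext i
  by_cases hi : i = b
  · subst hi; simp [cnotFun, Function.update_of_ne hab]
  · simp [cnotFun, Function.update_of_ne hi]

theorem exists_cnot_gate {a b : ι} (hab : a ≠ b) :
    ∃ g : Gate ι, ∀ f : (ι → Bool) → ℂ,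
      embed g.wires g.op * Matrix.diagonal f * embed g.wires g.op =
      Matrix.diagonal fun x => f (cnotFun a b x) := by
  let e : Fin 2 ↪ ι := ⟨![a, b], fun i j h => by
    fin_cases i <;> fin_cases j <;> simp_all [eq_comm]⟩
  let u : Op (Fin 2) := Matrix.of fun z w => if z = cnotFun 0 1 w then 1 else 0
  have hu : u ∈ Matrix.unitaryGroup (Fin 2 → Bool) ℂ := by
    rw [Matrix.mem_unitaryGroup_iff]
    ext z w
    rw [Matrix.mul_apply, ← (cnotFun_involutive (zero_ne_one (α := Fin 2))).bijective.sum_comp]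
    have hinv := cnotFun_involutive (zero_ne_one (α := Fin 2))
    simp only [u, Matrix.of_apply, Matrix.star_apply, hinv _, Matrix.one_apply]
    simp
  have hembed : ∀ x y, embed e u x y = if x = cnotFun a b y then 1 else 0 := by
    intro x y
    rw [embed_apply]
    have h1 : x = cnotFun a b y ↔ (∀ i, (∀ j, e j ≠ i) → x i = y i) ∧
        (fun j => x (e j)) = cnotFun 0 1 (fun j => y (e j)) := by
      constructor
      · rintro rfl
        refine ⟨fun i hi => ?_, ?_⟩
        · rw [cnotFun, Function.update_of_ne]
          exact fun h => hi 1 h.symm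
        · ext j
          fin_cases j
          · exact Function.update_of_ne hab _ _
          · exact Function.update_self _ _ _
      · rintro ⟨h1, h2⟩
        have h20 : x a = y a := congrFun h2 0
        have h21 : x b = xor (y a) (y b) := congrFun h2 1
        ext i
        by_cases hib : i = b
        · subst hib; simp [cnotFun, h21]
        · rw [cnotFun, Function.update_of_ne hib]
          by_cases hia : i = a
          · subst hia; exact h20
          · refine h1 i fun j => ?_
            fin_cases j
            · exact fun h => hia h.symm
            · exact fun h => hib h.symm
    by_cases hx : x = cnotFun a b y
    · rw [if_pos hx, if_pos (h1.1 hx).1]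
      simp only [u, Matrix.of_apply, if_pos (h1.1 hx).2]
    · rw [if_neg hx]
      split_ifs with h2
      · simp only [u, Matrix.of_apply]
        rw [if_neg fun h3 => hx (h1.2 ⟨h2, h3⟩)]
      · rfl
  refine ⟨⟨2, le_rfl, e, u, hu⟩, fun f => ?_⟩
  have hinv := cnotFun_involutive hab
  ext x y
  rw [Matrix.mul_apply, Finset.sum_eq_single (cnotFun a b y)]
  · rw [Matrix.mul_diagonal, hembed, hembed, hinv, Matrix.diagonal_apply]
    by_cases h : x = y
    · simp [h]
    · simp [h]
  · intro z _ hz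
    rw [hembed z, if_neg hz, mul_zero]
  · simp

end

section
variable {n : ℕ}

theorem tensorOp_one_embed {k : ℕ} (e : Fin k ↪ Fin n) (u : Op (Fin k)) :
    tensorOp 1 (embed e u) = embed (e.trans .some) u := by
  ext x y
  rw [tensorOp_apply, embed_apply, embed_apply, Matrix.one_apply]
  by_cases h0 : x none = y none
  · have : (∀ i, (∀ j, (e.trans .some) j ≠ i) → x i = y i) ↔
        ∀ i, (∀ j, e j ≠ i) → x (some i) = y (some i) := by
      constructor
      · intro h i hi
        exact h (some i) fun j hj => hi j (Option.some_injective _ hj)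
      · intro h i hi
        cases i with
        | none => exact h0
        | some i => exact h i fun j hj => hi j (congrArg some hj)
    rw [if_pos h0, one_mul]
    split_ifs with h1 h2 h2
    · rfl
    · exact absurd (this.2 h1) h2
    · exact absurd (this.1 h2) h1
    · rfl
  · rw [if_neg h0, zero_mul, if_neg]
    intro h
    exact h0 (h none fun j => by simp)

theorem controlled_diagonal (f : (Fin n → Bool) → ℂ) : controlled (Matrix.diagonal f) =
    Matrix.diagonal fun x => if x none then f (fun i => x (some i)) else 1 := by
  ext x y
  rw [controlled, Matrix.add_apply, tensorOp_apply, tensorOp_apply, Matrix.diagonal_apply,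
    Matrix.diagonal_apply, Matrix.one_apply]
  by_cases h : x = y
  · subst h
    cases hx : x none <;> simp [projBit]
  · rw [if_neg h]
    have h' : x none ≠ y none ∨ (fun i => x (some i)) ≠ fun i => y (some i) := by
      by_contra hc
      push Not at hc
      apply h
      ext q
      cases q with
      | none => exact hc.1
      | some i => exact congrFun hc.2 i
    rcases h' with h' | h'
    · have hp : ∀ b, projBit b (x none) (y none) = 0 := by
        intro b
        cases hx : x none <;> cases hy : y none <;> simp_all [projBit]
      simp [hp]
    · simp [h']

/-- The phases of a diagonal two-qubit gate, controlled by a third qubit, factor into phases that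
depend on two of the bits `c, x`, `c, y` and `c, x ⊕ y`. -/
theorem exists_controlled_phases (d : Bool → Bool → ℂ) (hd : ∀ x y, ‖d x y‖ = 1) :
    ∃ p q r : Bool → Bool → ℂ, (∀ x y, ‖p x y‖ = 1) ∧ (∀ x y, ‖q x y‖ = 1) ∧ (∀ x y, ‖r x y‖ = 1) ∧
      ∀ c x y, (if c then d x y else 1) = p c x * q c y * r c (xor x y) := by
  have hne : ∀ x y, d x y ≠ 0 := fun x y => by rw [← norm_ne_zero_iff, hd]; exact one_ne_zero
  obtain ⟨z, hz⟩ := IsAlgClosed.exists_pow_nat_eq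
    (d true true * d false false / (d true false * d false true)) two_pos
  have hz1 : ‖z‖ = 1 := by
    have := congrArg norm hz
    rw [norm_pow, norm_div, norm_mul, norm_mul, hd, hd, hd, hd, one_mul, div_one] at this
    exact (pow_eq_one_iff_of_nonneg (norm_nonneg _) two_ne_zero).1 this
  have hz0 : z ≠ 0 := by rw [← norm_ne_zero_iff, hz1]; exact one_ne_zero
  -- the phase of `x ⊕ y` contributes twice to `d 1 1 · d 0 0 / (d 1 0 · d 0 1)`, hence the root `z`
  refine ⟨fun c x => if c then (if x then d true false * z else d false false) else 1,
    fun c y => if c then (if y then d false true / d false false * z else 1) else 1,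
    fun c w => if c then (if w then z⁻¹ else 1) else 1, ?_, ?_, ?_, ?_⟩
  · intro c x; cases c <;> cases x <;> simp [hd, hz1]
  · intro c x; cases c <;> cases x <;> simp [hd, hz1]
  · intro c x; cases c <;> cases x <;> simp [hz1]
  · have h1 := hne true false
    have h2 := hne false false
    have h3 := hne false true
    have h4 : d true true = d true false * z * (d false true / d false false * z) := by
      rw [show d true false * z * (d false true / d false false * z) =
        d true false * (d false true / d false false) * z ^ 2 by ring, hz]
      field_simp
    intro c x y
    cases c <;> cases x <;> cases y <;> simp
    · field_simp
    · field_simp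
    · exact h4

/-- The phases of `x ⊕ y` are applied between two CNOT gates, which write this bit temporarily to
the second wire. -/
theorem exists_circuit_controlled_diagonal {k : ℕ} (hk : k ≤ 2) (e : Fin k ↪ Fin n)
    (d : (Fin k → Bool) → ℂ) (hd : ∀ z, ‖d z‖ = 1) :
    ∃ c : List (Gate (Option (Fin n))), c.length ≤ 5 ∧ circuitOp c = Matrix.diagonal fun x =>
      if x none then d (fun j => x (some (e j))) else 1 := by
  interval_cases k
  · obtain ⟨g, hg⟩ := exists_diagonal_gate₁ (none : Option (Fin n))
      (fun c => if c then d Fin.elim0 else 1) (fun c => by cases c <;> simp [hd])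
    refine ⟨[g], by simp, ?_⟩
    rw [circuitOp, circuitOp, one_mul, hg]
    congr 1
    ext x
    rw [Subsingleton.elim (fun j => x (some (e j))) Fin.elim0]
  · obtain ⟨g, hg⟩ := exists_diagonal_gate₂ (a := (none : Option (Fin n))) (b := some (e 0))
      (by simp) (fun c y => if c then d (fun _ => y) else 1) (fun c y => by cases c <;> simp [hd])
    refine ⟨[g], by simp, ?_⟩
    rw [circuitOp, circuitOp, one_mul, hg]
    congr 1
    ext x
    have : (fun j => x (some (e j))) = fun _ => x (some (e 0)) := by
      ext j; rw [Subsingleton.elim j 0]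
    rw [this]
  · obtain ⟨p, q, r, hp, hq, hr, h⟩ := exists_controlled_phases (fun a b => d ![a, b])
      (fun _ _ => hd _)
    have hne : some (e 0) ≠ some (e 1) := by
      intro h'; have := e.injective (Option.some_injective _ h'); simp at this
    obtain ⟨gp, hgp⟩ := exists_diagonal_gate₂ (a := (none : Option (Fin n))) (b := some (e 0))
      (by simp) p hp
    obtain ⟨gq, hgq⟩ := exists_diagonal_gate₂ (a := (none : Option (Fin n))) (b := some (e 1))
      (by simp) q hq
    obtain ⟨gr, hgr⟩ := exists_diagonal_gate₂ (a := (none : Option (Fin n))) (b := some (e 1))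
      (by simp) r hr
    obtain ⟨gc, hgc⟩ := exists_cnot_gate hne
    refine ⟨[gc, gr, gc, gq, gp], by simp, ?_⟩
    simp only [circuitOp, one_mul]
    rw [hgp, hgq, hgr, mul_assoc, mul_assoc, mul_assoc, ← mul_assoc _ _ (embed gc.wires gc.op),
      hgc, Matrix.diagonal_mul_diagonal, Matrix.diagonal_mul_diagonal]
    congr 1
    ext x
    have h2 : (fun j => x (some (e j))) = ![x (some (e 0)), x (some (e 1))] := by
      ext j; fin_cases j <;> rfl
    rw [h2, h, mul_assoc]
    simp [cnotFun]

/-- A controlled elementary gate needs at most seven elementary gates: one diagonalizes the gate,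
and the phases of the controlled diagonal gate are distributed over pairs of qubits. -/
theorem exists_circuit_controlled_gate (g : Gate (Fin n)) :
    ∃ c : List (Gate (Option (Fin n))), c.length ≤ 7 ∧
      circuitOp c = controlled (embed g.wires g.op) := by
  obtain ⟨V, d, hV, hd, hu⟩ := exists_diagonalization g.op g.unitary
  obtain ⟨c, hc, hcd⟩ := exists_circuit_controlled_diagonal g.arity_le g.wires d hd
  refine ⟨⟨_, g.arity_le, g.wires.trans .some, star V, Unitary.star_mem hV⟩ ::
    (c ++ [⟨_, g.arity_le, g.wires.trans .some, V, hV⟩]), by simp; omega, ?_⟩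
  rw [circuitOp, circuitOp_append, hcd, circuitOp, circuitOp, one_mul]
  rw [← tensorOp_one_embed, ← tensorOp_one_embed, hu, embed_mul, embed_mul, embed_diagonal]
  have h1 : embed g.wires V * embed g.wires (star V) = 1 := by
    rw [← embed_mul, Matrix.mem_unitaryGroup_iff.1 hV, ← Matrix.diagonal_one, embed_diagonal,
      Matrix.diagonal_one]
  have h2 := controlled_diagonal fun x : Fin n → Bool => d fun j => x (g.wires j)
  rw [← h2, controlled, controlled, mul_add, add_mul, tensorOp_mul, tensorOp_mul, tensorOp_mul,
    tensorOp_mul, one_mul, mul_one, mul_one, h1, one_mul, mul_one]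

theorem exists_circuit_controlled (c : List (Gate (Fin n))) :
    ∃ c' : List (Gate (Option (Fin n))), c'.length ≤ 7 * c.length ∧
      circuitOp c' = controlled (circuitOp c) := by
  induction c with
  | nil => exact ⟨[], by simp, by rw [circuitOp, circuitOp, controlled_one]⟩
  | cons g c ih =>
    obtain ⟨c₁, h₁, h₁'⟩ := exists_circuit_controlled_gate g
    obtain ⟨c₂, h₂, h₂'⟩ := ih
    refine ⟨c₁ ++ c₂, by simp; omega, ?_⟩
    rw [circuitOp_append, circuitOp, ← controlled_mul, h₁', h₂']

theorem gateComplexity_controlled_le {U : Op (Fin n)} {c : ℕ} (h : gateComplexity U ≤ c) :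
    gateComplexity (controlled U) ≤ (7 * c : ℕ) := by
  obtain ⟨l, rfl, hl⟩ := exists_circuit_of_gateComplexity_le h
  obtain ⟨l', h1, h2⟩ := exists_circuit_controlled l
  refine (gateComplexity_le_length l' h2).trans ?_
  exact_mod_cast h1.trans (by omega)

theorem gateComplexity_tensorOp_le {a : Matrix Bool Bool ℂ} (ha : a ∈ Matrix.unitaryGroup Bool ℂ) :
    gateComplexity (tensorOp a (1 : Op (Fin n))) ≤ (1 : ℕ) := by
  let E : (Fin 1 → Bool) ≃ Bool := Equiv.funUnique (Fin 1) Bool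
  let e : Fin 1 ↪ Option (Fin n) := ⟨fun _ => none, fun i j _ => Subsingleton.elim i j⟩
  have hu : a.submatrix E E ∈ Matrix.unitaryGroup (Fin 1 → Bool) ℂ := by
    rw [Matrix.mem_unitaryGroup_iff, Matrix.star_eq_conjTranspose, Matrix.conjTranspose_submatrix,
      Matrix.submatrix_mul_equiv, ← Matrix.star_eq_conjTranspose, Matrix.mem_unitaryGroup_iff.1 ha,
      Matrix.submatrix_one_equiv]
  refine gateComplexity_le_length [⟨1, one_le_two, e, a.submatrix E E, hu⟩] ?_
  rw [circuitOp, circuitOp, one_mul]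
  ext x y
  rw [embed_apply, tensorOp_apply, Matrix.one_apply]
  have h : (∀ i, (∀ j, e j ≠ i) → x i = y i) ↔ (fun i => x (some i)) = fun i => y (some i) := by
    constructor
    · intro h
      ext i
      exact h (some i) fun j => by simp [e]
    · intro h i hi
      cases i with
      | none => exact absurd rfl (hi 0)
      | some i => exact congrFun h i
  simp only [h, mul_ite, mul_one, mul_zero]
  rfl

end

/-! ### The cost of the multi-level program -/

section
variable {n : ℕ}

theorem queryCount_applyAll (l : List (Op (Option (Fin n)))) (P : Program n) :
    (Program.applyAll l P).queryCount = P.queryCount := by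
  induction l with
  | nil => rfl
  | cons U l ih => exact ih

theorem queryCount_levels_le (O : ℝ → Op (Fin n)) (s : ℝ) (m : ℕ) (φ : ℕ → ℝ) (restart : Program n)
    (ts : List ℝ) : (levels O s m φ restart ts).queryCount ≤ restart.queryCount := by
  induction ts with
  | nil => exact Nat.zero_le _
  | cons t ts ih =>
    rw [levels, queryCount_applyAll, Program.queryCount]
    exact max_le ih le_rfl

theorem queryCount_multiLevel_le (O : ℝ → Op (Fin n)) (s : ℝ) (m : ℕ) (φ : ℕ → ℝ) (ts : List ℝ)
    (N : ℕ) : (multiLevel O s m φ ts N).queryCount ≤ N := by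
  induction N with
  | zero => exact le_rfl
  | succ N ih =>
    rw [multiLevel, Program.queryCount, Program.queryCount]
    exact Nat.succ_le_succ ((queryCount_levels_le O s m φ _ ts).trans ih)

theorem gateCount_applyAll_le {l : List (Op (Option (Fin n)))} {c : ℕ}
    (h : ∀ U ∈ l, gateComplexity U ≤ c) (P : Program n) :
    (Program.applyAll l P).gateCount ≤ (l.length * c : ℕ) + P.gateCount := by
  induction l with
  | nil => simp [Program.applyAll]
  | cons U l ih =>
    have h1 := add_le_add (h U List.mem_cons_self) (ih fun V hV => h V (List.mem_cons_of_mem _ hV))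
    refine h1.trans_eq ?_
    rw [List.length_cons, Nat.succ_mul, ← add_assoc]
    push_cast
    ring

/-- A bound on the number of gates of one level with evolution time `t`, in terms of a bound `c` on
the gate complexity of the evolutions to the times `t` and `-t`. -/
def levelCost (m c : ℕ) : ℕ := (6 * m + 1) * (7 * (1 + c))

theorem gateCount_levels_le {O : ℝ → Op (Fin n)} {ts : List ℝ} {c : ℝ → ℕ}
    (hc : ∀ t ∈ ts, gateComplexity (O t) ≤ c t ∧ gateComplexity (O (-t)) ≤ c t) (s : ℝ) (m : ℕ)
    (φ : ℕ → ℝ) (restart : Program n) : (levels O s m φ restart ts).gateCount ≤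
      ((ts.map fun t => levelCost m (c t)).sum : ℕ) + restart.gateCount := by
  induction ts with
  | nil => simp [levels, Program.gateCount]
  | cons t ts ih =>
    have hrot : ∀ {k : ℕ∞}, k ≤ (1 : ℕ) → k ≤ (7 * (1 + c t) : ℕ) := fun h =>
      h.trans (by exact_mod_cast (by omega : 1 ≤ 7 * (1 + c t)))
    have hctl : ∀ {k : ℕ∞}, k ≤ (7 * c t : ℕ) → k ≤ (7 * (1 + c t) : ℕ) := fun h =>
      h.trans (by exact_mod_cast (by omega : 7 * c t ≤ 7 * (1 + c t)))
    have h1 : ∀ U ∈ qetu O s t m φ, gateComplexity U ≤ (7 * (1 + c t) : ℕ) :=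
      mem_qetu_cases (fun θ => hrot (gateComplexity_tensorOp_le (expX_mem_unitaryGroup θ)))
        (fun θ => hrot (gateComplexity_tensorOp_le (expZ_mem_unitaryGroup θ)))
        (hctl (gateComplexity_controlled_le (hc t List.mem_cons_self).1))
        (hctl (gateComplexity_controlled_le (hc t List.mem_cons_self).2))
    rw [levels]
    refine (gateCount_applyAll_le h1 _).trans ?_
    rw [length_qetu, List.map_cons, List.sum_cons, Nat.cast_add, add_assoc]
    exact add_le_add le_rfl (max_le (ih fun u hu => hc u (List.mem_cons_of_mem _ hu)) le_add_self)

theorem gateCount_multiLevel_le {O : ℝ → Op (Fin n)} {ts : List ℝ} {c : ℝ → ℕ}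
    (hc : ∀ t ∈ ts, gateComplexity (O t) ≤ c t ∧ gateComplexity (O (-t)) ≤ c t) (s : ℝ) (m : ℕ)
    (φ : ℕ → ℝ) (N : ℕ) : (multiLevel O s m φ ts N).gateCount ≤
      (N * (ts.map fun t => levelCost m (c t)).sum : ℕ) := by
  induction N with
  | zero => simp [multiLevel, Program.gateCount]
  | succ N ih =>
    rw [multiLevel, Program.gateCount, Program.gateCount]
    refine (gateCount_levels_le hc s m φ _).trans ((add_le_add le_rfl ih).trans_eq ?_)
    rw [← Nat.cast_add, Nat.succ_mul, add_comm]

theorem exists_gateCount_le {H : Op (Fin n)} {O : ℝ → Op (Fin n)} {τ α δ A C R Δ : ℝ} (hR : 0 < R)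
    (hHR : ‖H‖ = R) (hα : 0 ≤ α) (hA : 0 ≤ A) (hC : 0 ≤ C)
    (hτ : levelTime R (stopLevel R Δ) ≤ τ) (hO : IsFastForwarding H O τ α δ A C) (s : ℝ) (m : ℕ)
    (φ : ℕ → ℝ) (N : ℕ) : ∃ G : ℕ, (multiLevel O s m φ (levelTimes R Δ) N).gateCount ≤ G ∧
      (G : ℝ) ≤ N * ((6 * m + 1) * 7 * ((1 + A * (1 + C)) *
        ∑ l ∈ Finset.range (stopLevel R Δ), ((2 : ℝ) ^ (l + 1)) ^ α)) := by
  have hex : ∀ t : ℝ, ∃ c : ℕ, t ∈ levelTimes R Δ → gateComplexity (O t) ≤ c ∧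
      gateComplexity (O (-t)) ≤ c ∧ (c : ℝ) ≤ A * (C + (t * R) ^ α) := by
    intro t
    by_cases ht : t ∈ levelTimes R Δ
    · obtain ⟨l, hl, rfl⟩ := List.mem_map.1 ht
      have h0 : 0 ≤ levelTime R (l + 1) := by rw [levelTime]; positivity
      have h1 := (levelTime_le_last hR (List.mem_range.1 hl)).trans hτ
      obtain ⟨c₁, hc₁, hb₁⟩ := hO.efficient (levelTime R (l + 1)) (by rwa [abs_of_nonneg h0])
      obtain ⟨c₂, hc₂, hb₂⟩ := hO.efficient (-levelTime R (l + 1))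
        (by rwa [abs_neg, abs_of_nonneg h0])
      rw [abs_neg] at hb₂
      rw [abs_of_nonneg h0, hHR] at hb₁ hb₂
      refine ⟨max c₁ c₂, fun _ => ⟨hc₁.trans ?_, hc₂.trans ?_, ?_⟩⟩
      · exact_mod_cast le_max_left _ _
      · exact_mod_cast le_max_right _ _
      · rw [Nat.cast_max]
        exact max_le hb₁ hb₂
    · exact ⟨0, fun h => absurd h ht⟩
  choose c hc using hex
  refine ⟨_, gateCount_multiLevel_le (fun t ht => ⟨(hc t ht).1, (hc t ht).2.1⟩) s m φ N, ?_⟩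
  rw [Nat.cast_mul]
  refine mul_le_mul_of_nonneg_left ?_ (Nat.cast_nonneg N)
  rw [levelTimes, List.map_map, ← List.sum_toFinset _ List.nodup_range, List.toFinset_range,
    Nat.cast_sum, Finset.mul_sum, Finset.mul_sum]
  refine Finset.sum_le_sum fun l hl => ?_
  have hmem : levelTime R (l + 1) ∈ levelTimes R Δ :=
    List.mem_map.2 ⟨l, List.mem_range.2 (Finset.mem_range.1 hl), rfl⟩
  have h1 := (hc _ hmem).2.2
  have h2 : levelTime R (l + 1) * R = 2 ^ (l + 1) := by rw [levelTime]; field_simp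
  rw [h2] at h1
  have h3 : (1 : ℝ) ≤ ((2 : ℝ) ^ (l + 1)) ^ α :=
    Real.one_le_rpow (one_le_pow₀ one_le_two) hα
  simp only [Function.comp_apply, levelCost]
  push_cast
  rw [mul_assoc (6 * (m : ℝ) + 1)]
  gcongr
  have h4 : 1 + A * C ≤ (1 + A * C) * ((2 : ℝ) ^ (l + 1)) ^ α :=
    le_mul_of_one_le_right (by positivity) h3
  linarith

end

/-! ### Asymptotics -/

/-- The dependence of the number of gates on the spectral gap. -/
def gapScale (α R Δ : ℝ) : ℝ := if α = 0 then Real.log (R / Δ) else (R / Δ) ^ α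

section
variable {R Δ : ℝ}

theorem gapScale_ge {α : ℝ} (hα : 0 ≤ α) (hR : 0 < R) (hΔ : 0 < Δ)
    (hL : 0 < Real.logb 2 (Real.pi * R / (4 * Δ))) : 1 / 5 ≤ gapScale α R Δ := by
  have h1 := four_mul_lt_pi_mul hR hΔ hL
  have hpi := Real.pi_lt_d2
  have hpos : 0 < R / Δ := by positivity
  have h2 : Δ / R ≤ 0.7875 := by
    rw [div_le_iff₀ hR]
    nlinarith
  rw [gapScale]
  split_ifs with h
  · have := Real.one_sub_inv_le_log_of_pos hpos
    rw [inv_div] at this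
    linarith
  · have h3 : 1 ≤ R / Δ := by
      rw [one_le_div hΔ]
      rw [div_le_iff₀ hR] at h2
      linarith
    linarith [Real.one_le_rpow h3 hα]

/-- The evolution times grow geometrically; so their powers add up to a multiple of the last one,
unless the exponent vanishes, when the number of levels counts. -/
theorem exists_sum_le_gapScale {α : ℝ} (hα : 0 ≤ α) : ∃ c : ℝ, 1 ≤ c ∧ ∀ R Δ : ℝ, 0 < R → 0 < Δ →
    0 < Real.logb 2 (Real.pi * R / (4 * Δ)) →
    ∑ l ∈ Finset.range (stopLevel R Δ), ((2 : ℝ) ^ (l + 1)) ^ α ≤ c * gapScale α R Δ := by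
  rcases hα.eq_or_lt with rfl | hα
  · refine ⟨7, by norm_num, fun R Δ hR hΔ hL => ?_⟩
    have hD := gapScale_ge le_rfl hR hΔ hL
    have h1 : (stopLevel R Δ : ℝ) < Real.logb 2 (Real.pi * R / (4 * Δ)) + 1 :=
      Nat.ceil_lt_add_one hL.le
    have h2 : Real.log (Real.pi * R / (4 * Δ)) ≤ gapScale 0 R Δ := by
      rw [gapScale, if_pos rfl]
      apply Real.log_le_log (by positivity)
      rw [div_le_div_iff₀ (by positivity) hΔ]
      have := Real.pi_lt_four
      have : 0 < R * Δ := by positivity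
      nlinarith
    have h3 : Real.logb 2 (Real.pi * R / (4 * Δ)) ≤ 2 * gapScale 0 R Δ := by
      rw [Real.logb, div_le_iff₀ (Real.log_pos one_lt_two)]
      have := Real.log_two_gt_d9
      nlinarith
    simp only [Real.rpow_zero, Finset.sum_const, Finset.card_range, nsmul_eq_mul, mul_one]
    linarith
  · have hb : 1 < (2 : ℝ) ^ α := Real.one_lt_rpow one_lt_two hα
    have hb' : 0 < (2 : ℝ) ^ α - 1 := sub_pos.2 hb
    refine ⟨(2 : ℝ) ^ α * 2 ^ α / (2 ^ α - 1), ?_, fun R Δ hR hΔ hL => ?_⟩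
    · rw [one_le_div hb']
      nlinarith
    have h1 : ∀ l : ℕ, ((2 : ℝ) ^ l) ^ α = ((2 : ℝ) ^ α) ^ l := fun l => by
      rw [← Real.rpow_natCast, ← Real.rpow_mul two_pos.le, mul_comm, Real.rpow_mul two_pos.le,
        Real.rpow_natCast]
    have h2 : ((2 : ℝ) ^ α) ^ stopLevel R Δ ≤ 2 ^ α * (R / Δ) ^ α := by
      rw [← h1, ← Real.mul_rpow two_pos.le (by positivity)]
      refine Real.rpow_le_rpow (by positivity) ((two_pow_stopLevel_lt hR hΔ hL).le.trans ?_) hα.le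
      have h3 : Real.pi * R / (4 * Δ) ≤ R / Δ := by
        rw [div_le_div_iff₀ (by positivity) hΔ]
        have := Real.pi_lt_four
        have : 0 < R * Δ := by positivity
        nlinarith
      linarith
    rw [gapScale, if_neg hα.ne']
    simp only [h1]
    simp only [pow_succ]
    rw [← Finset.sum_mul, geom_sum_eq hb.ne', div_mul_eq_mul_div, div_mul_eq_mul_div]
    refine div_le_div_of_nonneg_right ?_ hb'.le
    nlinarith

end

/-- As `0.97 ≤ e^{-0.03}`, a degree of order `log η⁻¹` gives the filter the precision `η`. -/
theorem pow_ceil_le {η : ℝ} (hη : 0 < η) : (0.97 : ℝ) ^ ⌈Real.log η⁻¹ / 0.03⌉₊ ≤ η := by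
  have h1 : (0.97 : ℝ) ≤ Real.exp (-0.03) := by
    have := Real.add_one_le_exp (-0.03 : ℝ)
    linarith
  refine (pow_le_pow_left₀ (by norm_num) h1 _).trans ?_
  rw [← Real.exp_nat_mul, ← Real.le_log_iff_exp_le hη]
  have h2 := Nat.le_ceil (Real.log η⁻¹ / 0.03)
  rw [div_le_iff₀ (by norm_num)] at h2
  have h3 := Real.log_inv η
  linarith

/-- The degree of the filter is logarithmic in the inverse precision, up to a factor that is
logarithmic in the number of gates. -/
theorem degree_bound {γ ε D L c : ℝ} (hγ : 0 < γ) (hγ1 : γ ≤ 1) (hε : 0 < ε) (hε1 : ε < 1)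
    (hD : 1 / 5 ≤ D) (hL : 1 ≤ L) (hc : 1 ≤ c) (hLD : L ≤ c * D) :
    6 * (4 * ⌈Real.log (γ * ε / (64 * L))⁻¹ / 0.03⌉₊ : ℝ) + 1 ≤
      (800 * (9 + Real.log c) + 25) * ((1 + Real.log ε⁻¹) *
        (1 + Real.log (1 + (γ ^ 2)⁻¹ * D * (1 + Real.log ε⁻¹)))) := by
  set P := Real.log ε⁻¹ with hP
  have hP0 : 0 ≤ P := Real.log_nonneg ((one_le_inv₀ hε).2 hε1.le)
  have hg1 : 1 ≤ (γ ^ 2)⁻¹ := (one_le_inv₀ (by positivity)).2 (pow_le_one₀ hγ.le hγ1)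
  set S := (γ ^ 2)⁻¹ * D * (1 + P) with hS
  have hD0 : 0 < D := by linarith
  have hDS : D ≤ S := by
    have h1 : D ≤ (γ ^ 2)⁻¹ * D := le_mul_of_one_le_left hD0.le hg1
    exact h1.trans (le_mul_of_one_le_right (by positivity) (by linarith))
  have hgS : (γ ^ 2)⁻¹ ≤ 5 * S := by
    have h1 : (γ ^ 2)⁻¹ * (1 / 5) ≤ (γ ^ 2)⁻¹ * D := by gcongr
    have h2 : (γ ^ 2)⁻¹ * D ≤ S := le_mul_of_one_le_right (by positivity) (by linarith)
    linarith
  have hS0 : 0 ≤ S := hD0.le.trans hDS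
  have hlc : 0 ≤ Real.log c := Real.log_nonneg hc
  have hΛ : 0 ≤ Real.log (1 + S) := Real.log_nonneg (by linarith)
  have hlL : Real.log L ≤ Real.log c + Real.log (1 + S) := by
    rw [← Real.log_mul (by linarith) (by linarith)]
    refine Real.log_le_log (by linarith) (hLD.trans ?_)
    gcongr
    linarith
  have hlγ : Real.log γ⁻¹ ≤ 2 + Real.log (1 + S) := by
    have h1 : Real.log γ⁻¹ ≤ Real.log (γ ^ 2)⁻¹ := by
      apply Real.log_le_log (by positivity)
      apply inv_anti₀ (by positivity)
      nlinarith
    have h2 : Real.log (γ ^ 2)⁻¹ ≤ Real.log (5 * (1 + S)) :=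
      Real.log_le_log (by positivity) (by linarith)
    rw [Real.log_mul (by norm_num) (by linarith)] at h2
    have h3 : Real.log 5 ≤ 2 := by
      rw [Real.log_le_iff_le_exp (by norm_num)]
      have h4 : Real.exp 2 = Real.exp 1 * Real.exp 1 := by rw [← Real.exp_add]; norm_num
      have := Real.exp_one_gt_d9
      nlinarith
    linarith
  have hl64 : Real.log 64 ≤ 5 := by
    rw [show (64 : ℝ) = 2 ^ (6 : ℕ) by norm_num, Real.log_pow]
    have := Real.log_two_lt_d9
    push_cast
    linarith
  have hη : Real.log (γ * ε / (64 * L))⁻¹ = Real.log 64 + Real.log L + Real.log γ⁻¹ + P := by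
    rw [hP, inv_div, Real.log_div (by positivity) (by positivity), Real.log_mul (by norm_num)
      (by linarith), Real.log_mul hγ.ne' hε.ne', Real.log_inv, Real.log_inv]
    ring
  have hη0 : 0 ≤ Real.log (γ * ε / (64 * L))⁻¹ := by
    apply Real.log_nonneg
    rw [inv_div, one_le_div (by positivity)]
    have : γ * ε ≤ 1 := mul_le_one₀ hγ1 hε.le hε1.le
    linarith
  have hceil := Nat.ceil_lt_add_one (div_nonneg hη0 (by norm_num : (0 : ℝ) ≤ 0.03))
  have hmain : Real.log (γ * ε / (64 * L))⁻¹ ≤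
      (9 + Real.log c) * ((1 + P) * (1 + Real.log (1 + S))) := by
    rw [hη]
    have h1 : (7 + Real.log c) * 1 ≤ (7 + Real.log c) * ((1 + P) * (1 + Real.log (1 + S))) := by
      gcongr
      nlinarith
    nlinarith
  have h1 : 1 ≤ (1 + P) * (1 + Real.log (1 + S)) := by nlinarith
  have h2 : Real.log (γ * ε / (64 * L))⁻¹ / 0.03 = 100 / 3 * Real.log (γ * ε / (64 * L))⁻¹ := by
    rw [div_eq_iff (by norm_num)]
    ring
  rw [h2] at hceil
  rw [h2]
  linarith

end MultiLevelQSP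

end

theorem mainTheorem4 :
    -- `K₀` is absolute; `K` and the exponent `k` of the logarithm depend on `α` only
    ∃ K₀ : ℝ, 0 < K₀ ∧
    ∀ α : ℝ, 0 ≤ α → α ≤ 1 →
    ∃ (K : ℝ) (k : ℕ), 0 < K ∧
    -- the numbers known to the algorithm: `R = ‖H‖`, the gap `Δ`, its centre `μ`, a reference
    -- energy `E`, the overlap `γ` and the precision `ε`
    ∀ R Δ μ E γ ε : ℝ, 0 < R → 0 < Δ → 0 < γ → γ ≤ 1 → 0 < ε → ε < 1 →
      ε ≤ γ⁻¹ * (Real.logb 2 (Real.pi * R / (4 * Δ)))⁻¹ * Real.log (3 / 2) →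
    -- the algorithm: phase factors and filter polynomial of degree `2 m`, spectral shift `s`,
    -- number of runs `N`, and the precision `δ` demanded from the fast-forwarded evolution
    ∃ (m : ℕ) (φ : ℕ → ℝ) (g : Polynomial ℝ) (s : ℝ) (N : ℕ) (δ : ℝ),
      0 < δ ∧
      (∀ j, j ≤ 2 * m → φ (2 * m - j) = φ j) ∧
      g.natDegree ≤ 2 * m ∧
      IsFilter g (γ * ε) ∧
      QETURealizes m φ g ∧
      ∀ (n : ℕ) (H : Op (Fin n)) (lam : ℝ) (psi : Ket (Fin n)) (OI : Op (Fin n))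
        (O : ℝ → Op (Fin n)) (τ A C : ℝ),
        H.PosSemidef → ‖H‖ = R →
        IsGappedGroundState H μ Δ lam psi →
        E ≤ lam → lam ≤ E + Δ / 2 →
        OI ∈ Matrix.unitaryGroup (Fin n → Bool) ℂ →
        ‖inner ℂ (act OI (ketZero (Fin n))) psi‖ = γ →
        0 ≤ A → 0 ≤ C →
        levelTime R (stopLevel R Δ) ≤ τ →
        IsFastForwarding H O τ α δ A C →
        2 / 3 ≤ (multiLevel O s m φ (levelTimes R Δ) N).successProb OI ∧
        1 - ε ≤ (multiLevel O s m φ (levelTimes R Δ) N).fidelity OI psi ∧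
        ((multiLevel O s m φ (levelTimes R Δ) N).queryCount : ℝ) ≤ K₀ * (γ ^ 2)⁻¹ ∧
        ∃ G : ℕ, (multiLevel O s m φ (levelTimes R Δ) N).gateCount ≤ G ∧
          (G : ℝ) ≤ K * (1 + A * (1 + C)) * (gateScale α R Δ γ ε *
            (1 + Real.log (1 + gateScale α R Δ γ ε)) ^ k) := by
  -- `⌈3/γ²⌉ ≤ 4/γ²`
  refine ⟨4, by norm_num, fun α hα0 hα1 => ?_⟩
  obtain ⟨c, hc, hsum⟩ := exists_sum_le_gapScale hα0
  have hlc : 0 ≤ Real.log c := Real.log_nonneg hc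
  refine ⟨28 * c * (800 * (9 + Real.log c) + 25), 1, by positivity, ?_⟩
  intro R Δ μ E γ ε hR hΔ hγ hγ1 hε hε1 hεL
  -- `‖H‖` is large compared to `Δ`, since otherwise the bound on `ε` would not be positive
  have hL : 0 < Real.logb 2 (Real.pi * R / (4 * Δ)) := by
    by_contra hneg
    have h1 : (Real.logb 2 (Real.pi * R / (4 * Δ)))⁻¹ ≤ 0 := inv_nonpos.2 (not_lt.1 hneg)
    have h2 : γ⁻¹ * (Real.logb 2 (Real.pi * R / (4 * Δ)))⁻¹ * Real.log (3 / 2) ≤ 0 :=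
      mul_nonpos_of_nonpos_of_nonneg (mul_nonpos_of_nonneg_of_nonpos (by positivity) h1)
        (Real.log_nonneg (by norm_num))
    linarith
  have hL1 : (1 : ℝ) ≤ stopLevel R Δ := by exact_mod_cast stopLevel_pos hL
  -- the precision of the filter, such that the errors of all levels add up to `γε/64`
  set η := γ * ε / (64 * stopLevel R Δ) with hη
  have hη0 : 0 < η := by positivity
  have hηle : η ≤ γ * ε := div_le_self (by positivity) (by linarith)
  set q := ⌈Real.log η⁻¹ / 0.03⌉₊ with hq
  have hqη : (0.97 : ℝ) ^ q ≤ η := pow_ceil_le hη0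
  obtain ⟨φ, hsym, hφ⟩ := exists_phases_filterPoly q
  -- a run consists of `stopLevel R Δ` circuits of `6 m + 1` operators each
  set δ := γ * ε / 64 / (stopLevel R Δ * (6 * (4 * q : ℕ) + 1)) with hδ
  have hδ0 : 0 < δ := by positivity
  have hδL : stopLevel R Δ * (6 * (4 * q : ℕ) + 1) * δ ≤ γ * ε / 64 := by
    rw [hδ, mul_div_cancel₀]
    positivity
  have hN : ((⌈3 / γ ^ 2⌉₊ : ℕ) : ℝ) ≤ 4 * (γ ^ 2)⁻¹ := by
    have h1 := Nat.ceil_lt_add_one (by positivity : 0 ≤ 3 / γ ^ 2)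
    have h2 : 1 ≤ (γ ^ 2)⁻¹ := (one_le_inv₀ (by positivity)).2 (pow_le_one₀ hγ.le hγ1)
    rw [div_eq_mul_inv] at h1 ⊢
    linarith
  refine ⟨4 * q, φ, filterPoly q, min (μ - Δ) E, ⌈3 / γ ^ 2⌉₊, δ, hδ0, hsym,
    natDegree_filterPoly_le q, isFilter_filterPoly q (hqη.trans hηle),
    qetuRealizes_of_qspMat hφ, ?_⟩
  intro n H lam psi OI O τ A C hH hHR hg hE hE' hOI hγ' hA hC hτ hO
  obtain ⟨hsucc, hfid⟩ := multiLevel_success hR hΔ hγ hγ1 hε hε1 hL hqη hφ (Nat.le_ceil _) hδ0 hδL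
    hH hHR hg hE hE' hOI hγ' hO.unitary (fun t ht => hO.accurate t (ht.trans hτ))
  refine ⟨hsucc, hfid, le_trans ?_ hN, ?_⟩
  · exact_mod_cast queryCount_multiLevel_le O _ _ φ _ _
  obtain ⟨G, hG, hGle⟩ := exists_gateCount_le hR hHR hα0 hA hC hτ hO (min (μ - Δ) E) (4 * q) φ
    ⌈3 / γ ^ 2⌉₊
  refine ⟨G, hG, hGle.trans ?_⟩
  have hD := gapScale_ge hα0 hR hΔ hL
  have hsumBound := hsum R Δ hR hΔ hL
  have hLsum : (stopLevel R Δ : ℝ) ≤ c * gapScale α R Δ := by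
    refine le_trans ?_ hsumBound
    have h1 : ∀ l ∈ Finset.range (stopLevel R Δ), (1 : ℝ) ≤ ((2 : ℝ) ^ (l + 1)) ^ α :=
      fun l _ => Real.one_le_rpow (one_le_pow₀ one_le_two) hα0
    simpa using Finset.card_nsmul_le_sum _ _ 1 h1
  have hdeg := degree_bound hγ hγ1 hε hε1 hD hL1 hc hLsum
  rw [← hη, ← hq] at hdeg
  have hS : gateScale α R Δ γ ε = (γ ^ 2)⁻¹ * gapScale α R Δ * (1 + Real.log ε⁻¹) := rfl
  have hP0 : 0 ≤ Real.log ε⁻¹ := Real.log_nonneg ((one_le_inv₀ hε).2 hε1.le)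
  rw [hS, pow_one]
  set Λ := 1 + Real.log (1 + (γ ^ 2)⁻¹ * gapScale α R Δ * (1 + Real.log ε⁻¹))
  have hD0 : 0 ≤ gapScale α R Δ := le_trans (by norm_num) hD
  have hΛ : 0 ≤ Λ :=
    add_nonneg zero_le_one (Real.log_nonneg (le_add_of_nonneg_right (by positivity)))
  push_cast
  calc (⌈3 / γ ^ 2⌉₊ : ℝ) * ((6 * (4 * q) + 1) * 7 * ((1 + A * (1 + C)) *
        ∑ l ∈ Finset.range (stopLevel R Δ), ((2 : ℝ) ^ (l + 1)) ^ α))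
      ≤ (4 * (γ ^ 2)⁻¹) * (((800 * (9 + Real.log c) + 25) * ((1 + Real.log ε⁻¹) * Λ)) * 7 *
        ((1 + A * (1 + C)) * (c * gapScale α R Δ))) := by gcongr
    _ = _ := by ring
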